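/- Let $d\ge 1$ be an integer and $\nu\in\mathbf R$. Let $\Sigma$ be the space of functions $\psi:\mathbf R^d\to\mathbf C$ such that $\psi$, $\nabla\psi$ (in the sense of distributions) and $|x|\psi$ belong to $L^2(\mathbf R^d)$, and let $H=-\tfrac12\Delta+\tfrac{|x|^2}{2}$, with quadratic form $\langle H\psi,\psi\rangle=\tfrac12\|\nabla\psi\|_{L^2}^2+\tfrac12\||x|\psi\|_{L^2}^2$ on $\Sigma$. Put $$I(\psi)=\tfrac12\langle H\psi,\psi\rangle-\tfrac{\nu}{2}\|\psi\|_{L^2}^2,\qquad M=\Big\{\psi\in\Sigma:\ \psi \text{ depends only on } |x|,\ \ \frac{1}{1+2/d}\int_{\mathbf R^d}|\psi(x)|^{2+4/d}\,dx=1\Big\}.$$ 1. If $\nu>d/2$, then there is an even function $\psi\in\Sigma\setminus\{0\}$ such that $\nu\psi=H\psi+|\psi|^{4/d}\psi$ in the sense of distributions. 2. If $\nu<d/2$, then there is an even function $\psi\in\Sigma\setminus\{0\}$ such that $(H-\nu)\psi=|\psi|^{4/d}\psi$ in the sense of distributions. Moreover, in both cases $\psi$ can be chosen of the form $\psi=c\,\varphi$,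 where $c>0$ and $\varphi\in M$ minimizes $I$ over $M$ (in particular the minimum is attained). -/

import Mathlib

open MeasureTheory

open scoped ContDiff Laplacian

namespace HarmonicNLS

/-- A real-valued test function on `ℝ^d`: smooth with compact support. -/
def IsTestFun {d : ℕ} (η : EuclideanSpace ℝ (Fin d) → ℝ) : Prop :=
  ContDiff ℝ ∞ η ∧ HasCompactSupport η

/-- `G` is the gradient of `ψ` in the sense of distributions: both are locally integrable and
`∫ (∂_j η) ψ = - ∫ η G_j` for every test function `η` and every coordinate `j`. -/
def IsWeakGrad {d : ℕ} (ψ : EuclideanSpace ℝ (Fin d) → ℂ)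
    (G : EuclideanSpace ℝ (Fin d) → EuclideanSpace ℂ (Fin d)) : Prop :=
  LocallyIntegrable ψ ∧ LocallyIntegrable G ∧
    ∀ η : EuclideanSpace ℝ (Fin d) → ℝ, IsTestFun η → ∀ j : Fin d,
      ∫ x, (fderiv ℝ η x (EuclideanSpace.single j 1)) • ψ x = - ∫ x, η x • G x j

/-- The space `Σ = H¹ ∩ 𝓕(H¹)`: `ψ ∈ L²`, `∇ψ ∈ L²` (weak gradient) and `|x| ψ ∈ L²`. -/
def MemSigma {d : ℕ} (ψ : EuclideanSpace ℝ (Fin d) → ℂ) : Prop :=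
  MemLp ψ 2 ∧ (∃ G, IsWeakGrad ψ G ∧ MemLp G 2) ∧ MemLp (fun x => ‖x‖ • ψ x) 2

open Classical in
/-- The weak gradient of `ψ` (unique up to a null set), and `0` if there is none. -/
noncomputable def weakGrad {d : ℕ} (ψ : EuclideanSpace ℝ (Fin d) → ℂ) :
    EuclideanSpace ℝ (Fin d) → EuclideanSpace ℂ (Fin d) :=
  if h : ∃ G, IsWeakGrad ψ G then h.choose else 0

/-- `Hψ = F` in the sense of distributions, where `H = -½ Δ + |x|²/2`: both functions are locally
integrable and `∫ ψ Hη = ∫ F η` for every test function `η`. -/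
def HarmonicEq {d : ℕ} (ψ F : EuclideanSpace ℝ (Fin d) → ℂ) : Prop :=
  LocallyIntegrable ψ ∧ LocallyIntegrable F ∧
    ∀ η : EuclideanSpace ℝ (Fin d) → ℝ, IsTestFun η →
      ∫ x, (-(1 / 2) * (Δ η) x + ‖x‖ ^ 2 / 2 * η x) • ψ x = ∫ x, η x • F x

/-- The nonlinearity `|ψ|^{4/d} ψ`. -/
noncomputable def nonlin {d : ℕ} (ψ : EuclideanSpace ℝ (Fin d) → ℂ) :
    EuclideanSpace ℝ (Fin d) → ℂ :=
  fun x => ((‖ψ x‖ ^ (4 / (d : ℝ)) : ℝ) : ℂ) * ψ x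

/-- `⟨Hψ, ψ⟩` as a quadratic form on `Σ`: `½ ‖∇ψ‖² + ½ ‖xψ‖²`. -/
noncomputable def formH {d : ℕ} (ψ : EuclideanSpace ℝ (Fin d) → ℂ) : ℝ :=
  1 / 2 * (∫ x, ‖weakGrad ψ x‖ ^ 2) + 1 / 2 * ∫ x, ‖x‖ ^ 2 * ‖ψ x‖ ^ 2

/-- The functional `I(ψ) = ½ ⟨Hψ, ψ⟩ - (ν/2) ⟨ψ, ψ⟩`. -/
noncomputable def energy {d : ℕ} (ν : ℝ) (ψ : EuclideanSpace ℝ (Fin d) → ℂ) : ℝ :=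
  1 / 2 * formH ψ - ν / 2 * ∫ x, ‖ψ x‖ ^ 2

/-- `ψ` depends on `|x|` only. -/
def IsRadial {d : ℕ} (ψ : EuclideanSpace ℝ (Fin d) → ℂ) : Prop :=
  ∃ f : ℝ → ℂ, ∀ x, ψ x = f ‖x‖

/-- The constraint set `M`: radial `ψ ∈ Σ` with `(1 + 2/d)⁻¹ ∫ |ψ|^{2+4/d} = 1`. -/
def constraintSet (d : ℕ) : Set (EuclideanSpace ℝ (Fin d) → ℂ) :=
  {ψ | MemSigma ψ ∧ IsRadial ψ ∧
    1 / (1 + 2 / (d : ℝ)) * ∫ x, ‖ψ x‖ ^ (2 + 4 / (d : ℝ)) = 1}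

/-- `ψ` is a positive multiple of a minimizer of `I` over `M`. -/
def FromMinimizer {d : ℕ} (ν : ℝ) (ψ : EuclideanSpace ℝ (Fin d) → ℂ) : Prop :=
  ∃ φ ∈ constraintSet d, IsMinOn (energy ν) (constraintSet d) φ ∧
    ∃ c : ℝ, 0 < c ∧ ∀ x, ψ x = c • φ x

end HarmonicNLS

namespace HarmonicNLS

open Filter Topology

/-! ### Jensen on probability spaces and measure-preserving shifts -/

section Averages

variable {T : Type*} [MeasurableSpace T] {μ : Measure T} [IsProbabilityMeasure μ]

/-! Write p = 2 + 4/d and c = 1 + 2/d, so that M consists of the radial ψ in Σ with ∫|ψ|^p = c. The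
proof is the direct method, followed by a computation of the sign of the Lagrange multiplier.

A minimizer exists for every ν (`exists_minimizer`). The triples (ψ, ∇ψ, |x|ψ) form a closed
subspace `sigma` of an L² Hilbert space. On M the L² mass is controlled inside a ball by the
constraint and outside it by the weight, so I is bounded below and minimizing sequences are bounded
(`exists_coercive`). A weak limit of such a sequence stays in the closed subspace of radial
elements. Weakly null bounded sequences of Σ tend to zero in L² and in L^p
(`tendsto_of_weakly_null`), so the constraint survives in the limit and I does not increase. This
compactness comes from the weight |x|, not from radial symmetry.

Both convergences rest on one estimate: the mean square oscillation of u on balls of radius ε has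
integral at most ε²‖∇u‖² (`IsWeakGrad.lintegral_oscSq_le`). For L², ball averages of a weakly null
sequence tend to zero pointwise, and the oscillation is small with ε. For L^p, the same estimate on
the dyadic levels of |u|, with a radius adapted to each level, bounds u in L^r for some r > p
(`exists_sobolev_bound`); interpolation between L² and L^r then suffices.

Let m = I(φ) be the minimum. Since I is homogeneous of degree 2 and ∫|f|^p of degree p, I(f) ≥ m
(∫|f|^p / c)^(2/p) for radial f with ∫|f|^p > 0, with equality at φ. Differentiating gives Hφ = νφ +
(2m/c)|φ|^(4/d)φ tested against radial directions, and `symmetric_criticality` extends it to all of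
Σ. Multiplying φ by k > 0 with k^(4/d) = 2|m|/c turns the coefficient into the sign of m. If ν >
d/2, the Gaussian exp(-|x|²/2) shows m < 0; if ν < d/2, the bound H ≥ d/2
(`IsWeakGrad.ground_state_bound`) shows m > 0. Evenness is a consequence of radial symmetry. -/

theorem lintegral_rpow_le_lintegral_rpow {q r : ℝ} (hq : 0 < q) (hqr : q ≤ r) {f : T → ENNReal}
    (hf : AEMeasurable f μ) :
    (∫⁻ t, f t ^ q ∂μ) ≤ (∫⁻ t, f t ^ r ∂μ) ^ (q / r) := by
  have h := eLpNorm'_le_eLpNorm'_of_exponent_le hq hqr μ hf.aestronglyMeasurable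
  simp only [eLpNorm', enorm_eq_self] at h
  have h2 := ENNReal.rpow_le_rpow h hq.le
  rw [← ENNReal.rpow_mul, ← ENNReal.rpow_mul, one_div_mul_cancel hq.ne', ENNReal.rpow_one] at h2
  rwa [div_eq_mul_inv, mul_comm, ← one_div]

theorem enorm_integral_sq_le {F : Type*} [NormedAddCommGroup F] [NormedSpace ℝ F] {f : T → F}
    (hf : AEStronglyMeasurable f μ) :
    ‖∫ t, f t ∂μ‖ₑ ^ 2 ≤ ∫⁻ t, ‖f t‖ₑ ^ 2 ∂μ := by
  have h1 := enorm_integral_le_lintegral_enorm (μ := μ) f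
  have h2 := lintegral_rpow_le_lintegral_rpow (μ := μ) one_pos one_le_two hf.enorm
  simp only [ENNReal.rpow_one] at h2
  calc ‖∫ t, f t ∂μ‖ₑ ^ 2 ≤ ((∫⁻ t, ‖f t‖ₑ ^ (2 : ℝ) ∂μ) ^ ((1 : ℝ) / 2)) ^ 2 := by
        gcongr; exact h1.trans h2
    _ = ∫⁻ t, ‖f t‖ₑ ^ 2 ∂μ := by
        rw [← ENNReal.rpow_natCast, ← ENNReal.rpow_mul]; norm_num

variable {E : Type*} [MeasurableSpace E] [AddCommGroup E] [MeasurableAdd₂ E] {ν : Measure E}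
  [SFinite ν] [ν.IsAddRightInvariant]

/-- Functions known only almost everywhere on `E` pull back along such a map to the product, with
measurability and `L^p` norms intact. All Fubini arguments on translates rely on this. -/
theorem measurePreserving_add_of_prod {φ : T → E} (hφ : Measurable φ) :
    MeasurePreserving (fun z : T × E => z.2 + φ z.1) (μ.prod ν) ν := by
  have h1 : MeasurePreserving (fun z : T × E => (z.1, z.2 + φ z.1)) (μ.prod ν) (μ.prod ν) := by
    refine (MeasurePreserving.id μ).skew_product (g := fun t x => x + φ t) ?_ ?_
    · exact measurable_snd.add (hφ.comp measurable_fst)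
    · exact Eventually.of_forall fun t => map_add_right_eq_self ν (φ t)
  exact measurePreserving_snd.comp h1

end Averages

/-! ### Weak derivatives and translates -/

variable {d : ℕ}

theorem IsTestFun.integrable_smul {F : Type*} [NormedAddCommGroup F] [NormedSpace ℝ F]
    {η : EuclideanSpace ℝ (Fin d) → ℝ} (hη : IsTestFun η) {u : EuclideanSpace ℝ (Fin d) → F}
    (hu : LocallyIntegrable u) : Integrable (fun x => η x • u x) :=
  hu.integrable_smul_left_of_hasCompactSupport hη.1.continuous hη.2

theorem IsTestFun.fderiv_apply {η : EuclideanSpace ℝ (Fin d) → ℝ} (hη : IsTestFun η)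
    (h : EuclideanSpace ℝ (Fin d)) : IsTestFun (fun x => fderiv ℝ η x h) := by
  refine ⟨?_, hη.2.fderiv_apply (𝕜 := ℝ) h⟩
  exact (hη.1.fderiv_right (m := ∞) (by simp)).clm_apply contDiff_const

theorem IsTestFun.comp_add {η : EuclideanSpace ℝ (Fin d) → ℝ} (hη : IsTestFun η)
    (h : EuclideanSpace ℝ (Fin d)) : IsTestFun (fun x => η (x + h)) :=
  ⟨hη.1.comp (contDiff_id.add contDiff_const), hη.2.comp_homeomorph (Homeomorph.addRight h)⟩

theorem memLp_two_locallyIntegrable {F : Type*} [NormedAddCommGroup F]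
    {u : EuclideanSpace ℝ (Fin d) → F} (hu : MemLp u 2) : LocallyIntegrable u :=
  hu.locallyIntegrable one_le_two

theorem memLp_two_of_lintegral_sq_lt_top {α F : Type*} [MeasurableSpace α] {μ : Measure α}
    [NormedAddCommGroup F] {u : α → F} (hu : AEStronglyMeasurable u μ)
    (h : ∫⁻ x, ‖u x‖ₑ ^ 2 ∂μ < ⊤) : MemLp u 2 μ := by
  refine ⟨hu, ?_⟩
  rw [eLpNorm_lt_top_iff_lintegral_rpow_enorm_lt_top (by simp) (by simp)]
  simpa using h

/-- `g` is the derivative of `u` in the direction `h`, in the sense of distributions. -/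
def IsWeakDeriv (h : EuclideanSpace ℝ (Fin d)) (u g : EuclideanSpace ℝ (Fin d) → ℂ) : Prop :=
  ∀ η : EuclideanSpace ℝ (Fin d) → ℝ, IsTestFun η →
    ∫ x, (fderiv ℝ η x h) • u x = - ∫ x, η x • g x

theorem locallyIntegrable_coord {G : EuclideanSpace ℝ (Fin d) → EuclideanSpace ℂ (Fin d)}
    (hG : LocallyIntegrable G) (j : Fin d) : LocallyIntegrable (fun x => G x j) := by
  intro x
  obtain ⟨s, hs, hi⟩ := hG x
  exact ⟨s, hs, (EuclideanSpace.proj (𝕜 := ℂ) j).integrable_comp hi⟩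

theorem IsWeakGrad.isWeakDeriv {u : EuclideanSpace ℝ (Fin d) → ℂ}
    {G : EuclideanSpace ℝ (Fin d) → EuclideanSpace ℂ (Fin d)} (hG : IsWeakGrad u G)
    (h : EuclideanSpace ℝ (Fin d)) : IsWeakDeriv h u (fun x => ∑ j, h j • G x j) := by
  intro η hη
  have e1 : ∀ x, fderiv ℝ η x h = ∑ j, h j * fderiv ℝ η x (EuclideanSpace.single j 1) := by
    intro x
    have : h = ∑ j, h j • EuclideanSpace.single j (1 : ℝ) := by
      have := (EuclideanSpace.basisFun (Fin d) ℝ).sum_repr h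
      simpa using this.symm
    conv_lhs => rw [this]
    simp
  simp_rw [e1, Finset.sum_smul, Finset.smul_sum]
  rw [integral_finsetSum, integral_finsetSum, ← Finset.sum_neg_distrib]
  · refine Finset.sum_congr rfl fun j _ => ?_
    simp_rw [mul_smul]
    rw [integral_smul, hG.2.2 η hη j, smul_neg, ← integral_smul]
    congr 1; refine integral_congr_ae (Eventually.of_forall fun x => ?_)
    exact smul_comm _ _ _
  · intro j _
    exact hη.integrable_smul ((locallyIntegrable_coord hG.2.1 j).smul (h j))
  · intro j _
    simp_rw [mul_smul]
    exact ((hη.fderiv_apply _).integrable_smul hG.1).smul (h j)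

theorem IsWeakGrad.ae_eq {u : EuclideanSpace ℝ (Fin d) → ℂ}
    {G G' : EuclideanSpace ℝ (Fin d) → EuclideanSpace ℂ (Fin d)} (hG : IsWeakGrad u G)
    (hG' : IsWeakGrad u G') : G =ᵐ[volume] G' := by
  have : ∀ j : Fin d, ∀ᵐ x, G x j = G' x j := fun j =>
    ae_eq_of_integral_contDiff_smul_eq (locallyIntegrable_coord hG.2.1 j)
      (locallyIntegrable_coord hG'.2.1 j) fun η h1 h2 => by
        have a := hG.2.2 η ⟨h1, h2⟩ j
        have b := hG'.2.2 η ⟨h1, h2⟩ j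
        exact neg_injective (a.symm.trans b)
  filter_upwards [ae_all_iff.2 this] with x hx
  ext j; exact hx j

/-- Makes an integral along a unit segment an average, to which Jensen applies. -/
instance : IsProbabilityMeasure (volume.restrict (Set.Ioc (0 : ℝ) 1)) := ⟨by simp⟩

theorem IsTestFun.memLp {η : EuclideanSpace ℝ (Fin d) → ℝ} (hη : IsTestFun η) (p : ENNReal) :
    MemLp η p :=
  hη.1.continuous.memLp_of_hasCompactSupport hη.2

theorem integrable_smul_of_memLp_two {α F : Type*} [MeasurableSpace α] {μ : Measure α}
    [NormedAddCommGroup F] [NormedSpace ℝ F] {f : α → ℝ} {g : α → F} (hf : MemLp f 2 μ)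
    (hg : MemLp g 2 μ) : Integrable (fun x => f x • g x) μ :=
  memLp_one_iff_integrable.1 (hg.smul hf)

theorem measurePreserving_add_smul {T : Type*} [MeasurableSpace T] {μ : Measure T}
    [IsProbabilityMeasure μ] {φ : T → EuclideanSpace ℝ (Fin d)} (hφ : Measurable φ) :
    MeasurePreserving (fun z : EuclideanSpace ℝ (Fin d) × T => z.1 + φ z.2)
      (volume.prod μ) volume :=
  (measurePreserving_add_of_prod (ν := volume) (μ := μ) hφ).comp Measure.measurePreserving_swap

theorem IsTestFun.integral_fderiv_segment {η : EuclideanSpace ℝ (Fin d) → ℝ} (hη : IsTestFun η)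
    (x h : EuclideanSpace ℝ (Fin d)) :
    ∫ t in Set.Ioc (0 : ℝ) 1, fderiv ℝ η (x + -(t • h)) h = η x - η (x + -h) := by
  have hd : ∀ t : ℝ, HasDerivAt (fun t : ℝ => η (x + -(t • h)))
      (-(fderiv ℝ η (x + -(t • h)) h)) t := by
    intro t
    have h1 : HasDerivAt (fun t : ℝ => x + -(t • h)) (-h) t := by
      simpa using (((hasDerivAt_id t).smul_const h).neg).const_add x
    have h2 := ((hη.1.differentiable (by simp)) (x + -(t • h))).hasFDerivAt
    have h3 := h2.comp_hasDerivAt t h1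
    rw [map_neg] at h3
    exact h3
  have hc : Continuous fun t : ℝ => -(fderiv ℝ η (x + -(t • h)) h) := by
    have := (hη.fderiv_apply h).1.continuous
    fun_prop
  have := intervalIntegral.integral_eq_sub_of_hasDerivAt (fun t _ => hd t)
    (hc.intervalIntegrable 0 1)
  rw [intervalIntegral.integral_neg, intervalIntegral.integral_of_le zero_le_one] at this
  simp only [zero_smul, neg_zero, add_zero, one_smul] at this
  linarith

theorem IsWeakDeriv.comp_add {h : EuclideanSpace ℝ (Fin d)} {u g : EuclideanSpace ℝ (Fin d) → ℂ}
    (hw : IsWeakDeriv h u g) {η : EuclideanSpace ℝ (Fin d) → ℝ} (hη : IsTestFun η)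
    (a : EuclideanSpace ℝ (Fin d)) :
    ∫ x, (fderiv ℝ η (x + -a) h) • u x = - ∫ x, η x • g (x + a) := by
  have := hw _ (hη.comp_add (-a))
  simp only [fderiv_comp_add_right] at this
  rw [this, ← integral_add_right_eq_self (fun x => η (x + -a) • g x) a]
  simp

theorem integral_smul_comp_add {u : EuclideanSpace ℝ (Fin d) → ℂ}
    {η : EuclideanSpace ℝ (Fin d) → ℝ} (h : EuclideanSpace ℝ (Fin d)) :
    ∫ x, η x • u (x + h) = ∫ x, η (x + -h) • u x := by
  rw [← integral_add_right_eq_self (fun x => η (x + -h) • u x) h]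
  simp

/-- The fundamental theorem of calculus along the segment from x to x + h, proved by duality: after
pairing with a test function, the translation moves onto that function, where the classical theorem
applies, and Fubini moves it back. -/
theorem IsWeakDeriv.translate_ae_eq {h : EuclideanSpace ℝ (Fin d)}
    {u g : EuclideanSpace ℝ (Fin d) → ℂ} (hu : MemLp u 2) (hg : MemLp g 2)
    (hw : IsWeakDeriv h u g) :
    MemLp (fun z : EuclideanSpace ℝ (Fin d) × ℝ => g (z.1 + z.2 • h)) 2
      (volume.prod (volume.restrict (Set.Ioc (0 : ℝ) 1))) ∧
    ∀ᵐ x, u (x + h) - u x = ∫ t in Set.Ioc (0 : ℝ) 1, g (x + t • h) := by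
  set μ : Measure ℝ := volume.restrict (Set.Ioc (0 : ℝ) 1)
  have hA : MemLp (fun z : EuclideanSpace ℝ (Fin d) × ℝ => g (z.1 + z.2 • h)) 2
      (volume.prod μ) :=
    hg.comp_measurePreserving (measurePreserving_add_smul (μ := μ) (φ := fun t => t • h)
      (by fun_prop))
  have huh : MemLp (fun x => u (x + h)) 2 :=
    hu.comp_measurePreserving (measurePreserving_add_right volume h)
  have hWm : AEStronglyMeasurable (fun x => ∫ t, g (x + t • h) ∂μ) volume :=
    hA.1.integral_prod_right'
  have hW : MemLp (fun x => ∫ t, g (x + t • h) ∂μ) 2 := by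
    refine memLp_two_of_lintegral_sq_lt_top hWm ?_
    calc ∫⁻ x, ‖∫ t, g (x + t • h) ∂μ‖ₑ ^ 2
        ≤ ∫⁻ x, ∫⁻ t, ‖g (x + t • h)‖ₑ ^ 2 ∂μ := by
          refine lintegral_mono_ae ?_
          filter_upwards [hA.1.prodMk_left] with x hx
          exact enorm_integral_sq_le hx
      _ = ∫⁻ z : EuclideanSpace ℝ (Fin d) × ℝ, ‖g (z.1 + z.2 • h)‖ₑ ^ 2 ∂(volume.prod μ) :=
          (lintegral_prod _ (hA.1.enorm.pow_const 2)).symm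
      _ < ⊤ := by
          have := lintegral_rpow_enorm_lt_top_of_eLpNorm_lt_top (p := 2) (by simp) (by simp) hA.2
          simpa using this
  refine ⟨hA, ae_eq_of_integral_contDiff_smul_eq
    ((memLp_two_locallyIntegrable huh).sub (memLp_two_locallyIntegrable hu))
    (memLp_two_locallyIntegrable hW) fun η h1 h2 => ?_⟩
  have hη : IsTestFun η := ⟨h1, h2⟩
  have hI2 : Integrable (fun z : EuclideanSpace ℝ (Fin d) × ℝ => η z.1 • g (z.1 + z.2 • h))
      (volume.prod μ) :=
    integrable_smul_of_memLp_two ((hη.memLp 2).comp_measurePreserving measurePreserving_fst) hA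
  have hI1 : Integrable (fun z : EuclideanSpace ℝ (Fin d) × ℝ =>
      fderiv ℝ η (z.1 + -(z.2 • h)) h • u z.1) (volume.prod μ) :=
    integrable_smul_of_memLp_two
      (((hη.fderiv_apply h).memLp 2).comp_measurePreserving
        (measurePreserving_add_smul (μ := μ) (φ := fun t => -(t • h)) (by fun_prop)))
      (hu.comp_measurePreserving measurePreserving_fst)
  calc ∫ x, η x • (u (x + h) - u x)
      = (∫ x, η x • u (x + h)) - ∫ x, η x • u x := by
        simp_rw [smul_sub]
        exact integral_sub (hη.integrable_smul (memLp_two_locallyIntegrable huh))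
          (hη.integrable_smul (memLp_two_locallyIntegrable hu))
    _ = (∫ x, η (x + -h) • u x) - ∫ x, η x • u x := by rw [integral_smul_comp_add]
    _ = -∫ x, (η x - η (x + -h)) • u x := by
        simp_rw [sub_smul]
        rw [integral_sub (hη.integrable_smul (memLp_two_locallyIntegrable hu))
          ((hη.comp_add (-h)).integrable_smul (memLp_two_locallyIntegrable hu))]
        ring
    _ = -∫ x, ∫ t, fderiv ℝ η (x + -(t • h)) h • u x ∂μ := by
        congr 1; refine integral_congr_ae (Eventually.of_forall fun x => ?_)
        simp only []
        rw [integral_smul_const, ← hη.integral_fderiv_segment x h]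
    _ = -∫ t, (∫ x, fderiv ℝ η (x + -(t • h)) h • u x) ∂μ := by
        rw [integral_integral_swap hI1]
    _ = ∫ t, (∫ x, η x • g (x + t • h)) ∂μ := by
        rw [← integral_neg]
        congr 1; ext t
        rw [hw.comp_add hη (t • h), neg_neg]
    _ = ∫ x, ∫ t, η x • g (x + t • h) ∂μ := (integral_integral_swap hI2).symm
    _ = ∫ x, η x • ∫ t, g (x + t • h) ∂μ := by simp_rw [integral_smul]

/-- Jensen on the segment formula, then translation invariance of the integral. -/
theorem IsWeakDeriv.lintegral_translate_sub_le {h : EuclideanSpace ℝ (Fin d)}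
    {u g : EuclideanSpace ℝ (Fin d) → ℂ} (hu : MemLp u 2) (hg : MemLp g 2)
    (hw : IsWeakDeriv h u g) : ∫⁻ x, ‖u (x + h) - u x‖ₑ ^ 2 ≤ ∫⁻ x, ‖g x‖ₑ ^ 2 := by
  obtain ⟨hA, hae⟩ := hw.translate_ae_eq hu hg
  calc ∫⁻ x, ‖u (x + h) - u x‖ₑ ^ 2
      ≤ ∫⁻ x, ∫⁻ t in Set.Ioc (0 : ℝ) 1, ‖g (x + t • h)‖ₑ ^ 2 := by
        refine lintegral_mono_ae ?_
        filter_upwards [hA.1.prodMk_left, hae] with x hx hx2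
        rw [hx2]; exact enorm_integral_sq_le hx
    _ = ∫⁻ z : EuclideanSpace ℝ (Fin d) × ℝ, ‖g (z.1 + z.2 • h)‖ₑ ^ 2
          ∂(volume.prod (volume.restrict (Set.Ioc (0 : ℝ) 1))) :=
        (lintegral_prod _ (hA.1.enorm.pow_const 2)).symm
    _ = ∫⁻ x, ‖g x‖ₑ ^ 2 := by
        have hmp := measurePreserving_add_smul (d := d)
          (μ := volume.restrict (Set.Ioc (0 : ℝ) 1)) (φ := fun t => t • h) (by fun_prop)
        conv_rhs => rw [← hmp.map_eq]
        rw [lintegral_map' _ hmp.measurable.aemeasurable]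
        rw [hmp.map_eq]; exact hg.1.enorm.pow_const 2

theorem integrable_norm_sq {α F : Type*} [MeasurableSpace α] {μ : Measure α}
    [NormedAddCommGroup F] {u : α → F} (hu : MemLp u 2 μ) : Integrable (fun x => ‖u x‖ ^ 2) μ :=
  MemLp.integrable_norm_pow (p := 2) (by exact_mod_cast hu) two_ne_zero

theorem ofReal_integral_sq {α F : Type*} [MeasurableSpace α] {μ : Measure α}
    [NormedAddCommGroup F] {u : α → F} (hu : MemLp u 2 μ) :
    ENNReal.ofReal (∫ x, ‖u x‖ ^ 2 ∂μ) = ∫⁻ x, ‖u x‖ₑ ^ 2 ∂μ := by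
  rw [ofReal_integral_eq_lintegral_ofReal (integrable_norm_sq hu) (ae_of_all _ fun x => by positivity)]
  refine lintegral_congr fun x => ?_
  rw [ENNReal.ofReal_pow (norm_nonneg _), ofReal_norm]

theorem integral_sq_le_of_lintegral_le {α F F' : Type*} [MeasurableSpace α] {μ : Measure α}
    [NormedAddCommGroup F] [NormedAddCommGroup F'] {u : α → F} {v : α → F'} (hu : MemLp u 2 μ)
    (hv : MemLp v 2 μ) (h : ∫⁻ x, ‖u x‖ₑ ^ 2 ∂μ ≤ ∫⁻ x, ‖v x‖ₑ ^ 2 ∂μ) :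
    ∫ x, ‖u x‖ ^ 2 ∂μ ≤ ∫ x, ‖v x‖ ^ 2 ∂μ := by
  rw [← ofReal_integral_sq hu, ← ofReal_integral_sq hv] at h
  exact (ENNReal.ofReal_le_ofReal_iff (integral_nonneg fun x => by positivity)).1 h

theorem IsWeakDeriv.smul {h : EuclideanSpace ℝ (Fin d)} {u g : EuclideanSpace ℝ (Fin d) → ℂ}
    (hw : IsWeakDeriv h u g) (t : ℝ) : IsWeakDeriv (t • h) u (fun x => t • g x) := by
  intro η hη
  have := hw η hη
  simp_rw [map_smul, smul_assoc, integral_smul, this, smul_neg, ← integral_smul]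
  congr 1; refine integral_congr_ae (Eventually.of_forall fun x => ?_)
  exact smul_comm _ _ _

/-! ### The lower bound d/2 for the harmonic oscillator -/

/-- Young's inequality, weighted so that with a = u(x + t e_j) and b = u(x) the integrated right
side, divided by t, tends to a bound in which both terms have coefficient one. -/
theorem uncertainty_pointwise (a b : ℂ) (x t : ℝ) (ht : 0 < t) :
    -(x * (‖a‖ ^ 2 - ‖b‖ ^ 2)) ≤
      t⁻¹ * ‖a - b‖ ^ 2 + t / 2 * (x ^ 2 * ‖a‖ ^ 2 + x ^ 2 * ‖b‖ ^ 2) := by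
  have h1 : |‖a‖ - ‖b‖| ≤ ‖a - b‖ := abs_norm_sub_norm_le a b
  have h2 : -(x * (‖a‖ ^ 2 - ‖b‖ ^ 2)) ≤ ‖a - b‖ * (|x| * (‖a‖ + ‖b‖)) := by
    calc -(x * (‖a‖ ^ 2 - ‖b‖ ^ 2)) ≤ |x * (‖a‖ ^ 2 - ‖b‖ ^ 2)| := neg_le_abs _
      _ = |‖a‖ - ‖b‖| * (|x| * (‖a‖ + ‖b‖)) := by
        rw [show x * (‖a‖ ^ 2 - ‖b‖ ^ 2) = (‖a‖ - ‖b‖) * (x * (‖a‖ + ‖b‖)) by ring, abs_mul,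
          abs_mul, abs_of_nonneg (by positivity : 0 ≤ ‖a‖ + ‖b‖)]
      _ ≤ _ := by gcongr
  have h3 : ∀ p q : ℝ, p * q ≤ t⁻¹ * p ^ 2 + t / 4 * q ^ 2 := by
    intro p q
    have : 0 ≤ t⁻¹ * (p - t / 2 * q) ^ 2 := by positivity
    have e : t⁻¹ * (p - t / 2 * q) ^ 2 = t⁻¹ * p ^ 2 + t / 4 * q ^ 2 - p * q := by
      field_simp; ring
    linarith
  have h4 := h3 ‖a - b‖ (|x| * (‖a‖ + ‖b‖))
  have h5 : (|x| * (‖a‖ + ‖b‖)) ^ 2 ≤ 2 * (x ^ 2 * ‖a‖ ^ 2 + x ^ 2 * ‖b‖ ^ 2) := by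
    rw [mul_pow, sq_abs]
    nlinarith [mul_nonneg (sq_nonneg x) (sq_nonneg (‖a‖ - ‖b‖))]
  nlinarith

/-- The classical proof integrates x_j ∂_j|u|² by parts. Here a finite difference in direction e_j
replaces the derivative, so neither a product rule for weak derivatives nor a density argument is
needed. -/
theorem IsWeakDeriv.integral_sq_le {j : Fin d} {u g : EuclideanSpace ℝ (Fin d) → ℂ}
    (hu : MemLp u 2) (hg : MemLp g 2) (hx : MemLp (fun x => x j • u x) 2)
    (hw : IsWeakDeriv (EuclideanSpace.single j 1) u g) :
    ∫ x, ‖u x‖ ^ 2 ≤ (∫ x, ‖g x‖ ^ 2) + ∫ x, x j ^ 2 * ‖u x‖ ^ 2 := by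
  have i0 : Integrable (fun x => ‖u x‖ ^ 2) := (integrable_norm_sq hu)
  have i2 : Integrable (fun x : EuclideanSpace ℝ (Fin d) => x j ^ 2 * ‖u x‖ ^ 2) := by
    refine (integrable_norm_sq hx).congr (ae_of_all _ fun x => ?_)
    simp [mul_pow]
  have i1 : Integrable (fun x : EuclideanSpace ℝ (Fin d) => x j * ‖u x‖ ^ 2) := by
    refine (i0.add i2).mono' ?_ (ae_of_all _ fun x => ?_)
    · exact (by fun_prop : Measurable fun x : EuclideanSpace ℝ (Fin d) => x j).aestronglyMeasurable.mul
        (hu.1.norm.pow 2)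
    · simp only [Pi.add_apply, norm_mul, norm_pow, Real.norm_eq_abs, abs_norm]
      have : |x j| ≤ 1 + x j ^ 2 := by rw [← sq_abs (x j)]; nlinarith [sq_nonneg (|x j| - 1)]
      nlinarith [sq_nonneg ‖u x‖]
  -- Replacing u by its translate by t e_j changes ∫ x_j|u|² by -t∫|u|². The pointwise inequality
  -- bounds that change, and division by t leaves errors of order t.
  have key : ∀ t : ℝ, 0 < t → ∫ x, ‖u x‖ ^ 2 ≤ (∫ x, ‖g x‖ ^ 2) + (∫ x, x j ^ 2 * ‖u x‖ ^ 2)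
      - t * (∫ x, x j * ‖u x‖ ^ 2) + t ^ 2 / 2 * ∫ x, ‖u x‖ ^ 2 := by
    intro t ht
    set h : EuclideanSpace ℝ (Fin d) := t • EuclideanSpace.single j (1 : ℝ) with hh
    have hhj : h j = t := by simp [hh]
    have huh : MemLp (fun x => u (x + h)) 2 :=
      hu.comp_measurePreserving (measurePreserving_add_right volume h)
    have b1 : ∫ x, ‖u (x + h) - u x‖ ^ 2 ≤ t ^ 2 * ∫ x, ‖g x‖ ^ 2 := by
      have := integral_sq_le_of_lintegral_le (huh.sub hu) (hg.const_smul t)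
        ((hw.smul t).lintegral_translate_sub_le hu (hg.const_smul t))
      simpa [norm_smul, mul_pow, integral_const_mul] using this
    have shift : ∀ F : EuclideanSpace ℝ (Fin d) → ℝ, Integrable F →
        Integrable (fun x => F (x + h)) ∧ ∫ x, F (x + h) = ∫ x, F x := fun F hF =>
      ⟨hF.comp_add_right h, integral_add_right_eq_self F h⟩
    obtain ⟨s1, s1'⟩ := shift (fun x => (x j - t) * ‖u x‖ ^ 2) (by
      refine (i1.sub (i0.const_mul t)).congr (ae_of_all _ fun x => ?_)
      simp only [Pi.sub_apply]; ring)
    obtain ⟨s2, s2'⟩ := shift (fun x => (x j - t) ^ 2 * ‖u x‖ ^ 2) (by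
      refine ((i2.sub (i1.const_mul (2 * t))).add (i0.const_mul (t ^ 2))).congr
        (ae_of_all _ fun x => ?_)
      simp only [Pi.sub_apply, Pi.add_apply]; ring)
    have e1 : ∫ x, (x j - t) * ‖u x‖ ^ 2 = (∫ x, x j * ‖u x‖ ^ 2) - t * ∫ x, ‖u x‖ ^ 2 := by
      rw [← integral_const_mul, ← integral_sub i1 (i0.const_mul t)]
      congr 1; ext x; ring
    have e2 : ∫ x, (x j - t) ^ 2 * ‖u x‖ ^ 2 = (∫ x, x j ^ 2 * ‖u x‖ ^ 2)
        - 2 * t * (∫ x, x j * ‖u x‖ ^ 2) + t ^ 2 * ∫ x, ‖u x‖ ^ 2 := by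
      rw [← integral_const_mul, ← integral_const_mul, ← integral_sub i2 (i1.const_mul _),
        ← integral_add (f := fun x => x j ^ 2 * ‖u x‖ ^ 2 - 2 * t * (x j * ‖u x‖ ^ 2))
          (i2.sub (i1.const_mul _)) (i0.const_mul _)]
      congr 1; ext x; ring
    simp only [PiLp.add_apply, hhj, add_sub_cancel_right] at s1 s1' s2 s2'
    have i3 : Integrable (fun x => ‖u (x + h) - u x‖ ^ 2) := (integrable_norm_sq (huh.sub hu))
    have mono := integral_mono (μ := volume) (s1.sub i1).neg
      ((i3.const_mul t⁻¹).add ((s2.add i2).const_mul (t / 2)))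
      (fun x => by
        have := uncertainty_pointwise (u (x + h)) (u x) (x j) t ht
        simp only [Pi.neg_apply, Pi.sub_apply, Pi.add_apply]
        linarith)
    simp only [Pi.neg_apply, Pi.sub_apply, Pi.add_apply] at mono
    rw [integral_neg, integral_sub s1 i1, integral_add (i3.const_mul _)
      (g := fun x => t / 2 * (x j ^ 2 * ‖u (x + h)‖ ^ 2 + x j ^ 2 * ‖u x‖ ^ 2))
      ((s2.add i2).const_mul _), integral_const_mul, integral_const_mul, integral_add s2 i2, s1', e1, s2', e2] at mono
    have b2 : t⁻¹ * ∫ x, ‖u (x + h) - u x‖ ^ 2 ≤ t * ∫ x, ‖g x‖ ^ 2 := by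
      calc _ ≤ t⁻¹ * (t ^ 2 * ∫ x, ‖g x‖ ^ 2) := by gcongr
        _ = _ := by field_simp
    refine le_of_mul_le_mul_left ?_ ht
    nlinarith
  have lim : Tendsto (fun t : ℝ => (∫ x, ‖g x‖ ^ 2) + (∫ x, x j ^ 2 * ‖u x‖ ^ 2)
      - t * (∫ x, x j * ‖u x‖ ^ 2) + t ^ 2 / 2 * ∫ x, ‖u x‖ ^ 2) (𝓝[>] 0)
      (𝓝 ((∫ x, ‖g x‖ ^ 2) + ∫ x, x j ^ 2 * ‖u x‖ ^ 2)) := by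
    refine tendsto_nhdsWithin_of_tendsto_nhds ?_
    refine Continuous.tendsto' (by fun_prop) _ _ (by simp)
  exact ge_of_tendsto lim (eventually_mem_nhdsWithin.mono fun t ht => key t ht)

theorem memLp_coord {G : EuclideanSpace ℝ (Fin d) → EuclideanSpace ℂ (Fin d)} {p : ENNReal}
    (hG : MemLp G p) (j : Fin d) : MemLp (fun x => G x j) p :=
  (EuclideanSpace.proj (𝕜 := ℂ) j).comp_memLp' hG

theorem IsWeakGrad.isWeakDeriv_single {u : EuclideanSpace ℝ (Fin d) → ℂ}
    {G : EuclideanSpace ℝ (Fin d) → EuclideanSpace ℂ (Fin d)} (hG : IsWeakGrad u G) (j : Fin d) :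
    IsWeakDeriv (EuclideanSpace.single j 1) u (fun x => G x j) :=
  fun η hη => hG.2.2 η hη j

theorem memLp_coord_smul {u : EuclideanSpace ℝ (Fin d) → ℂ} (hu : MemLp u 2)
    (hx : MemLp (fun x => ‖x‖ • u x) 2) (j : Fin d) : MemLp (fun x => x j • u x) 2 := by
  refine hx.mono ?_ (ae_of_all _ fun x => ?_)
  · exact (by fun_prop : Measurable fun x : EuclideanSpace ℝ (Fin d) =>
      x j).aestronglyMeasurable.smul hu.1
  · rw [norm_smul, norm_smul, norm_norm]
    gcongr
    exact PiLp.norm_apply_le x j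

/-- The lower bound `⟨Hψ, ψ⟩ ≥ (d/2) ‖ψ‖²`. -/
theorem IsWeakGrad.ground_state_bound {u : EuclideanSpace ℝ (Fin d) → ℂ}
    {G : EuclideanSpace ℝ (Fin d) → EuclideanSpace ℂ (Fin d)} (hG : IsWeakGrad u G)
    (hu : MemLp u 2) (hG2 : MemLp G 2) (hx : MemLp (fun x => ‖x‖ • u x) 2) :
    d * ∫ x, ‖u x‖ ^ 2 ≤ (∫ x, ‖G x‖ ^ 2) + ∫ x, ‖x‖ ^ 2 * ‖u x‖ ^ 2 := by
  have h := Finset.sum_le_sum fun (j : Fin d) (_ : j ∈ Finset.univ) =>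
    (hG.isWeakDeriv_single j).integral_sq_le hu (memLp_coord hG2 j) (memLp_coord_smul hu hx j)
  have e1 : ∑ j, ∫ x, ‖G x j‖ ^ 2 = ∫ x, ‖G x‖ ^ 2 := by
    rw [← integral_finsetSum _ fun j _ => integrable_norm_sq (memLp_coord hG2 j)]
    simp [EuclideanSpace.norm_sq_eq]
  have e2 : ∑ j : Fin d, ∫ x, x j ^ 2 * ‖u x‖ ^ 2 = ∫ x, ‖x‖ ^ 2 * ‖u x‖ ^ 2 := by
    rw [← integral_finsetSum]
    · simp [EuclideanSpace.norm_sq_eq, Finset.sum_mul]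
    · intro j _
      refine (integrable_norm_sq (memLp_coord_smul hu hx j)).congr (ae_of_all _ fun x => ?_)
      simp [mul_pow]
  rw [Finset.sum_add_distrib, e1, e2] at h
  simpa using h

/-! ### Mean oscillation on small balls -/

theorem norm_sum_smul_le (h : EuclideanSpace ℝ (Fin d)) (v : EuclideanSpace ℂ (Fin d)) :
    ‖∑ j, h j • v j‖ ≤ ‖h‖ * ‖v‖ := by
  calc ‖∑ j, h j • v j‖ ≤ ∑ j, ‖h j‖ * ‖v j‖ := by
        refine (norm_sum_le _ _).trans (Finset.sum_le_sum fun j _ => ?_)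
        rw [norm_smul]
    _ ≤ √(∑ j, ‖h j‖ ^ 2) * √(∑ j, ‖v j‖ ^ 2) := Real.sum_mul_le_sqrt_mul_sqrt _ _ _
    _ = ‖h‖ * ‖v‖ := by rw [EuclideanSpace.norm_eq, EuclideanSpace.norm_eq]

theorem IsWeakGrad.lintegral_translate_sub_le {u : EuclideanSpace ℝ (Fin d) → ℂ}
    {G : EuclideanSpace ℝ (Fin d) → EuclideanSpace ℂ (Fin d)} (hG : IsWeakGrad u G)
    (hu : MemLp u 2) (hG2 : MemLp G 2) (h : EuclideanSpace ℝ (Fin d)) :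
    ∫⁻ x, ‖u (x + h) - u x‖ₑ ^ 2 ≤ ‖h‖ₑ ^ 2 * ∫⁻ x, ‖G x‖ₑ ^ 2 := by
  have hg : MemLp (fun x => ∑ j, h j • G x j) 2 := by
    refine memLp_finsetSum _ fun j _ => (memLp_coord hG2 j).const_smul (h j)
  refine ((hG.isWeakDeriv h).lintegral_translate_sub_le hu hg).trans ?_
  rw [← lintegral_const_mul' _ _ (by finiteness)]
  refine lintegral_mono fun x => ?_
  rw [← mul_pow]
  gcongr
  rw [← ofReal_norm, ← ofReal_norm, ← ofReal_norm,
    ← ENNReal.ofReal_mul (norm_nonneg _)]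
  exact ENNReal.ofReal_le_ofReal (norm_sum_smul_le h (G x))

/-- The uniform probability measure on the ball of radius `ε` about the origin. -/
noncomputable def ballMeasure (d : ℕ) (ε : ℝ) : Measure (EuclideanSpace ℝ (Fin d)) :=
  (volume (Metric.ball (0 : EuclideanSpace ℝ (Fin d)) ε))⁻¹ •
    volume.restrict (Metric.ball (0 : EuclideanSpace ℝ (Fin d)) ε)

theorem isProbabilityMeasure_ballMeasure {ε : ℝ} (hε : 0 < ε) :
    IsProbabilityMeasure (ballMeasure d ε) := by
  constructor
  rw [ballMeasure, Measure.smul_apply, Measure.restrict_apply_univ, smul_eq_mul]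
  exact ENNReal.inv_mul_cancel (Metric.measure_ball_pos _ _ hε).ne' measure_ball_lt_top.ne

theorem lintegral_ballMeasure_le (ε : ℝ) (f : EuclideanSpace ℝ (Fin d) → ENNReal) :
    ∫⁻ h, f h ∂(ballMeasure d ε) ≤
      (volume (Metric.ball (0 : EuclideanSpace ℝ (Fin d)) ε))⁻¹ * ∫⁻ h, f h := by
  rw [ballMeasure, lintegral_smul_measure, smul_eq_mul]
  gcongr
  exact Measure.restrict_le_self

theorem ae_ballMeasure_norm_le (ε : ℝ) : ∀ᵐ h ∂(ballMeasure d ε), ‖h‖ ≤ ε := by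
  refine Measure.ae_smul_measure ?_ _
  filter_upwards [ae_restrict_mem measurableSet_ball] with h hh
  simpa using (mem_ball_zero_iff.1 hh).le

/-- The mean square oscillation of `u` on the ball of radius `ε` about `x`. -/
noncomputable def oscSq (u : EuclideanSpace ℝ (Fin d) → ℂ) (ε : ℝ)
    (x : EuclideanSpace ℝ (Fin d)) : ENNReal :=
  ∫⁻ h, ‖u (x + h) - u x‖ₑ ^ 2 ∂(ballMeasure d ε)

theorem aestronglyMeasurable_comp_add_prod {u : EuclideanSpace ℝ (Fin d) → ℂ} {ε : ℝ}
    (hε : 0 < ε) (hu : AEStronglyMeasurable u) :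
    AEStronglyMeasurable (fun z : EuclideanSpace ℝ (Fin d) × EuclideanSpace ℝ (Fin d) =>
      u (z.1 + z.2)) (volume.prod (ballMeasure d ε)) := by
  have := isProbabilityMeasure_ballMeasure (d := d) hε
  exact hu.comp_measurePreserving (measurePreserving_add_smul (φ := fun h => h) measurable_id)

theorem aestronglyMeasurable_sub_prod {u : EuclideanSpace ℝ (Fin d) → ℂ} {ε : ℝ}
    (hε : 0 < ε) (hu : AEStronglyMeasurable u) :
    AEStronglyMeasurable (fun z : EuclideanSpace ℝ (Fin d) × EuclideanSpace ℝ (Fin d) =>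
      u (z.1 + z.2) - u z.1) (volume.prod (ballMeasure d ε)) := by
  have := isProbabilityMeasure_ballMeasure (d := d) hε
  exact (aestronglyMeasurable_comp_add_prod hε hu).sub
    (hu.comp_measurePreserving measurePreserving_fst)

theorem aemeasurable_oscSq {u : EuclideanSpace ℝ (Fin d) → ℂ} {ε : ℝ}
    (hε : 0 < ε) (hu : AEStronglyMeasurable u) : AEMeasurable (oscSq u ε) := by
  have := isProbabilityMeasure_ballMeasure (d := d) hε
  exact ((aestronglyMeasurable_sub_prod hε hu).enorm.pow_const 2).lintegral_prod_right'

/-- Average the translation estimate over ‖h‖ ≤ ε, after exchanging the integrals in x and h. This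
is a Poincaré inequality at scale ε, global in x. -/
theorem IsWeakGrad.lintegral_oscSq_le {u : EuclideanSpace ℝ (Fin d) → ℂ}
    {G : EuclideanSpace ℝ (Fin d) → EuclideanSpace ℂ (Fin d)} (hG : IsWeakGrad u G)
    (hu : MemLp u 2) (hG2 : MemLp G 2) {ε : ℝ} (hε : 0 < ε) :
    ∫⁻ x, oscSq u ε x ≤ ENNReal.ofReal (ε ^ 2) * ∫⁻ x, ‖G x‖ₑ ^ 2 := by
  have := isProbabilityMeasure_ballMeasure (d := d) hε
  unfold oscSq
  rw [lintegral_lintegral_swap ((aestronglyMeasurable_sub_prod hε hu.1).enorm.pow_const 2)]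
  calc _ ≤ ∫⁻ _, (ENNReal.ofReal (ε ^ 2) * ∫⁻ x, ‖G x‖ₑ ^ 2) ∂(ballMeasure d ε) := by
        refine lintegral_mono_ae ?_
        filter_upwards [ae_ballMeasure_norm_le ε] with h hh
        refine (hG.lintegral_translate_sub_le hu hG2 h).trans ?_
        gcongr
        rw [← ofReal_norm, ← ENNReal.ofReal_pow (norm_nonneg _)]
        exact ENNReal.ofReal_le_ofReal (by gcongr)
    _ = _ := by simp

theorem aestronglyMeasurable_comp_add_ballMeasure {u : EuclideanSpace ℝ (Fin d) → ℂ}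
    (hu : AEStronglyMeasurable u) (ε : ℝ) (x : EuclideanSpace ℝ (Fin d)) :
    AEStronglyMeasurable (fun h => u (x + h)) (ballMeasure d ε) := by
  have h1 : AEStronglyMeasurable (fun h => u (x + h)) volume :=
    hu.comp_measurePreserving (measurePreserving_add_left volume x)
  exact h1.mono_ac (Measure.restrict_le_self.absolutelyContinuous.smul_left _)

/-! ### An L^r bound above the critical exponent, by dyadic levels -/

theorem enorm_sq_le_two_mul_add (a b : ℂ) : ‖b‖ₑ ^ 2 ≤ 2 * ‖a‖ₑ ^ 2 + 2 * ‖a - b‖ₑ ^ 2 := by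
  have h : ‖b‖ ^ 2 ≤ 2 * ‖a‖ ^ 2 + 2 * ‖a - b‖ ^ 2 := by
    have h1 : ‖b‖ ≤ ‖a‖ + ‖a - b‖ := by
      calc ‖b‖ = ‖a - (a - b)‖ := by ring_nf
        _ ≤ _ := norm_sub_le _ _
    nlinarith [norm_nonneg b, sq_nonneg (‖a‖ - ‖a - b‖)]
  have := ENNReal.ofReal_le_ofReal h
  rwa [ENNReal.ofReal_add (by positivity) (by positivity), ENNReal.ofReal_mul (by norm_num),
    ENNReal.ofReal_mul (by norm_num), ENNReal.ofReal_pow (norm_nonneg _),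
    ENNReal.ofReal_pow (norm_nonneg _), ENNReal.ofReal_pow (norm_nonneg _), ofReal_norm,
    ofReal_norm, ofReal_norm, ENNReal.ofReal_ofNat] at this

theorem enorm_sq_le_average_add_oscSq {u : EuclideanSpace ℝ (Fin d) → ℂ}
    (hu : AEStronglyMeasurable u) {ε : ℝ} (hε : 0 < ε) (x : EuclideanSpace ℝ (Fin d)) :
    ‖u x‖ₑ ^ 2 ≤ 2 * (∫⁻ h, ‖u (x + h)‖ₑ ^ 2 ∂(ballMeasure d ε)) + 2 * oscSq u ε x := by
  have := isProbabilityMeasure_ballMeasure (d := d) hε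
  have hm := aestronglyMeasurable_comp_add_ballMeasure hu ε x
  calc ‖u x‖ₑ ^ 2 = ∫⁻ _, ‖u x‖ₑ ^ 2 ∂(ballMeasure d ε) := by simp
    _ ≤ ∫⁻ h, (2 * ‖u (x + h)‖ₑ ^ 2 + 2 * ‖u (x + h) - u x‖ₑ ^ 2) ∂(ballMeasure d ε) :=
        lintegral_mono fun h => enorm_sq_le_two_mul_add _ _
    _ = _ := by
        rw [lintegral_add_left' ((hm.enorm.pow_const 2).const_mul 2),
          lintegral_const_mul' _ _ (by simp), lintegral_const_mul' _ _ (by simp), oscSq]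

theorem average_sq_le {u : EuclideanSpace ℝ (Fin d) → ℂ}
    (hu : AEStronglyMeasurable u) {ε : ℝ} (hε : 0 < ε) {q : ℝ} (hq : 2 ≤ q)
    (x : EuclideanSpace ℝ (Fin d)) :
    ∫⁻ h, ‖u (x + h)‖ₑ ^ 2 ∂(ballMeasure d ε) ≤
      ((volume (Metric.ball (0 : EuclideanSpace ℝ (Fin d)) ε))⁻¹ * ∫⁻ y, ‖u y‖ₑ ^ q) ^ (2 / q) := by
  have := isProbabilityMeasure_ballMeasure (d := d) hε
  have hm := aestronglyMeasurable_comp_add_ballMeasure hu ε x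
  have h1 := lintegral_rpow_le_lintegral_rpow (q := 2) (by norm_num) hq hm.enorm
  simp only [ENNReal.rpow_two] at h1
  refine h1.trans ?_
  have : 0 ≤ 2 / q := by positivity
  gcongr
  refine (lintegral_ballMeasure_le ε _).trans_eq ?_
  rw [lintegral_add_left_eq_self (fun y => ‖u y‖ₑ ^ q) x]

theorem ENNReal_absorb {a b c : ENNReal} (ha : a ≠ ⊤) (h : a ≤ b + 2 * c) (hb : b ≤ a / 2) :
    a ≤ 4 * c := by
  by_cases hc : c = ⊤
  · simp [hc]
  have hb' : b ≠ ⊤ := ne_top_of_le_ne_top (ENNReal.div_ne_top ha (by norm_num)) hb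
  lift a to NNReal using ha
  lift b to NNReal using hb'
  lift c to NNReal using hc
  have h2 : (a : ENNReal) / 2 = ((a / 2 : NNReal) : ENNReal) := by
    rw [ENNReal.coe_div (by norm_num)]; rfl
  rw [h2] at hb
  have h' : a ≤ b + 2 * c := by exact_mod_cast h
  have hb' : b ≤ a / 2 := by exact_mod_cast hb
  have : a ≤ 4 * c := by
    rw [← NNReal.coe_le_coe] at *
    push_cast at *
    linarith
  exact_mod_cast this

/-- The radius attached to the level 2^k decays like 2^(-kq/d), which is as fast as an L^q bound
allows if ball averages are to stay below half the level. -/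
theorem exists_radius {q b B : ℝ} (hb : 0 < b) (hB : 0 ≤ B) (hd : 1 ≤ d) :
    ∃ ρ : ℝ, 0 < ρ ∧ ∀ k : ℕ, (B / (b * (ρ * 2 ^ (-(k * q / d) : ℝ)) ^ d)) ≤
      ((2 : ℝ) ^ k / 2) ^ q := by
  have hd' : (d : ℝ) ≠ 0 := by positivity
  -- `B + 1` instead of `B` keeps the radius positive when `B = 0`.
  refine ⟨(2 ^ q * (B + 1) / b) ^ (1 / (d : ℝ)), by positivity, fun k => ?_⟩
  have e1 : ((2 ^ q * (B + 1) / b) ^ (1 / (d : ℝ))) ^ d = 2 ^ q * (B + 1) / b := by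
    rw [← Real.rpow_natCast, ← Real.rpow_mul (by positivity), one_div_mul_cancel hd',
      Real.rpow_one]
  have e2 : ((2 : ℝ) ^ (-(k * q / d) : ℝ)) ^ d = 2 ^ (-(k * q) : ℝ) := by
    rw [← Real.rpow_natCast, ← Real.rpow_mul (by positivity)]
    congr 1; field_simp
  have e3 : ((2 : ℝ) ^ k / 2) ^ q = 2 ^ (k * q : ℝ) / 2 ^ q := by
    rw [Real.div_rpow (by positivity) (by positivity), ← Real.rpow_natCast,
      ← Real.rpow_mul (by positivity)]
  rw [mul_pow, e1, e2, e3, Real.rpow_neg (by positivity)]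
  rw [div_le_iff₀ (by positivity)]
  have : 2 ^ (k * q : ℝ) / 2 ^ q * (b * (2 ^ q * (B + 1) / b * (2 ^ (k * q : ℝ))⁻¹)) = B + 1 := by
    have := (Real.rpow_pos_of_pos (two_pos : (0:ℝ) < 2) (k * q : ℝ)).ne'
    field_simp
  rw [this]; linarith

/-- By Hölder, the L^q bound keeps the mean of |u|² over the ball below (L/2)². At a point where |u|
≥ L, this mean accounts for at most half of |u(x)|², so the oscillation must account for the rest.
-/
theorem enorm_sq_le_four_mul_oscSq {u : EuclideanSpace ℝ (Fin d) → ℂ}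
    (hu : AEStronglyMeasurable u) {ε : ℝ} (hε : 0 < ε) {q : ℝ} (hq : 2 ≤ q) {B : ℝ}
    (hB : ∫⁻ y, ‖u y‖ₑ ^ q ≤ ENNReal.ofReal B) {L : ℝ}
    (hBL : B / ((volume (Metric.ball (0 : EuclideanSpace ℝ (Fin d)) 1)).toReal * ε ^ d) ≤
      (L / 2) ^ q)
    {x : EuclideanSpace ℝ (Fin d)} (hL : 0 ≤ L) (hLu : L ≤ ‖u x‖) :
    ‖u x‖ₑ ^ 2 ≤ 4 * oscSq u ε x := by
  refine ENNReal_absorb (by finiteness) (enorm_sq_le_average_add_oscSq hu hε x) ?_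
  have hb : 0 < (volume (Metric.ball (0 : EuclideanSpace ℝ (Fin d)) 1)).toReal :=
    ENNReal.toReal_pos (Metric.measure_ball_pos _ _ one_pos).ne' measure_ball_lt_top.ne
  have hv : volume (Metric.ball (0 : EuclideanSpace ℝ (Fin d)) ε) =
      ENNReal.ofReal ((volume (Metric.ball (0 : EuclideanSpace ℝ (Fin d)) 1)).toReal * ε ^ d) := by
    rw [Measure.addHaar_ball_of_pos _ _ hε, finrank_euclideanSpace_fin, mul_comm,
      ENNReal.ofReal_mul hb.le, ENNReal.ofReal_toReal measure_ball_lt_top.ne]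
  have h1 := average_sq_le hu hε hq x
  have h2 : ((volume (Metric.ball (0 : EuclideanSpace ℝ (Fin d)) ε))⁻¹ * ∫⁻ y, ‖u y‖ₑ ^ q)
      ^ (2 / q) ≤ ENNReal.ofReal ((L / 2) ^ 2) := by
    have hq0 : 0 ≤ 2 / q := by positivity
    calc _ ≤ (ENNReal.ofReal ((L / 2) ^ q)) ^ (2 / q) := by
          gcongr
          rw [hv, ← ENNReal.ofReal_inv_of_pos (by positivity)]
          calc _ ≤ _ := mul_le_mul_right hB _
            _ = _ := (ENNReal.ofReal_mul (by positivity)).symm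
            _ ≤ _ := ENNReal.ofReal_le_ofReal (by rw [inv_mul_eq_div]; exact hBL)
      _ = _ := by
          rw [ENNReal.ofReal_rpow_of_nonneg (by positivity) hq0, ← Real.rpow_mul (by positivity),
            mul_div_cancel₀ _ (by positivity)]
          norm_num
  calc _ ≤ 2 * ENNReal.ofReal ((L / 2) ^ 2) := mul_le_mul_right (h1.trans h2) _
    _ = ENNReal.ofReal (L ^ 2 / 2) := by
        rw [← ENNReal.ofReal_ofNat, ← ENNReal.ofReal_mul (by norm_num)]; congr 1; ring
    _ ≤ ENNReal.ofReal (‖u x‖ ^ 2 / 2) := ENNReal.ofReal_le_ofReal (by gcongr)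
    _ = _ := by
        rw [ENNReal.ofReal_div_of_pos (by norm_num), ENNReal.ofReal_pow (norm_nonneg _),
          ofReal_norm, ENNReal.ofReal_ofNat]

/-- Where |u| ≤ 1 the square dominates. Elsewhere the single index with 2^k ≤ |u(x)| < 2^(k+1) is
enough, and the rest of the series is discarded. -/
theorem enorm_rpow_le_tsum {u : EuclideanSpace ℝ (Fin d) → ℂ}
    {ε : ℕ → ℝ} {r : ℝ} (hr : 2 ≤ r) {x : EuclideanSpace ℝ (Fin d)}
    (h : ∀ k : ℕ, (2 : ℝ) ^ k ≤ ‖u x‖ → ‖u x‖ₑ ^ 2 ≤ 4 * oscSq u (ε k) x) :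
    ‖u x‖ₑ ^ r ≤ ‖u x‖ₑ ^ 2 +
      ∑' k : ℕ, ENNReal.ofReal (4 * 2 ^ ((k + 1) * (r - 2) : ℝ)) * oscSq u (ε k) x := by
  rcases le_or_gt ‖u x‖ 1 with h1 | h1
  · refine le_add_right ?_
    rw [← ENNReal.rpow_two]
    refine ENNReal.rpow_le_rpow_of_exponent_ge ?_ hr
    rw [← ofReal_norm]; exact ENNReal.ofReal_le_one.2 h1
  · refine le_add_left ?_
    obtain ⟨k, hk1, hk2⟩ := exists_nat_pow_near h1.le (one_lt_two : (1 : ℝ) < 2)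
    refine le_trans ?_ (ENNReal.le_tsum k)
    have e : ‖u x‖ₑ ^ r = ‖u x‖ₑ ^ 2 * ‖u x‖ₑ ^ (r - 2) := by
      rw [← ENNReal.rpow_two, ← ENNReal.rpow_add _ _ (by simpa using (by intro h; simp [h] at h1; linarith : u x ≠ 0)) (by simp)]
      congr 1; ring
    have e2 : ‖u x‖ₑ ^ (r - 2) ≤ ENNReal.ofReal (2 ^ ((k + 1) * (r - 2) : ℝ)) := by
      rw [← ofReal_norm, ENNReal.ofReal_rpow_of_nonneg (norm_nonneg _) (by linarith)]
      refine ENNReal.ofReal_le_ofReal ?_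
      calc ‖u x‖ ^ (r - 2) ≤ ((2 : ℝ) ^ (k + 1)) ^ (r - 2) :=
            Real.rpow_le_rpow (norm_nonneg _) hk2.le (by linarith)
        _ = _ := by
            rw [← Real.rpow_natCast, ← Real.rpow_mul (by norm_num)]; push_cast; rfl
    calc ‖u x‖ₑ ^ r ≤ (4 * oscSq u (ε k) x) * ENNReal.ofReal (2 ^ ((k + 1) * (r - 2) : ℝ)) := by
          rw [e]; exact mul_le_mul' (h k hk1) e2
      _ = _ := by
          rw [ENNReal.ofReal_mul (by norm_num), ENNReal.ofReal_ofNat]; ring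

/-- Local averaging improves the integrability exponent from `q` to any `r < 2 + 2 q / d`. -/
theorem sobolev_step (hd : 1 ≤ d) {q r : ℝ} (hq : 2 ≤ q) (hr : 2 ≤ r) (hrq : r < 2 + 2 * q / d)
    {A B : ℝ} (hA : 0 ≤ A) (hB : 0 ≤ B) :
    ∃ C : ℝ, 0 ≤ C ∧ ∀ (u : EuclideanSpace ℝ (Fin d) → ℂ)
      (G : EuclideanSpace ℝ (Fin d) → EuclideanSpace ℂ (Fin d)), IsWeakGrad u G →
      MemLp u 2 → MemLp G 2 → ∫⁻ x, ‖u x‖ₑ ^ 2 ≤ ENNReal.ofReal A →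
      ∫⁻ x, ‖G x‖ₑ ^ 2 ≤ ENNReal.ofReal A → ∫⁻ x, ‖u x‖ₑ ^ q ≤ ENNReal.ofReal B →
      ∫⁻ x, ‖u x‖ₑ ^ r ≤ ENNReal.ofReal C := by
  have hd' : (0 : ℝ) < d := by exact_mod_cast hd
  have hb : 0 < (volume (Metric.ball (0 : EuclideanSpace ℝ (Fin d)) 1)).toReal :=
    ENNReal.toReal_pos (Metric.measure_ball_pos _ _ one_pos).ne' measure_ball_lt_top.ne
  obtain ⟨ρ, hρ, hk⟩ := exists_radius (q := q) hb hB hd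
  set ε : ℕ → ℝ := fun k => ρ * 2 ^ (-(k * q / d) : ℝ) with hε
  have hεpos : ∀ k, 0 < ε k := fun k => by positivity
  set c : ℕ → ℝ := fun k => 4 * 2 ^ ((k + 1) * (r - 2) : ℝ) * (ε k ^ 2 * A) with hc
  have hc0 : ∀ k, 0 ≤ c k := fun k => by positivity
  -- The k-th term is proportional to 2^(k(r-2)) ε_k², with ε_k² proportional to 2^(-2kq/d): a
  -- geometric series, convergent exactly because r < 2 + 2q/d.
  have hsum : Summable c := by
    have hgeo : Summable fun k : ℕ => ((2 : ℝ) ^ (r - 2 - 2 * q / d)) ^ k := by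
      refine summable_geometric_of_lt_one (by positivity) ?_
      exact Real.rpow_lt_one_of_one_lt_of_neg (by norm_num) (by linarith)
    refine (hgeo.mul_left (4 * 2 ^ (r - 2) * ρ ^ 2 * A)).congr fun k => ?_
    have e1 : ((2 : ℝ) ^ (-(k * q / d) : ℝ)) ^ 2 = 2 ^ (-(k * (2 * q / d)) : ℝ) := by
      rw [← Real.rpow_natCast, ← Real.rpow_mul (by norm_num)]; congr 1; push_cast; ring
    have e2 : ((2 : ℝ) ^ (r - 2 - 2 * q / d)) ^ k =
        2 ^ (k * (r - 2) : ℝ) * 2 ^ (-(k * (2 * q / d)) : ℝ) := by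
      rw [← Real.rpow_natCast, ← Real.rpow_mul (by norm_num), ← Real.rpow_add (by norm_num)]
      congr 1; ring
    have e3 : (2 : ℝ) ^ ((k + 1) * (r - 2) : ℝ) = 2 ^ (k * (r - 2) : ℝ) * 2 ^ (r - 2) := by
      rw [← Real.rpow_add (by norm_num)]; congr 1; ring
    simp only [hc, hε]
    rw [mul_pow, e1, e2, e3]; ring
  refine ⟨A + ∑' k, c k, add_nonneg hA (tsum_nonneg hc0), fun u G hG hu hG2 hAu hAG hBu => ?_⟩
  have hpt : ∀ x, ‖u x‖ₑ ^ r ≤ ‖u x‖ₑ ^ 2 +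
      ∑' k : ℕ, ENNReal.ofReal (4 * 2 ^ ((k + 1) * (r - 2) : ℝ)) * oscSq u (ε k) x := fun x =>
    enorm_rpow_le_tsum hr fun k hkx =>
      enorm_sq_le_four_mul_oscSq hu.1 (hεpos k) hq hBu (hk k) (by positivity) hkx
  refine (lintegral_mono hpt).trans ?_
  rw [lintegral_add_left' (hu.1.enorm.pow_const 2), lintegral_tsum fun k =>
    (aemeasurable_oscSq (hεpos k) hu.1).const_mul _, ENNReal.ofReal_add hA (tsum_nonneg hc0),
    ENNReal.ofReal_tsum_of_nonneg hc0 hsum]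
  gcongr with k
  rw [lintegral_const_mul' _ _ ENNReal.ofReal_ne_top]
  calc _ ≤ ENNReal.ofReal (4 * 2 ^ ((k + 1) * (r - 2) : ℝ)) *
        (ENNReal.ofReal (ε k ^ 2) * ENNReal.ofReal A) := by
        gcongr
        exact (hG.lintegral_oscSq_le hu hG2 (hεpos k)).trans (by gcongr)
    _ = ENNReal.ofReal (c k) := by
        rw [← ENNReal.ofReal_mul (by positivity), ← ENNReal.ofReal_mul (by positivity)]

/-- Uniform bound in `L^r` for some `r` above the mass-critical exponent `2 + 4/d`. -/
theorem exists_sobolev_bound (hd : 1 ≤ d) : ∃ r : ℝ, 2 + 4 / (d : ℝ) < r ∧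
    ∀ A : ℝ, 0 ≤ A → ∃ C : ℝ, 0 ≤ C ∧ ∀ (u : EuclideanSpace ℝ (Fin d) → ℂ)
      (G : EuclideanSpace ℝ (Fin d) → EuclideanSpace ℂ (Fin d)), IsWeakGrad u G →
      MemLp u 2 → MemLp G 2 → ∫⁻ x, ‖u x‖ₑ ^ 2 ≤ ENNReal.ofReal A →
      ∫⁻ x, ‖G x‖ₑ ^ 2 ≤ ENNReal.ofReal A → ∫⁻ x, ‖u x‖ₑ ^ r ≤ ENNReal.ofReal C := by
  have hd' : (0 : ℝ) < d := by exact_mod_cast hd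
  have h4 : 0 < 4 / (d : ℝ) := by positivity
  have h2 : (2 : ℝ) ≤ 2 + 2 / d := by linarith [(by positivity : 0 < 2 / (d : ℝ))]
  refine ⟨2 + 4 / d + 2 / d ^ 2, by linarith [(by positivity : 0 < 2 / (d : ℝ) ^ 2)],
    fun A hA => ?_⟩
  -- One step from q = 2 reaches only r < 2 + 4/d, just short of the critical exponent. A second
  -- step, from q = 2 + 2/d, reaches every r < 2 + 4/d + 4/d².
  obtain ⟨B, hB, h⟩ := sobolev_step hd (q := 2) (r := 2 + 2 / d) le_rfl h2
    (by linarith [(by ring : 2 * 2 / (d : ℝ) = 2 / d + 2 / d), (by positivity : 0 < 2 / (d : ℝ))])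
    hA hA
  obtain ⟨C, hC, h'⟩ := sobolev_step hd (q := 2 + 2 / d) (r := 2 + 4 / d + 2 / d ^ 2) h2
    (by linarith [(by positivity : 0 < 2 / (d : ℝ) ^ 2)])
    (by
      have e : 2 * (2 + 2 / (d : ℝ)) / d = 4 / d + 4 / d ^ 2 := by field_simp; norm_num
      have : 2 / (d : ℝ) ^ 2 < 4 / d ^ 2 := by gcongr; norm_num
      linarith) hA hB
  exact ⟨C, hC, fun u G hG hu hG2 h1 h3 => h' u G hG hu hG2 h1 h3
    (h u G hG hu hG2 h1 h3 (by simpa using h1))⟩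

/-! ### Rellich compactness in L² -/

/-- The average of `w` over the ball of radius `ε` about `x`. -/
noncomputable def ballAverage (w : EuclideanSpace ℝ (Fin d) → ℂ) (ε : ℝ)
    (x : EuclideanSpace ℝ (Fin d)) : ℂ :=
  ∫ h, w (x + h) ∂(ballMeasure d ε)

theorem memLp_comp_add_ballMeasure {w : EuclideanSpace ℝ (Fin d) → ℂ} (hw : MemLp w 2) {ε : ℝ}
    (hε : 0 < ε) (x : EuclideanSpace ℝ (Fin d)) :
    MemLp (fun h => w (x + h)) 2 (ballMeasure d ε) := by
  have h1 : MemLp (fun h => w (x + h)) 2 :=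
    hw.comp_measurePreserving (measurePreserving_add_left volume x)
  refine (h1.restrict _).smul_measure ?_
  exact ENNReal.inv_ne_top.2 (Metric.measure_ball_pos _ _ hε).ne'

theorem enorm_ballAverage_sq_le {w : EuclideanSpace ℝ (Fin d) → ℂ} (hw : MemLp w 2) {ε : ℝ}
    (hε : 0 < ε) (x : EuclideanSpace ℝ (Fin d)) :
    ‖ballAverage w ε x‖ₑ ^ 2 ≤
      (volume (Metric.ball (0 : EuclideanSpace ℝ (Fin d)) ε))⁻¹ * ∫⁻ y, ‖w y‖ₑ ^ 2 := by
  have := isProbabilityMeasure_ballMeasure (d := d) hε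
  refine (enorm_integral_sq_le (memLp_comp_add_ballMeasure hw hε x).1).trans ?_
  refine (lintegral_ballMeasure_le ε _).trans_eq ?_
  rw [lintegral_add_left_eq_self (fun y => ‖w y‖ₑ ^ 2) x]

theorem enorm_sq_le_ballAverage_add_oscSq {w : EuclideanSpace ℝ (Fin d) → ℂ} (hw : MemLp w 2)
    {ε : ℝ} (hε : 0 < ε) (x : EuclideanSpace ℝ (Fin d)) :
    ‖w x‖ₑ ^ 2 ≤ 2 * ‖ballAverage w ε x‖ₑ ^ 2 + 2 * oscSq w ε x := by
  have := isProbabilityMeasure_ballMeasure (d := d) hε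
  have hm := memLp_comp_add_ballMeasure hw hε x
  refine (enorm_sq_le_two_mul_add (ballAverage w ε x) (w x)).trans ?_
  have e : ballAverage w ε x - w x = ∫ h, (w (x + h) - w x) ∂(ballMeasure d ε) := by
    rw [integral_sub (hm.integrable one_le_two) (integrable_const _)]
    simp [ballAverage]
  rw [e]
  gcongr
  exact enorm_integral_sq_le (hm.1.sub aestronglyMeasurable_const)

theorem aestronglyMeasurable_ballAverage {w : EuclideanSpace ℝ (Fin d) → ℂ}
    (hw : AEStronglyMeasurable w) {ε : ℝ} (hε : 0 < ε) :
    AEStronglyMeasurable (ballAverage w ε) := by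
  have := isProbabilityMeasure_ballMeasure (d := d) hε
  exact (aestronglyMeasurable_comp_add_prod hε hw).integral_prod_right'

theorem tendsto_setLIntegral_ballAverage {w : ℕ → EuclideanSpace ℝ (Fin d) → ℂ}
    (hw : ∀ n, MemLp (w n) 2) {A : ℝ} (hA : ∀ n, ∫⁻ x, ‖w n x‖ₑ ^ 2 ≤ ENNReal.ofReal A)
    {ε : ℝ} (hε : 0 < ε) (h : ∀ x, Tendsto (fun n => ballAverage (w n) ε x) atTop (𝓝 0)) (R : ℝ) :
    Tendsto (fun n => ∫⁻ x in Metric.ball (0 : EuclideanSpace ℝ (Fin d)) R,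
      ‖ballAverage (w n) ε x‖ₑ ^ 2) atTop (𝓝 0) := by
  have hv : (volume (Metric.ball (0 : EuclideanSpace ℝ (Fin d)) ε))⁻¹ ≠ ⊤ :=
    ENNReal.inv_ne_top.2 (Metric.measure_ball_pos _ _ hε).ne'
  have := tendsto_lintegral_of_dominated_convergence'
    (μ := volume.restrict (Metric.ball (0 : EuclideanSpace ℝ (Fin d)) R))
    (F := fun n x => ‖ballAverage (w n) ε x‖ₑ ^ 2) (f := fun _ => 0)
    (fun _ => (volume (Metric.ball (0 : EuclideanSpace ℝ (Fin d)) ε))⁻¹ * ENNReal.ofReal A)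
    (fun n => ((aestronglyMeasurable_ballAverage (hw n).1 hε).enorm.pow_const 2).restrict)
    (fun n => ae_of_all _ fun x =>
      (enorm_ballAverage_sq_le (hw n) hε x).trans (mul_le_mul_right (hA n) _))
    (by
      rw [lintegral_const, Measure.restrict_apply_univ]
      exact ENNReal.mul_ne_top (ENNReal.mul_ne_top hv ENNReal.ofReal_ne_top)
        measure_ball_lt_top.ne)
    (ae_of_all _ fun x => by
      have h1 := ENNReal.Tendsto.pow (n := 2) (h x).enorm
      simpa using h1)
  simpa using this

/-- Inside the ball of radius R, compare w with its local average; outside, use 1 ≤ ‖x‖²/R², so that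
the weighted norm controls the tail. -/
theorem enorm_sq_le_indicator_add {w : EuclideanSpace ℝ (Fin d) → ℂ} (hw : MemLp w 2)
    {ε : ℝ} (hε : 0 < ε) {R : ℝ} (hR : 0 < R) (x : EuclideanSpace ℝ (Fin d)) :
    ‖w x‖ₑ ^ 2 ≤ (Metric.ball (0 : EuclideanSpace ℝ (Fin d)) R).indicator
      (fun x => 2 * ‖ballAverage w ε x‖ₑ ^ 2) x +
      (2 * oscSq w ε x + ENNReal.ofReal ((R ^ 2)⁻¹) * ‖‖x‖ • w x‖ₑ ^ 2) := by
  by_cases hx : x ∈ Metric.ball (0 : EuclideanSpace ℝ (Fin d)) R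
  · rw [Set.indicator_of_mem hx, ← add_assoc]
    exact le_add_right (enorm_sq_le_ballAverage_add_oscSq hw hε x)
  · refine le_add_left (le_add_left ?_)
    have hx' : R ≤ ‖x‖ := by simpa using hx
    rw [← ofReal_norm, ← ofReal_norm, ← ENNReal.ofReal_pow (norm_nonneg _),
      ← ENNReal.ofReal_pow (norm_nonneg _), ← ENNReal.ofReal_mul (by positivity)]
    refine ENNReal.ofReal_le_ofReal ?_
    rw [norm_smul, norm_norm, mul_pow, ← mul_assoc, inv_mul_eq_div]
    refine le_mul_of_one_le_left (by positivity) ?_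
    rw [one_le_div (by positivity)]
    gcongr

/-- Rellich's theorem for `Σ ⊂ L²`, in the form of convergence of weakly null sequences. -/
theorem tendsto_lintegral_sq_of_ballAverage (w : ℕ → EuclideanSpace ℝ (Fin d) → ℂ)
    (G : ℕ → EuclideanSpace ℝ (Fin d) → EuclideanSpace ℂ (Fin d))
    (hG : ∀ n, IsWeakGrad (w n) (G n)) (hw : ∀ n, MemLp (w n) 2) (hG2 : ∀ n, MemLp (G n) 2)
    (hx : ∀ n, MemLp (fun x => ‖x‖ • w n x) 2) {A : ℝ} (hA0 : 0 ≤ A)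
    (hA : ∀ n, ∫⁻ x, ‖w n x‖ₑ ^ 2 ≤ ENNReal.ofReal A)
    (hAG : ∀ n, ∫⁻ x, ‖G n x‖ₑ ^ 2 ≤ ENNReal.ofReal A)
    (hAx : ∀ n, ∫⁻ x, ‖‖x‖ • w n x‖ₑ ^ 2 ≤ ENNReal.ofReal A)
    (h : ∀ ε > 0, ∀ x, Tendsto (fun n => ballAverage (w n) ε x) atTop (𝓝 0)) :
    Tendsto (fun n => ∫⁻ x, ‖w n x‖ₑ ^ 2) atTop (𝓝 0) := by
  rw [ENNReal.tendsto_nhds_zero]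
  intro δ' hδ'
  obtain ⟨δ, hδ0, hδ⟩ : ∃ δ : ℝ, 0 < δ ∧ ENNReal.ofReal δ ≤ δ' := by
    obtain ⟨δ, h1, h2⟩ := ENNReal.lt_iff_exists_nnreal_btwn.1 hδ'
    exact ⟨δ, by exact_mod_cast h1, by simpa using h2.le⟩
  -- The total δ is split in three thirds: averages on the ball, oscillation 2ε²A, and tail A/R².
  -- Writing `A + 1` allows `A = 0`.
  set ε := √(δ / (6 * (A + 1))) with hεd
  set R := √(3 * (A + 1) / δ) with hRd
  have hε : 0 < ε := Real.sqrt_pos.2 (by positivity)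
  have hR : 0 < R := Real.sqrt_pos.2 (by positivity)
  have hε2 : ε ^ 2 = δ / (6 * (A + 1)) := Real.sq_sqrt (by positivity)
  have hR2 : (R ^ 2)⁻¹ = δ / (3 * (A + 1)) := by
    rw [hRd, Real.sq_sqrt (by positivity), inv_div]
  have hlim := tendsto_setLIntegral_ballAverage hw hA hε (h ε hε) R
  have hev := (ENNReal.tendsto_nhds_zero.1 hlim) (ENNReal.ofReal (δ / 6)) (by simpa using hδ0)
  filter_upwards [hev] with n hn
  refine le_trans ?_ hδ
  refine (lintegral_mono (enorm_sq_le_indicator_add (hw n) hε hR)).trans ?_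
  have m1 : AEMeasurable (fun x => 2 * oscSq (w n) ε x) :=
    (aemeasurable_oscSq hε (hw n).1).const_mul 2
  have m2 : AEMeasurable (fun x => ENNReal.ofReal ((R ^ 2)⁻¹) * ‖‖x‖ • w n x‖ₑ ^ 2) :=
    ((hx n).1.enorm.pow_const 2).const_mul _
  rw [lintegral_add_right' (g := fun x => 2 * oscSq (w n) ε x +
      ENNReal.ofReal ((R ^ 2)⁻¹) * ‖‖x‖ • w n x‖ₑ ^ 2) _ (m1.add m2), lintegral_add_left' m1,
    lintegral_indicator measurableSet_ball, lintegral_const_mul' _ _ (by simp),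
    lintegral_const_mul' _ _ (by simp), lintegral_const_mul' _ _ ENNReal.ofReal_ne_top]
  calc _ ≤ 2 * ENNReal.ofReal (δ / 6) + (2 * (ENNReal.ofReal (ε ^ 2) * ENNReal.ofReal A) +
        ENNReal.ofReal ((R ^ 2)⁻¹) * ENNReal.ofReal A) := by
        gcongr
        · exact ((hG n).lintegral_oscSq_le (hw n) (hG2 n) hε).trans (by gcongr; exact hAG n)
        · exact hAx n
    _ = ENNReal.ofReal (2 * (δ / 6) + (2 * (ε ^ 2 * A) + (R ^ 2)⁻¹ * A)) := by
        rw [ENNReal.ofReal_add (by positivity) (by positivity),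
          ENNReal.ofReal_add (by positivity) (by positivity), ENNReal.ofReal_mul (by norm_num),
          ENNReal.ofReal_mul (by norm_num), ENNReal.ofReal_mul (by positivity),
          ENNReal.ofReal_mul (by positivity), ENNReal.ofReal_ofNat]
    _ ≤ ENNReal.ofReal δ := by
        refine ENNReal.ofReal_le_ofReal ?_
        rw [hε2, hR2]
        have : A / (A + 1) ≤ 1 := (div_le_one (by positivity)).2 (by linarith)
        have e : 2 * (δ / 6) + (2 * (δ / (6 * (A + 1)) * A) + δ / (3 * (A + 1)) * A) =
          δ / 3 + 2 * (δ / 3) * (A / (A + 1)) := by field_simp; ring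
        rw [e]; nlinarith

/-! ### Interpolation between L² and L^r -/

/-- Split at |z| = K: below it |z|^(p-2) ≤ K^(p-2), above it |z|^(p-r) ≤ K^(p-r). -/
theorem enorm_rpow_le_interpolate (z : ℂ) {p r K : ℝ} (hp : 2 ≤ p) (hpr : p ≤ r) (hK : 0 < K) :
    ‖z‖ₑ ^ p ≤ ENNReal.ofReal (K ^ (p - 2)) * ‖z‖ₑ ^ 2 +
      ENNReal.ofReal (K ^ (p - r)) * ‖z‖ₑ ^ r := by
  rcases eq_or_ne z 0 with rfl | hz
  · simp [ENNReal.zero_rpow_of_pos (by linarith : 0 < p)]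
  have hz0 : 0 < ‖z‖ := norm_pos_iff.2 hz
  have hreal : ‖z‖ ^ p ≤ K ^ (p - 2) * ‖z‖ ^ 2 + K ^ (p - r) * ‖z‖ ^ r := by
    rcases le_total ‖z‖ K with h | h
    · refine le_add_of_le_of_nonneg ?_ (by positivity)
      have e : ‖z‖ ^ p = ‖z‖ ^ (p - 2) * ‖z‖ ^ 2 := by
        rw [← Real.rpow_natCast, ← Real.rpow_add hz0]; congr 1; push_cast; ring
      rw [e]
      gcongr
    · refine le_add_of_nonneg_of_le (by positivity) ?_
      have e : ‖z‖ ^ p = ‖z‖ ^ (p - r) * ‖z‖ ^ r := by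
        rw [← Real.rpow_add hz0]; congr 1; ring
      rw [e]
      have : ‖z‖ ^ (p - r) ≤ K ^ (p - r) :=
        Real.rpow_le_rpow_of_nonpos hK h (by linarith)
      gcongr
  have := ENNReal.ofReal_le_ofReal hreal
  rwa [ENNReal.ofReal_add (by positivity) (by positivity), ENNReal.ofReal_mul (by positivity),
    ENNReal.ofReal_mul (by positivity), ← ENNReal.ofReal_rpow_of_nonneg (norm_nonneg z) (by linarith : 0 ≤ p),
    ← ENNReal.ofReal_rpow_of_nonneg (norm_nonneg z) (by linarith : 0 ≤ r),
    ENNReal.ofReal_pow (norm_nonneg _), ofReal_norm] at this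

theorem lintegral_rpow_le_interpolate {w : EuclideanSpace ℝ (Fin d) → ℂ}
    (hw : AEStronglyMeasurable w) {p r K : ℝ} (hp : 2 ≤ p) (hpr : p ≤ r) (hK : 0 < K) :
    ∫⁻ x, ‖w x‖ₑ ^ p ≤ ENNReal.ofReal (K ^ (p - 2)) * (∫⁻ x, ‖w x‖ₑ ^ 2) +
      ENNReal.ofReal (K ^ (p - r)) * ∫⁻ x, ‖w x‖ₑ ^ r := by
  refine (lintegral_mono fun x => enorm_rpow_le_interpolate (w x) hp hpr hK).trans_eq ?_
  rw [lintegral_add_left' ((hw.enorm.pow_const 2).const_mul _),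
    lintegral_const_mul' _ _ ENNReal.ofReal_ne_top, lintegral_const_mul' _ _ ENNReal.ofReal_ne_top]

theorem tendsto_lintegral_rpow_of_sq {w : ℕ → EuclideanSpace ℝ (Fin d) → ℂ}
    (hw : ∀ n, AEStronglyMeasurable (w n)) {p r : ℝ} (hp : 2 ≤ p) (hpr : p < r) {C : ℝ}
    (hC : ∀ n, ∫⁻ x, ‖w n x‖ₑ ^ r ≤ ENNReal.ofReal C)
    (h : Tendsto (fun n => ∫⁻ x, ‖w n x‖ₑ ^ 2) atTop (𝓝 0)) :
    Tendsto (fun n => ∫⁻ x, ‖w n x‖ₑ ^ p) atTop (𝓝 0) := by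
  rw [ENNReal.tendsto_nhds_zero]
  intro δ hδ
  -- K is chosen first, to make the L^r part small uniformly in n (this needs p < r); only then does
  -- n grow.
  have hK : Tendsto (fun K : ℝ => ENNReal.ofReal (K ^ (p - r)) * ENNReal.ofReal C) atTop (𝓝 0) := by
    have h1 : Tendsto (fun K : ℝ => K ^ (p - r) * C) atTop (𝓝 (0 * C)) :=
      (by simpa using tendsto_rpow_neg_atTop (by linarith : 0 < r - p) :
        Tendsto (fun K : ℝ => K ^ (p - r)) atTop (𝓝 0)).mul_const C
    have h2 := ENNReal.tendsto_ofReal h1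
    rw [zero_mul, ENNReal.ofReal_zero] at h2
    refine h2.congr' ?_
    filter_upwards [eventually_gt_atTop 0] with K hK
    rw [ENNReal.ofReal_mul (by positivity)]
  have hδ2 : 0 < δ / 2 := ENNReal.div_pos hδ.ne' (by simp)
  obtain ⟨K, hK1, hK0⟩ := (((ENNReal.tendsto_nhds_zero.1 hK) (δ / 2) hδ2).and
    (eventually_gt_atTop 0)).exists
  have h3 : Tendsto (fun n => ENNReal.ofReal (K ^ (p - 2)) * ∫⁻ x, ‖w n x‖ₑ ^ 2) atTop (𝓝 0) := by
    simpa using ENNReal.Tendsto.const_mul h (Or.inr (ENNReal.ofReal_ne_top (r := K ^ (p - 2))))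
  filter_upwards [(ENNReal.tendsto_nhds_zero.1 h3) (δ / 2) hδ2] with n hn
  refine (lintegral_rpow_le_interpolate (hw n) hp hpr.le hK0).trans ?_
  calc _ ≤ δ / 2 + δ / 2 := by
        gcongr
        exact (mul_le_mul_right (hC n) _).trans hK1
    _ = δ := ENNReal.add_halves δ

/-! ### Weak compactness in Hilbert space -/

section WeakCompactness

variable {H : Type*} [NormedAddCommGroup H] [InnerProductSpace ℝ H] [CompleteSpace H]

/-- Sequential Banach–Alaoglu in the dual, transported by the Riesz isomorphism. -/
theorem exists_subseq_weakly_convergent [TopologicalSpace.SeparableSpace H] {f : ℕ → H} {C : ℝ}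
    (hf : ∀ n, ‖f n‖ ≤ C) : ∃ g : H, ∃ s : ℕ → ℕ, StrictMono s ∧
      ∀ h : H, Tendsto (fun n => inner ℝ (f (s n)) h) atTop (𝓝 (inner ℝ g h)) := by
  have hc := WeakDual.isSeqCompact_closedBall ℝ H 0 C
  obtain ⟨a, -, s, hs, hlim⟩ := hc (x := fun n => StrongDual.toWeakDual
    (InnerProductSpace.toDual ℝ H (f n))) (fun n => by simpa using hf n)
  refine ⟨(InnerProductSpace.toDual ℝ H).symm (WeakDual.toStrongDual a), s, hs, fun h => ?_⟩
  have h1 := ((WeakDual.eval_continuous (𝕜 := ℝ) h).tendsto a).comp hlim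
  rw [InnerProductSpace.toDual_symm_apply]
  exact h1

theorem tendsto_clm_of_tendsto_inner {f : ℕ → H}
    (hf : ∀ h : H, Tendsto (fun n => inner ℝ (f n) h) atTop (𝓝 0)) (Λ : H →L[ℝ] ℂ) :
    Tendsto (fun n => Λ (f n)) atTop (𝓝 0) := by
  have key : ∀ Φ : H →L[ℝ] ℝ, Tendsto (fun n => Φ (f n)) atTop (𝓝 0) := by
    intro Φ
    refine (hf ((InnerProductSpace.toDual ℝ H).symm Φ)).congr fun n => ?_
    rw [real_inner_comm, InnerProductSpace.toDual_symm_apply]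
  have h1 := key (Complex.reCLM ∘L Λ)
  have h2 := key (Complex.imCLM ∘L Λ)
  have h3 := ((Complex.continuous_ofReal.tendsto _).comp h1).add
    (((Complex.continuous_ofReal.tendsto _).comp h2).mul_const Complex.I)
  simpa [Function.comp_def, Complex.re_add_im] using h3

/-- A closed subspace is its own double orthogonal, hence weakly closed. -/
theorem mem_of_tendsto_inner {f : ℕ → H} {g : H} {K : Submodule ℝ H} (hK : IsClosed (K : Set H))
    (hf : ∀ n, f n ∈ K)
    (h : ∀ h : H, Tendsto (fun n => inner ℝ (f n) h) atTop (𝓝 (inner ℝ g h))) : g ∈ K := by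
  have : CompleteSpace K := hK.completeSpace_coe
  rw [← Submodule.orthogonal_orthogonal K, Submodule.mem_orthogonal']
  intro v hv
  refine tendsto_nhds_unique (h v) ?_
  simp [Submodule.inner_right_of_mem_orthogonal (hf _) hv]

end WeakCompactness

/-! ### Σ as a closed subspace of a Hilbert space of triples -/

instance : Fact ((2 : ENNReal) ≠ ⊤) := ⟨by simp⟩

/-- The complex `L²` space on `ℝ^d`. -/
noncomputable abbrev L2C (d : ℕ) := Lp ℂ 2 (volume : Measure (EuclideanSpace ℝ (Fin d)))

/-- The `L²` space of `ℂ^d`-valued functions on `ℝ^d`. -/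
noncomputable abbrev L2G (d : ℕ) :=
  Lp (EuclideanSpace ℂ (Fin d)) 2 (volume : Measure (EuclideanSpace ℝ (Fin d)))

/-- The Hilbert space containing the triples `(ψ, ∇ψ, |x| ψ)`. -/
noncomputable abbrev Phase (d : ℕ) := WithLp 2 (L2C d × WithLp 2 (L2G d × L2C d))

instance separableSpace_phase (d : ℕ) : TopologicalSpace.SeparableSpace (Phase d) := by
  have h1 : SecondCountableTopology (L2C d) := inferInstance
  have h2 : SecondCountableTopology (L2G d) := inferInstance
  have h3 : SecondCountableTopology (L2G d × L2C d) := inferInstance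
  have h4 : SecondCountableTopology (WithLp 2 (L2G d × L2C d)) :=
    (WithLp.prodContinuousLinearEquiv 2 ℝ (L2G d) (L2C d)).toHomeomorph.secondCountableTopology
  have h5 : SecondCountableTopology (L2C d × WithLp 2 (L2G d × L2C d)) :=
    inferInstance
  have h6 : SecondCountableTopology (Phase d) :=
    (WithLp.prodContinuousLinearEquiv 2 ℝ (L2C d)
      (WithLp 2 (L2G d × L2C d))).toHomeomorph.secondCountableTopology
  infer_instance

namespace Phase

/-- The first component of a triple. -/
noncomputable def fnL (d : ℕ) : Phase d →L[ℝ] L2C d := WithLp.fstL 2 ℝ _ _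

/-- The gradient component of a triple. -/
noncomputable def gradL (d : ℕ) : Phase d →L[ℝ] L2G d := (WithLp.fstL 2 ℝ _ _) ∘L (WithLp.sndL 2 ℝ _ _)

/-- The weighted component of a triple. -/
noncomputable def wtL (d : ℕ) : Phase d →L[ℝ] L2C d := (WithLp.sndL 2 ℝ _ _) ∘L (WithLp.sndL 2 ℝ _ _)

theorem inner_eq (f g : Phase d) : inner ℝ f g =
    inner ℝ (fnL d f) (fnL d g) + (inner ℝ (gradL d f) (gradL d g) +
      inner ℝ (wtL d f) (wtL d g)) := by
  rw [WithLp.prod_inner_apply, WithLp.prod_inner_apply]; rfl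

theorem norm_sq_eq (f : Phase d) :
    ‖f‖ ^ 2 = ‖fnL d f‖ ^ 2 + (‖gradL d f‖ ^ 2 + ‖wtL d f‖ ^ 2) := by
  rw [WithLp.prod_norm_sq_eq_of_L2, WithLp.prod_norm_sq_eq_of_L2]; rfl

theorem exists_components (a : L2C d) (b : L2G d) (c : L2C d) :
    ∃ f : Phase d, fnL d f = a ∧ gradL d f = b ∧ wtL d f = c :=
  ⟨WithLp.toLp 2 (a, WithLp.toLp 2 (b, c)), rfl, rfl, rfl⟩

end Phase

open Phase

theorem L2_norm_sq {F : Type*} [NormedAddCommGroup F]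
    (u : Lp F 2 (volume : Measure (EuclideanSpace ℝ (Fin d)))) :
    ‖u‖ ^ 2 = ∫ x, ‖u x‖ ^ 2 := by
  have h := ofReal_integral_sq (Lp.memLp u)
  rw [Lp.norm_def, eLpNorm_eq_lintegral_rpow_enorm_toReal (by simp) (by simp)]
  simp only [ENNReal.toReal_ofNat, ENNReal.rpow_two, ← h]
  rw [ENNReal.ofReal_rpow_of_nonneg (integral_nonneg fun x => by positivity) (by norm_num),
    ENNReal.toReal_ofReal (by positivity), ← Real.rpow_natCast, ← Real.rpow_mul
      (integral_nonneg fun x => by positivity)]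
  norm_num

theorem L2_lintegral_sq_le {F : Type*} [NormedAddCommGroup F]
    (u : Lp F 2 (volume : Measure (EuclideanSpace ℝ (Fin d)))) {A : ℝ} (h : ‖u‖ ^ 2 ≤ A) :
    ∫⁻ x, ‖u x‖ₑ ^ 2 ≤ ENNReal.ofReal A := by
  rw [← ofReal_integral_sq (Lp.memLp u), ← L2_norm_sq]
  exact ENNReal.ofReal_le_ofReal h

/-- The continuous functional `u ↦ ∫ a u` for a real `L²` function `a`. -/
noncomputable def testPair (a : EuclideanSpace ℝ (Fin d) → ℝ) (ha : MemLp a 2) : L2C d →L[ℝ] ℂ :=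
  (innerSL ℂ (MemLp.toLp _ (ha.ofReal (K := ℂ)) : L2C d)).restrictScalars ℝ

theorem testPair_apply (a : EuclideanSpace ℝ (Fin d) → ℝ) (ha : MemLp a 2) (u : L2C d) :
    testPair a ha u = ∫ x, a x • u x := by
  simp only [testPair, ContinuousLinearMap.coe_restrictScalars', innerSL_apply_apply]
  rw [L2.inner_def]
  refine integral_congr_ae ?_
  filter_upwards [MemLp.coeFn_toLp (ha.ofReal (K := ℂ))] with x hx
  rw [hx]
  simp [mul_comm]

/-- The `j`-th coordinate of a `ℂ^d`-valued `L²` function. -/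
noncomputable def coordL (j : Fin d) : L2G d →L[ℝ] L2C d :=
  ((EuclideanSpace.proj (𝕜 := ℂ) j : EuclideanSpace ℂ (Fin d) →L[ℂ] ℂ).compLpL 2
    (volume : Measure (EuclideanSpace ℝ (Fin d)))).restrictScalars ℝ

theorem coordL_ae (j : Fin d) (v : L2G d) : coordL j v =ᵐ[volume] fun x => v x j :=
  ContinuousLinearMap.coeFn_compLpL (p := 2) (EuclideanSpace.proj (𝕜 := ℂ) j) v

theorem IsTestFun.norm_mul_memLp {η : EuclideanSpace ℝ (Fin d) → ℝ} (hη : IsTestFun η) :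
    MemLp (fun x => ‖x‖ * η x) 2 :=
  (continuous_norm.mul hη.1.continuous).memLp_of_hasCompactSupport (hη.2.mul_left)

/-- The functional expressing that the gradient component is the weak gradient. -/
noncomputable def gradTest (η : {η : EuclideanSpace ℝ (Fin d) → ℝ // IsTestFun η}) (j : Fin d) :
    Phase d →L[ℝ] ℂ :=
  testPair _ ((η.2.fderiv_apply (EuclideanSpace.single j 1)).memLp 2) ∘L fnL d +
    testPair _ (η.2.memLp 2) ∘L coordL j ∘L gradL d

/-- The functional expressing that the weighted component is `|x|` times the function. -/
noncomputable def wtTest (η : {η : EuclideanSpace ℝ (Fin d) → ℝ // IsTestFun η}) :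
    Phase d →L[ℝ] ℂ :=
  testPair _ (η.2.memLp 2) ∘L wtL d - testPair _ η.2.norm_mul_memLp ∘L fnL d

/-- The space `Σ` as a closed subspace of the Hilbert space of triples. -/
noncomputable def sigma (d : ℕ) : Submodule ℝ (Phase d) :=
  (⨅ η, ⨅ j, (gradTest (d := d) η j).ker) ⊓ ⨅ η, (wtTest (d := d) η).ker

theorem isClosed_sigma (d : ℕ) : IsClosed (sigma d : Set (Phase d)) := by
  simp only [sigma, Submodule.coe_inf, Submodule.coe_iInf]
  exact (isClosed_iInter fun η => isClosed_iInter fun j =>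
    ContinuousLinearMap.isClosed_ker _).inter
      (isClosed_iInter fun η => ContinuousLinearMap.isClosed_ker _)

theorem locallyIntegrable_norm_smul {u : EuclideanSpace ℝ (Fin d) → ℂ}
    (hu : LocallyIntegrable u) : LocallyIntegrable (fun x => ‖x‖ • u x) := by
  rw [← locallyIntegrableOn_univ] at *
  exact hu.continuousOn_smul isOpen_univ.isLocallyClosed continuous_norm.continuousOn

/-- Each kernel in the definition is one tested identity; the fundamental lemma of the calculus of
variations recovers the weighted component almost everywhere. -/
theorem mem_sigma_iff {f : Phase d} : f ∈ sigma d ↔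
    IsWeakGrad (fnL d f) (gradL d f) ∧ wtL d f =ᵐ[volume] fun x => ‖x‖ • fnL d f x := by
  have l1 : LocallyIntegrable (fnL d f) := memLp_two_locallyIntegrable (Lp.memLp _)
  have l2 : LocallyIntegrable (gradL d f) := memLp_two_locallyIntegrable (Lp.memLp _)
  have l3 : LocallyIntegrable (wtL d f) := memLp_two_locallyIntegrable (Lp.memLp _)
  have e1 : ∀ η j, gradTest (d := d) η j f =
      (∫ x, fderiv ℝ η.1 x (EuclideanSpace.single j 1) • fnL d f x) +
        ∫ x, η.1 x • gradL d f x j := by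
    intro η j
    simp only [gradTest, _root_.add_apply, ContinuousLinearMap.comp_apply,
      testPair_apply]
    congr 1
    refine integral_congr_ae ?_
    filter_upwards [coordL_ae j (gradL d f)] with x hx
    rw [hx]
  have e2 : ∀ η, wtTest (d := d) η f =
      (∫ x, η.1 x • wtL d f x) - ∫ x, η.1 x • ‖x‖ • fnL d f x := by
    intro η
    simp only [wtTest, _root_.sub_apply, ContinuousLinearMap.comp_apply,
      testPair_apply]
    congr 1
    refine integral_congr_ae (ae_of_all _ fun x => ?_)
    simp only [smul_smul]; rw [mul_comm]
  simp only [sigma, Submodule.mem_inf, Submodule.mem_iInf, LinearMap.mem_ker,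
    ContinuousLinearMap.coe_coe, e1, e2, sub_eq_zero]
  constructor
  · rintro ⟨h1, h2⟩
    refine ⟨⟨l1, l2, fun η hη j => eq_neg_of_add_eq_zero_left (h1 ⟨η, hη⟩ j)⟩, ?_⟩
    exact ae_eq_of_integral_contDiff_smul_eq l3 (locallyIntegrable_norm_smul l1)
      fun η a b => h2 ⟨η, a, b⟩
  · rintro ⟨h1, h2⟩
    refine ⟨fun η j => by rw [h1.2.2 η.1 η.2 j]; ring, fun η => integral_congr_ae ?_⟩
    filter_upwards [h2] with x hx
    rw [hx]

theorem exists_mem_sigma {u : EuclideanSpace ℝ (Fin d) → ℂ}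
    {G : EuclideanSpace ℝ (Fin d) → EuclideanSpace ℂ (Fin d)} (hu : MemLp u 2)
    (hG : IsWeakGrad u G) (hG2 : MemLp G 2) (hx : MemLp (fun x => ‖x‖ • u x) 2) :
    ∃ f ∈ sigma d, fnL d f =ᵐ[volume] u ∧ gradL d f =ᵐ[volume] G ∧
      wtL d f =ᵐ[volume] fun x => ‖x‖ • u x := by
  obtain ⟨f, h1, h2, h3⟩ := exists_components (hu.toLp u) (hG2.toLp G) (hx.toLp _)
  have a1 : fnL d f =ᵐ[volume] u := h1 ▸ hu.coeFn_toLp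
  have a2 : gradL d f =ᵐ[volume] G := h2 ▸ hG2.coeFn_toLp
  have a3 : wtL d f =ᵐ[volume] fun x => ‖x‖ • u x := h3 ▸ hx.coeFn_toLp
  refine ⟨f, mem_sigma_iff.2 ⟨⟨memLp_two_locallyIntegrable (Lp.memLp _),
    memLp_two_locallyIntegrable (Lp.memLp _), fun η hη j => ?_⟩, ?_⟩, a1, a2, a3⟩
  · have e1 : ∫ x, fderiv ℝ η x (EuclideanSpace.single j 1) • fnL d f x =
        ∫ x, fderiv ℝ η x (EuclideanSpace.single j 1) • u x := by
      refine integral_congr_ae ?_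
      filter_upwards [a1] with x hx; rw [hx]
    have e2 : ∫ x, η x • gradL d f x j = ∫ x, η x • G x j := by
      refine integral_congr_ae ?_
      filter_upwards [a2] with x hx; rw [hx]
    rw [e1, e2, hG.2.2 η hη j]
  · filter_upwards [a1, a3] with x h1 h3
    rw [h3, h1]

/-- For a fixed centre the average is a continuous functional on L², given by the normalized
indicator of the ball. Weak convergence therefore gives convergence of averages at every point. -/
theorem ballAverage_eq_testPair {ε : ℝ} (x : EuclideanSpace ℝ (Fin d)) :
    ∃ (a : EuclideanSpace ℝ (Fin d) → ℝ) (ha : MemLp a 2),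
      ∀ u : L2C d, ballAverage u ε x = testPair a ha u := by
  set c := (volume (Metric.ball (0 : EuclideanSpace ℝ (Fin d)) ε))⁻¹.toReal with hc
  refine ⟨(Metric.ball x ε).indicator fun _ => c,
    memLp_indicator_const 2 measurableSet_ball c (Or.inr measure_ball_lt_top.ne), fun u => ?_⟩
  rw [testPair_apply, ballAverage, ballMeasure, integral_smul_measure, ← hc,
    ← integral_smul]
  have e : ∀ y, (Metric.ball x ε).indicator (fun _ => c) y • u y =
      (Metric.ball x ε).indicator (fun y => c • u y) y := by
    intro y
    by_cases hy : y ∈ Metric.ball x ε <;> simp [hy]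
  simp_rw [e]
  rw [integral_indicator measurableSet_ball]
  have hpre : (fun h => x + h) ⁻¹' Metric.ball x ε = Metric.ball 0 ε := by
    ext h; simp [Metric.mem_ball, dist_eq_norm]
  rw [← (measurePreserving_add_left volume x).setIntegral_preimage_emb
    (measurableEmbedding_addLeft x) (fun y => c • u y) (Metric.ball x ε), hpre]

theorem sigma_bounds {f : Phase d} {A : ℝ} (h : ‖f‖ ^ 2 ≤ A) :
    ‖fnL d f‖ ^ 2 ≤ A ∧ ‖gradL d f‖ ^ 2 ≤ A ∧ ‖wtL d f‖ ^ 2 ≤ A := by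
  have := norm_sq_eq f
  refine ⟨?_, ?_, ?_⟩ <;>
    nlinarith [sq_nonneg ‖fnL d f‖, sq_nonneg ‖gradL d f‖, sq_nonneg ‖wtL d f‖]

theorem memLp_norm_smul_fn {f : Phase d} (hf : f ∈ sigma d) :
    MemLp (fun x => ‖x‖ • fnL d f x) 2 :=
  (memLp_congr_ae (mem_sigma_iff.1 hf).2).1 (Lp.memLp _)

/-- Weakly null sequences of `Σ` converge to zero in `L²` and in `L^(2+4/d)`. -/
theorem tendsto_of_weakly_null (hd : 1 ≤ d) {f : ℕ → Phase d} (hf : ∀ n, f n ∈ sigma d) {C : ℝ}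
    (hC : ∀ n, ‖f n‖ ≤ C) (hw : ∀ h, Tendsto (fun n => inner ℝ (f n) h) atTop (𝓝 0)) :
    Tendsto (fun n => ∫⁻ x, ‖fnL d (f n) x‖ₑ ^ 2) atTop (𝓝 0) ∧
    Tendsto (fun n => ∫⁻ x, ‖fnL d (f n) x‖ₑ ^ (2 + 4 / (d : ℝ))) atTop (𝓝 0) := by
  have hb : ∀ n, ‖f n‖ ^ 2 ≤ C ^ 2 := fun n => by gcongr; exact hC n
  have h2 : Tendsto (fun n => ∫⁻ x, ‖fnL d (f n) x‖ₑ ^ 2) atTop (𝓝 0) := by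
    refine tendsto_lintegral_sq_of_ballAverage (A := C ^ 2) _ (fun n => gradL d (f n))
      (fun n => (mem_sigma_iff.1 (hf n)).1) (fun n => Lp.memLp _) (fun n => Lp.memLp _)
      (fun n => memLp_norm_smul_fn (hf n)) (sq_nonneg C)
      (fun n => L2_lintegral_sq_le _ (sigma_bounds (hb n)).1)
      (fun n => L2_lintegral_sq_le _ (sigma_bounds (hb n)).2.1) (fun n => ?_) ?_
    · refine le_of_eq_of_le (lintegral_congr_ae ?_)
        (L2_lintegral_sq_le _ (sigma_bounds (hb n)).2.2)
      filter_upwards [(mem_sigma_iff.1 (hf n)).2] with x hx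
      rw [hx]
    · intro ε _ x
      obtain ⟨a, ha, h⟩ := ballAverage_eq_testPair (ε := ε) x
      simp_rw [h]
      exact tendsto_clm_of_tendsto_inner hw (testPair a ha ∘L fnL d)
  refine ⟨h2, ?_⟩
  obtain ⟨r, hr, hB⟩ := exists_sobolev_bound hd
  obtain ⟨B, hB0, hB⟩ := hB (C ^ 2) (sq_nonneg C)
  refine tendsto_lintegral_rpow_of_sq (fun n => (Lp.memLp _).1)
    (by linarith [(by positivity : 0 ≤ 4 / (d : ℝ))]) hr (C := B) (fun n => ?_) h2
  exact hB _ _ (mem_sigma_iff.1 (hf n)).1 (Lp.memLp _) (Lp.memLp _)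
    (L2_lintegral_sq_le _ (sigma_bounds (hb n)).1) (L2_lintegral_sq_le _ (sigma_bounds (hb n)).2.1)

/-! ### Action of linear isometries and radial elements -/

theorem IsWeakGrad.congr_ae {u u' : EuclideanSpace ℝ (Fin d) → ℂ}
    {G G' : EuclideanSpace ℝ (Fin d) → EuclideanSpace ℂ (Fin d)} (h : IsWeakGrad u G)
    (hu : u =ᵐ[volume] u') (hG : G =ᵐ[volume] G') : IsWeakGrad u' G' := by
  refine ⟨h.1.congr hu, h.2.1.congr hG, fun η hη j => ?_⟩
  rw [integral_congr_ae (g := fun x => fderiv ℝ η x (EuclideanSpace.single j 1) • u x),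
    h.2.2 η hη j]
  · congr 1
    refine integral_congr_ae ?_
    filter_upwards [hG] with x hx; rw [hx]
  · filter_upwards [hu] with x hx; rw [hx]

/-- The change of the gradient under composition with a linear isometry. -/
noncomputable def rotGrad (g : EuclideanSpace ℝ (Fin d) ≃ₗᵢ[ℝ] EuclideanSpace ℝ (Fin d))
    (v : EuclideanSpace ℂ (Fin d)) : EuclideanSpace ℂ (Fin d) :=
  WithLp.toLp 2 fun j => ∑ k, g (EuclideanSpace.single j 1) k • v k

theorem continuous_rotGrad (g : EuclideanSpace ℝ (Fin d) ≃ₗᵢ[ℝ] EuclideanSpace ℝ (Fin d)) :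
    Continuous (rotGrad g) := by
  unfold rotGrad; fun_prop

theorem sum_isometry_single (g : EuclideanSpace ℝ (Fin d) ≃ₗᵢ[ℝ] EuclideanSpace ℝ (Fin d))
    (a : EuclideanSpace ℝ (Fin d)) (j : Fin d) :
    ∑ k, g (EuclideanSpace.single j 1) k * a k = g.symm a j := by
  have h1 : inner ℝ (g (EuclideanSpace.single j (1 : ℝ))) a =
      inner ℝ (EuclideanSpace.single j (1 : ℝ)) (g.symm a) := by
    conv_lhs => rw [← g.apply_symm_apply a]
    exact g.inner_map_map _ _
  rw [EuclideanSpace.inner_single_left] at h1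
  simp only [PiLp.inner_apply] at h1
  simpa [mul_comm] using h1

/-- `rotGrad g` acts as `g.symm` on the real and imaginary parts separately, and `g.symm` preserves
both norms. -/
theorem norm_rotGrad (g : EuclideanSpace ℝ (Fin d) ≃ₗᵢ[ℝ] EuclideanSpace ℝ (Fin d))
    (v : EuclideanSpace ℂ (Fin d)) : ‖rotGrad g v‖ = ‖v‖ := by
  set a : EuclideanSpace ℝ (Fin d) := WithLp.toLp 2 fun k => (v k).re
  set b : EuclideanSpace ℝ (Fin d) := WithLp.toLp 2 fun k => (v k).im
  have hv : ‖v‖ ^ 2 = ‖a‖ ^ 2 + ‖b‖ ^ 2 := by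
    rw [EuclideanSpace.norm_sq_eq, EuclideanSpace.norm_sq_eq, EuclideanSpace.norm_sq_eq,
      ← Finset.sum_add_distrib]
    refine Finset.sum_congr rfl fun k _ => ?_
    rw [Complex.sq_norm, Complex.normSq_apply]
    simp [a, b, sq]
  have hr : ‖rotGrad g v‖ ^ 2 = ‖g.symm a‖ ^ 2 + ‖g.symm b‖ ^ 2 := by
    rw [EuclideanSpace.norm_sq_eq, EuclideanSpace.norm_sq_eq, EuclideanSpace.norm_sq_eq,
      ← Finset.sum_add_distrib]
    refine Finset.sum_congr rfl fun j _ => ?_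
    rw [Complex.sq_norm, Complex.normSq_apply, ← sum_isometry_single, ← sum_isometry_single]
    simp [a, b, rotGrad, sq]
  rw [g.symm.norm_map, g.symm.norm_map, ← hv] at hr
  exact (sq_eq_sq₀ (norm_nonneg _) (norm_nonneg _)).1 hr

theorem IsTestFun.comp_isometry {η : EuclideanSpace ℝ (Fin d) → ℝ} (hη : IsTestFun η)
    (g : EuclideanSpace ℝ (Fin d) ≃ₗᵢ[ℝ] EuclideanSpace ℝ (Fin d)) :
    IsTestFun (fun x => η (g x)) :=
  ⟨hη.1.comp g.contDiff, hη.2.comp_homeomorph g.toHomeomorph⟩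

theorem IsWeakGrad.comp_isometry {u : EuclideanSpace ℝ (Fin d) → ℂ}
    {G : EuclideanSpace ℝ (Fin d) → EuclideanSpace ℂ (Fin d)} (h : IsWeakGrad u G)
    (hu : MemLp u 2) (hG : MemLp G 2)
    (g : EuclideanSpace ℝ (Fin d) ≃ₗᵢ[ℝ] EuclideanSpace ℝ (Fin d)) :
    MemLp (fun x => rotGrad g (G (g x))) 2 ∧
      IsWeakGrad (fun x => u (g x)) (fun x => rotGrad g (G (g x))) := by
  have hgm := g.measurePreserving
  have hG' : MemLp (fun x => rotGrad g (G (g x))) 2 := by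
    refine (hG.comp_measurePreserving hgm).mono
      ((continuous_rotGrad g).comp_aestronglyMeasurable (hG.comp_measurePreserving hgm).1)
      (ae_of_all _ fun x => ?_)
    rw [norm_rotGrad]; rfl
  refine ⟨hG', memLp_two_locallyIntegrable (hu.comp_measurePreserving hgm),
    memLp_two_locallyIntegrable hG', fun η hη j => ?_⟩
  have hη' := hη.comp_isometry g.symm
  have e : ∀ y, fderiv ℝ (fun x => η (g.symm x)) y (g (EuclideanSpace.single j 1)) =
      fderiv ℝ η (g.symm y) (EuclideanSpace.single j 1) := by
    intro y
    have h1 := ((hη.1.differentiable (by simp)) (g.symm y)).hasFDerivAt.comp y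
      (g.symm.toContinuousLinearEquiv.hasFDerivAt)
    have h2 : fderiv ℝ (fun x => η (g.symm x)) y = _ := h1.fderiv
    rw [h2]; simp
  -- The derivative of u∘g along e_j is that of u along g e_j: test u in this direction against
  -- η∘g⁻¹, then substitute y = g x.
  have h1 := h.isWeakDeriv (g (EuclideanSpace.single j 1)) _ hη'
  simp only [e] at h1
  have cv : ∀ F : EuclideanSpace ℝ (Fin d) → ℂ, ∫ x, F x = ∫ x, F (g x) := fun F =>
    (hgm.integral_comp' (f := g.toHomeomorph.toMeasurableEquiv) F).symm
  rw [cv fun y => fderiv ℝ η (g.symm y) (EuclideanSpace.single j 1) • u y,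
    cv fun y => η (g.symm y) • ∑ k, g (EuclideanSpace.single j 1) k • G y k] at h1
  simpa [rotGrad] using h1

/-- Composition with a linear isometry acts isometrically on `Σ`. -/
theorem exists_comp_isometry {f : Phase d} (hf : f ∈ sigma d)
    (g : EuclideanSpace ℝ (Fin d) ≃ₗᵢ[ℝ] EuclideanSpace ℝ (Fin d)) :
    ∃ f' ∈ sigma d, (fnL d f' =ᵐ[volume] fun x => fnL d f (g x)) ∧ ‖f'‖ = ‖f‖ := by
  have hgm := g.measurePreserving
  have hf' := mem_sigma_iff.1 hf
  obtain ⟨hG2, hG⟩ := hf'.1.comp_isometry (Lp.memLp _) (Lp.memLp _) g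
  have hu : MemLp (fun x => fnL d f (g x)) 2 := (Lp.memLp _).comp_measurePreserving hgm
  have hx : MemLp (fun x => ‖x‖ • fnL d f (g x)) 2 := by
    have := (memLp_norm_smul_fn hf).comp_measurePreserving hgm
    simpa [Function.comp_def] using this
  obtain ⟨f', h1, h2, h3, h4⟩ := exists_mem_sigma hu hG hG2 hx
  refine ⟨f', h1, h2, ?_⟩
  have key : ‖f'‖ ^ 2 = ‖f‖ ^ 2 := by
    rw [norm_sq_eq, norm_sq_eq, L2_norm_sq, L2_norm_sq, L2_norm_sq, L2_norm_sq, L2_norm_sq,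
      L2_norm_sq]
    have cv : ∀ F : EuclideanSpace ℝ (Fin d) → ℝ, ∫ x, F (g x) = ∫ x, F x := fun F =>
      hgm.integral_comp' (f := g.toHomeomorph.toMeasurableEquiv) F
    rw [← cv fun x => ‖fnL d f x‖ ^ 2, ← cv fun x => ‖gradL d f x‖ ^ 2]
    have e3 : ∫ x, ‖wtL d f x‖ ^ 2 = ∫ x, ‖‖x‖ • fnL d f (g x)‖ ^ 2 := by
      rw [integral_congr_ae (g := fun x => ‖‖x‖ • fnL d f x‖ ^ 2)
        (by filter_upwards [hf'.2] with x hx; rw [hx]), ← cv]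
      simp
    rw [e3]
    congr 1
    · refine integral_congr_ae ?_
      filter_upwards [h2] with x hx; rw [hx]
    · congr 1
      · refine integral_congr_ae ?_
        filter_upwards [h3] with x hx; rw [hx, norm_rotGrad]
      · refine integral_congr_ae ?_
        filter_upwards [h4] with x hx; rw [hx]
  exact (sq_eq_sq₀ (norm_nonneg _) (norm_nonneg _)).1 key

/-- Invariance of an `L²` function under a linear isometry, as the kernel of a functional. -/
noncomputable def rotDiff (g : EuclideanSpace ℝ (Fin d) ≃ₗᵢ[ℝ] EuclideanSpace ℝ (Fin d)) :
    Phase d →L[ℝ] L2C d :=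
  (Lp.compMeasurePreservingₗᵢ (E := ℂ) (p := 2) ℝ g
    g.measurePreserving).toContinuousLinearMap ∘L fnL d - fnL d

/-- The closed subspace of isometry-invariant elements of `Σ`. -/
noncomputable def radialSigma (d : ℕ) : Submodule ℝ (Phase d) :=
  sigma d ⊓ ⨅ g, (rotDiff (d := d) g).ker

theorem isClosed_radialSigma (d : ℕ) : IsClosed (radialSigma d : Set (Phase d)) := by
  simp only [radialSigma, Submodule.coe_inf, Submodule.coe_iInf]
  exact (isClosed_sigma d).inter (isClosed_iInter fun g => ContinuousLinearMap.isClosed_ker _)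

theorem mem_radialSigma_iff {f : Phase d} : f ∈ radialSigma d ↔ f ∈ sigma d ∧
    ∀ g : EuclideanSpace ℝ (Fin d) ≃ₗᵢ[ℝ] EuclideanSpace ℝ (Fin d),
      (fun x => fnL d f (g x)) =ᵐ[volume] fnL d f := by
  simp only [radialSigma, Submodule.mem_inf, Submodule.mem_iInf, LinearMap.mem_ker,
    ContinuousLinearMap.coe_coe]
  refine and_congr_right fun _ => forall_congr' fun g => ?_
  have h := Lp.coeFn_compMeasurePreserving (fnL d f) g.measurePreserving
  have e : rotDiff g f =
      Lp.compMeasurePreserving g g.measurePreserving (fnL d f) - fnL d f := rfl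
  rw [e, sub_eq_zero]
  constructor
  · intro h1; rw [h1] at h; exact h.symm
  · intro h1; exact Lp.ext (h.trans h1)

/-- The reflection in the hyperplane orthogonal to x - y. -/
theorem exists_isometry_of_norm_eq {x y : EuclideanSpace ℝ (Fin d)} (h : ‖x‖ = ‖y‖) :
    ∃ g : EuclideanSpace ℝ (Fin d) ≃ₗᵢ[ℝ] EuclideanSpace ℝ (Fin d), g x = y :=
  ⟨_, Submodule.reflection_sub h⟩

theorem isRadial_of_forall {φ : EuclideanSpace ℝ (Fin d) → ℂ}
    (h : ∀ x y, ‖x‖ = ‖y‖ → φ x = φ y) : IsRadial φ := by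
  have hf : Function.FactorsThrough φ (norm : EuclideanSpace ℝ (Fin d) → ℝ) := fun x y => h x y
  exact ⟨Function.extend norm φ 0, fun x => (hf.extend_apply 0 x).symm⟩

/-- The exceptional null set in the invariance depends on the isometry, so u itself need not be
radial. Its averages over closed balls about x do depend on ‖x‖ alone, and Lebesgue differentiation
recovers u almost everywhere as their limit. Where no limit exists, `limUnder` still depends only on
the sequence of averages, hence only on ‖x‖. -/
theorem exists_radial_representative {u : EuclideanSpace ℝ (Fin d) → ℂ}
    (hu : LocallyIntegrable u)
    (h : ∀ g : EuclideanSpace ℝ (Fin d) ≃ₗᵢ[ℝ] EuclideanSpace ℝ (Fin d),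
      (fun x => u (g x)) =ᵐ[volume] u) : ∃ φ, IsRadial φ ∧ φ =ᵐ[volume] u := by
  set A : ℕ → EuclideanSpace ℝ (Fin d) → ℂ :=
    fun n x => ⨍ y in Metric.closedBall x (1 / ((n : ℝ) + 1)), u y with hA
  refine ⟨fun x => limUnder atTop fun n => A n x, isRadial_of_forall fun x y hxy => ?_, ?_⟩
  · obtain ⟨g, rfl⟩ := exists_isometry_of_norm_eq hxy
    congr 1; ext n
    have hgm := g.measurePreserving
    have hpre : g ⁻¹' Metric.closedBall (g x) (1 / ((n : ℝ) + 1)) =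
        Metric.closedBall x (1 / ((n : ℝ) + 1)) := by
      ext z; simp
    have hemb : MeasurableEmbedding g := g.toHomeomorph.measurableEmbedding
    have e1 : ∫ z in Metric.closedBall x (1 / ((n : ℝ) + 1)), u (g z) =
        ∫ y in Metric.closedBall (g x) (1 / ((n : ℝ) + 1)), u y := by
      rw [← hpre]; exact hgm.setIntegral_preimage_emb hemb _ _
    have e2 : ∫ z in Metric.closedBall x (1 / ((n : ℝ) + 1)), u (g z) =
        ∫ z in Metric.closedBall x (1 / ((n : ℝ) + 1)), u z :=
      integral_congr_ae (ae_restrict_of_ae (h g))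
    simp only [hA]
    rw [setAverage_eq, setAverage_eq, ← e1, e2]
    congr 2
    rw [measureReal_def, measureReal_def, ← hpre,
      hgm.measure_preimage measurableSet_closedBall.nullMeasurableSet]
  · have hlim : Tendsto (fun n : ℕ => 1 / ((n : ℝ) + 1)) atTop (𝓝[>] 0) :=
      tendsto_nhdsWithin_iff.2 ⟨tendsto_one_div_add_atTop_nhds_zero_nat,
        Eventually.of_forall fun n => by simp only [Set.mem_Ioi]; positivity⟩
    filter_upwards [IsUnifLocDoublingMeasure.ae_tendsto_average (μ := volume) hu 1] with x hx
    exact (hx (fun _ => x) _ hlim (Eventually.of_forall fun n => by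
      simp only [Metric.mem_closedBall, dist_self]; positivity)).limUnder_eq

/-! ### Energy and constraint on triples -/

/-- The energy on the Hilbert space of triples. -/
noncomputable def energyQ (d : ℕ) (ν : ℝ) (f : Phase d) : ℝ :=
  1 / 4 * (‖gradL d f‖ ^ 2 + ‖wtL d f‖ ^ 2) - ν / 2 * ‖fnL d f‖ ^ 2

/-- The potential `∫ |ψ|^(2+4/d)` on the Hilbert space of triples. -/
noncomputable def potQ (d : ℕ) (f : Phase d) : ℝ :=
  ∫ x, ‖fnL d f x‖ ^ (2 + 4 / (d : ℝ))

/-- The gradient picked by choice in `weakGrad` agrees almost everywhere with the gradient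
component, since weak gradients are unique. -/
theorem energy_eq_energyQ {f : Phase d} (hf : f ∈ sigma d) {ψ : EuclideanSpace ℝ (Fin d) → ℂ}
    (h : fnL d f =ᵐ[volume] ψ) (ν : ℝ) : energy ν ψ = energyQ d ν f := by
  have hf' := mem_sigma_iff.1 hf
  have hex : ∃ G, IsWeakGrad ψ G := ⟨_, hf'.1.congr_ae h (ae_eq_refl _)⟩
  have hw : weakGrad ψ =ᵐ[volume] gradL d f := by
    have h1 : IsWeakGrad ψ (weakGrad ψ) := by
      rw [weakGrad, dif_pos hex]; exact hex.choose_spec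
    exact h1.ae_eq (hf'.1.congr_ae h (ae_eq_refl _))
  have e1 : ∫ x, ‖weakGrad ψ x‖ ^ 2 = ‖gradL d f‖ ^ 2 := by
    rw [L2_norm_sq]; refine integral_congr_ae ?_
    filter_upwards [hw] with x hx; rw [hx]
  have e2 : ∫ x, ‖x‖ ^ 2 * ‖ψ x‖ ^ 2 = ‖wtL d f‖ ^ 2 := by
    rw [L2_norm_sq]; refine integral_congr_ae ?_
    filter_upwards [hf'.2, h] with x hx hx2
    rw [hx, hx2, norm_smul, norm_norm, mul_pow]
  have e3 : ∫ x, ‖ψ x‖ ^ 2 = ‖fnL d f‖ ^ 2 := by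
    rw [L2_norm_sq]; refine integral_congr_ae ?_
    filter_upwards [h] with x hx; rw [hx]
  rw [energy, formH, e1, e2, e3, energyQ]; ring

theorem memSigma_of_ae_eq {f : Phase d} (hf : f ∈ sigma d) {ψ : EuclideanSpace ℝ (Fin d) → ℂ}
    (h : fnL d f =ᵐ[volume] ψ) : MemSigma ψ := by
  have hf' := mem_sigma_iff.1 hf
  refine ⟨(memLp_congr_ae h).1 (Lp.memLp _),
    ⟨_, hf'.1.congr_ae h (ae_eq_refl _), Lp.memLp _⟩, ?_⟩
  refine (memLp_congr_ae ?_).1 (memLp_norm_smul_fn hf)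
  filter_upwards [h] with x hx; rw [hx]

theorem constraint_iff (hd : 1 ≤ d) (t : ℝ) :
    1 / (1 + 2 / (d : ℝ)) * t = 1 ↔ t = 1 + 2 / (d : ℝ) := by
  have : (0 : ℝ) < 1 + 2 / d := by positivity
  rw [one_div, inv_mul_eq_div, div_eq_one_iff_eq this.ne']

theorem potQ_eq {f : Phase d} {ψ : EuclideanSpace ℝ (Fin d) → ℂ}
    (h : fnL d f =ᵐ[volume] ψ) : potQ d f = ∫ x, ‖ψ x‖ ^ (2 + 4 / (d : ℝ)) := by
  refine integral_congr_ae ?_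
  filter_upwards [h] with x hx; rw [hx]

theorem exists_of_mem_constraintSet (hd : 1 ≤ d) {ψ : EuclideanSpace ℝ (Fin d) → ℂ}
    (h : ψ ∈ constraintSet d) :
    ∃ f ∈ radialSigma d, potQ d f = 1 + 2 / (d : ℝ) ∧ fnL d f =ᵐ[volume] ψ := by
  obtain ⟨⟨h1, ⟨G, hG, hG2⟩, h3⟩, ⟨F, hF⟩, h5⟩ := h
  obtain ⟨f, hf, e1, -, -⟩ := exists_mem_sigma h1 hG hG2 h3
  refine ⟨f, mem_radialSigma_iff.2 ⟨hf, fun g => ?_⟩, ?_, e1⟩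
  · have := g.measurePreserving.quasiMeasurePreserving.ae_eq_comp e1
    filter_upwards [this, e1] with x a b
    simp only [Function.comp_apply] at a
    rw [a, b, hF, hF, g.norm_map]
  · rw [potQ_eq e1]; exact (constraint_iff hd _).1 h5

theorem exists_mem_constraintSet (hd : 1 ≤ d) {f : Phase d} (hf : f ∈ radialSigma d)
    (h : potQ d f = 1 + 2 / (d : ℝ)) : ∃ φ ∈ constraintSet d, fnL d f =ᵐ[volume] φ := by
  obtain ⟨φ, h1, h2⟩ := exists_radial_representative
    (memLp_two_locallyIntegrable (Lp.memLp _)) (mem_radialSigma_iff.1 hf).2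
  refine ⟨φ, ⟨memSigma_of_ae_eq (mem_radialSigma_iff.1 hf).1 h2.symm, h1, ?_⟩, h2.symm⟩
  rw [constraint_iff hd, ← potQ_eq h2.symm, h]

/-- The critical exponent lies between 2 and the exponent r of the Sobolev bound; interpolate at
threshold `K = 1`. -/
theorem exists_lintegral_crit_bound (hd : 1 ≤ d) (A : ℝ) : ∃ C : ℝ, 0 ≤ C ∧
    ∀ f ∈ sigma d, ‖f‖ ≤ A → ∫⁻ x, ‖fnL d f x‖ₑ ^ (2 + 4 / (d : ℝ)) ≤ ENNReal.ofReal C := by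
  obtain ⟨r, hr, h⟩ := exists_sobolev_bound hd
  obtain ⟨C, hC0, hC⟩ := h (A ^ 2) (sq_nonneg A)
  refine ⟨A ^ 2 + C, by positivity, fun f hf hA => ?_⟩
  have hb : ‖f‖ ^ 2 ≤ A ^ 2 := by gcongr
  have h1 := lintegral_rpow_le_interpolate (w := fnL d f) (Lp.memLp _).1
    (p := 2 + 4 / (d : ℝ)) (K := 1) (by linarith [(by positivity : 0 ≤ 4 / (d : ℝ))]) hr.le one_pos
  have b1 := L2_lintegral_sq_le _ (sigma_bounds hb).1
  have b2 := hC _ _ (mem_sigma_iff.1 hf).1 (Lp.memLp _) (Lp.memLp _) b1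
    (L2_lintegral_sq_le _ (sigma_bounds hb).2.1)
  simp only [Real.one_rpow, ENNReal.ofReal_one, one_mul] at h1
  rw [ENNReal.ofReal_add (sq_nonneg A) hC0]
  exact h1.trans (add_le_add b1 b2)

theorem crit_toReal (d : ℕ) : (ENNReal.ofReal (2 + 4 / (d : ℝ))).toReal = 2 + 4 / (d : ℝ) :=
  ENNReal.toReal_ofReal (by positivity)

theorem crit_ne_zero (d : ℕ) : ENNReal.ofReal (2 + 4 / (d : ℝ)) ≠ 0 := by
  have : 0 < 2 + 4 / (d : ℝ) := by positivity
  simpa using this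

theorem one_le_crit (d : ℕ) : 1 ≤ ENNReal.ofReal (2 + 4 / (d : ℝ)) := by
  rw [ENNReal.one_le_ofReal]
  have : 0 ≤ 4 / (d : ℝ) := by positivity
  linarith

theorem memLp_crit (hd : 1 ≤ d) {f : Phase d} (hf : f ∈ sigma d) :
    MemLp (fnL d f) (ENNReal.ofReal (2 + 4 / (d : ℝ))) := by
  refine ⟨(Lp.memLp _).1, ?_⟩
  rw [eLpNorm_lt_top_iff_lintegral_rpow_enorm_lt_top (crit_ne_zero d) ENNReal.ofReal_ne_top,
    crit_toReal]
  obtain ⟨C, -, hC⟩ := exists_lintegral_crit_bound hd ‖f‖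
  exact (hC f hf le_rfl).trans_lt ENNReal.ofReal_lt_top

theorem integrable_crit {w : EuclideanSpace ℝ (Fin d) → ℂ}
    (hw : MemLp w (ENNReal.ofReal (2 + 4 / (d : ℝ)))) :
    Integrable (fun x => ‖w x‖ ^ (2 + 4 / (d : ℝ))) := by
  have := hw.integrable_norm_rpow (crit_ne_zero d) ENNReal.ofReal_ne_top
  rwa [crit_toReal] at this

theorem lintegral_eq_potQ (hd : 1 ≤ d) {f : Phase d} (hf : f ∈ sigma d) :
    ∫⁻ x, ‖fnL d f x‖ₑ ^ (2 + 4 / (d : ℝ)) = ENNReal.ofReal (potQ d f) := by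
  rw [potQ, ofReal_integral_eq_lintegral_ofReal (integrable_crit (memLp_crit hd hf))
    (ae_of_all _ fun x => by positivity)]
  refine lintegral_congr fun x => ?_
  rw [← ENNReal.ofReal_rpow_of_nonneg (norm_nonneg _) (by positivity), ofReal_norm]

theorem eLpNorm_crit_eq (hd : 1 ≤ d) {f : Phase d} (hf : f ∈ sigma d) :
    eLpNorm (fnL d f) (ENNReal.ofReal (2 + 4 / (d : ℝ))) volume =
      ENNReal.ofReal (potQ d f) ^ (1 / (2 + 4 / (d : ℝ))) := by
  rw [eLpNorm_eq_lintegral_rpow_enorm_toReal (crit_ne_zero d) ENNReal.ofReal_ne_top, crit_toReal,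
    lintegral_eq_potQ hd hf]

theorem potQ_nonneg (f : Phase d) : 0 ≤ potQ d f := integral_nonneg fun x => by positivity

/-- The triangle inequality in L^p, used in both directions, identifies the norm of the limit. -/
theorem potQ_eq_of_tendsto (hd : 1 ≤ d) {f : ℕ → Phase d} {φ : Phase d} (hf : ∀ n, f n ∈ sigma d)
    (hφ : φ ∈ sigma d) {c : ℝ} (hc0 : 0 ≤ c) (hc : ∀ n, potQ d (f n) = c)
    (h : Tendsto (fun n => ∫⁻ x, ‖fnL d (f n - φ) x‖ₑ ^ (2 + 4 / (d : ℝ))) atTop (𝓝 0)) :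
    potQ d φ = c := by
  have hp : 0 < 2 + 4 / (d : ℝ) := by positivity
  set p := ENNReal.ofReal (2 + 4 / (d : ℝ))
  set D : ℕ → ENNReal := fun n => eLpNorm (fnL d (f n - φ)) p volume with hD
  have hDlim : Tendsto D atTop (𝓝 0) := by
    have h1 := (ENNReal.continuous_rpow_const (y := 1 / (2 + 4 / (d : ℝ)))).tendsto 0 |>.comp h
    rw [ENNReal.zero_rpow_of_pos (by positivity)] at h1
    refine h1.congr fun n => ?_
    simp only [hD, Function.comp_apply]
    rw [eLpNorm_eq_lintegral_rpow_enorm_toReal (crit_ne_zero d) ENNReal.ofReal_ne_top,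
      crit_toReal]
  have hsub : ∀ n, fnL d (f n - φ) =ᵐ[volume] fun x => fnL d (f n) x - fnL d φ x := fun n => by
    rw [map_sub]; exact Lp.coeFn_sub _ _
  have hu : ∀ n, eLpNorm (fnL d (f n)) p volume ≤ eLpNorm (fnL d φ) p volume + D n := by
    intro n
    rw [eLpNorm_congr_ae (g := (fnL d φ : EuclideanSpace ℝ (Fin d) → ℂ) +
      fun x => fnL d (f n - φ) x)
      (by filter_upwards [hsub n] with x hx; rw [Pi.add_apply, hx]; ring)]
    exact eLpNorm_add_le (Lp.memLp _).1 (Lp.memLp _).1 (one_le_crit d)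
  have hl : ∀ n, eLpNorm (fnL d φ) p volume ≤ eLpNorm (fnL d (f n)) p volume + D n := by
    intro n
    rw [eLpNorm_congr_ae (g := (fnL d (f n) : EuclideanSpace ℝ (Fin d) → ℂ) -
      fun x => fnL d (f n - φ) x)
      (by filter_upwards [hsub n] with x hx; rw [Pi.sub_apply, hx]; ring)]
    exact eLpNorm_sub_le (Lp.memLp _).1 (Lp.memLp _).1 (one_le_crit d)
  simp only [eLpNorm_crit_eq hd (hf _), hc, p, eLpNorm_crit_eq hd hφ] at hu hl
  have e : ENNReal.ofReal (potQ d φ) ^ (1 / (2 + 4 / (d : ℝ))) =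
      ENNReal.ofReal c ^ (1 / (2 + 4 / (d : ℝ))) := by
    refine le_antisymm ?_ ?_
    · exact ge_of_tendsto' (by simpa using hDlim.const_add _) hl
    · exact ge_of_tendsto' (by simpa using hDlim.const_add _) hu
  have := ENNReal.rpow_left_injective (x := 1 / (2 + 4 / (d : ℝ))) (by positivity) e
  exact (ENNReal.ofReal_eq_ofReal_iff (potQ_nonneg φ) hc0).1 this

/-! ### Existence of a minimizer -/

theorem sq_le_indicator_add (z : ℂ) (x : EuclideanSpace ℝ (Fin d)) {R p : ℝ} (hR : 0 < R)
    (hp : 2 ≤ p) : ‖z‖ ^ 2 ≤ (Metric.ball (0 : EuclideanSpace ℝ (Fin d)) R).indicator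
      (fun _ => (1 : ℝ)) x + ‖z‖ ^ p + (R ^ 2)⁻¹ * ‖‖x‖ • z‖ ^ 2 := by
  by_cases hx : x ∈ Metric.ball (0 : EuclideanSpace ℝ (Fin d)) R
  · rw [Set.indicator_of_mem hx]
    refine le_add_of_le_of_nonneg ?_ (by positivity)
    rcases le_total ‖z‖ 1 with h | h
    · refine le_add_of_le_of_nonneg ?_ (by positivity)
      exact pow_le_one₀ (norm_nonneg _) h
    · refine le_add_of_nonneg_of_le zero_le_one ?_
      rw [← Real.rpow_two]
      exact Real.rpow_le_rpow_of_exponent_le h hp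
  · rw [Set.indicator_of_notMem hx, zero_add]
    refine le_add_of_nonneg_of_le (by positivity) ?_
    have hx' : R ≤ ‖x‖ := by simpa using hx
    rw [norm_smul, norm_norm, mul_pow, ← mul_assoc, inv_mul_eq_div]
    refine le_mul_of_one_le_left (by positivity) ?_
    rw [one_le_div (by positivity)]
    gcongr

theorem norm_sq_fn_le (hd : 1 ≤ d) {f : Phase d} (hf : f ∈ sigma d) {R : ℝ} (hR : 0 < R) :
    ‖fnL d f‖ ^ 2 ≤ volume.real (Metric.ball (0 : EuclideanSpace ℝ (Fin d)) R) + potQ d f +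
      (R ^ 2)⁻¹ * ‖wtL d f‖ ^ 2 := by
  have hp : (2 : ℝ) ≤ 2 + 4 / d := by linarith [(by positivity : 0 ≤ 4 / (d : ℝ))]
  have i1 : Integrable ((Metric.ball (0 : EuclideanSpace ℝ (Fin d)) R).indicator
      (fun _ => (1 : ℝ))) :=
    (integrable_indicator_iff measurableSet_ball).2 (integrableOn_const measure_ball_lt_top.ne)
  have i2 := integrable_crit (memLp_crit hd hf)
  have i3 := (integrable_norm_sq (memLp_norm_smul_fn hf)).const_mul (R ^ 2)⁻¹
  have e3 : ‖wtL d f‖ ^ 2 = ∫ x, ‖‖x‖ • fnL d f x‖ ^ 2 := by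
    rw [L2_norm_sq]; refine integral_congr_ae ?_
    filter_upwards [(mem_sigma_iff.1 hf).2] with x hx; rw [hx]
  have := integral_mono (integrable_norm_sq (Lp.memLp (fnL d f))) ((i1.add i2).add i3)
    (fun x => sq_le_indicator_add (fnL d f x) x hR hp)
  rw [integral_add' (i1.add i2) i3, integral_add' i1 i2, integral_indicator measurableSet_ball,
    integral_const_mul, ← e3, ← L2_norm_sq] at this
  simpa [potQ] using this

theorem energyQ_eq (ν : ℝ) (f : Phase d) :
    energyQ d ν f = 1 / 4 * ‖f‖ ^ 2 - (1 / 4 + ν / 2) * ‖fnL d f‖ ^ 2 := by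
  rw [energyQ, norm_sq_eq]; ring

/-- On the constraint set the mass term, whatever the sign and size of ν, is absorbed by the
weighted norm up to a constant. No spectral information enters. -/
theorem exists_coercive (hd : 1 ≤ d) (ν c : ℝ) : ∃ K : ℝ, ∀ f ∈ sigma d, potQ d f = c →
    ‖f‖ ^ 2 ≤ 8 * energyQ d ν f + K := by
  -- Eight times the energy is 2(‖∇u‖² + ‖xu‖²) - 4ν‖u‖², so one copy of ‖xu‖² has to absorb (1 +
  -- 4|ν|)‖u‖². The cutoff R² = s gives its weight exactly coefficient one.
  set s := 4 * |ν| + 1 with hs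
  have hs0 : 0 < s := by positivity
  refine ⟨s * (volume.real (Metric.ball (0 : EuclideanSpace ℝ (Fin d)) (√s)) + c),
    fun f hf hfc => ?_⟩
  have h1 := norm_sq_fn_le hd hf (Real.sqrt_pos.2 hs0)
  rw [Real.sq_sqrt hs0.le, hfc] at h1
  have h2 : s * ‖fnL d f‖ ^ 2 ≤ s * (volume.real (Metric.ball (0 : EuclideanSpace ℝ (Fin d)) (√s))
      + c) + ‖wtL d f‖ ^ 2 := by
    refine (mul_le_mul_of_nonneg_left h1 hs0.le).trans_eq ?_
    field_simp
  have h3 : ν * ‖fnL d f‖ ^ 2 ≤ |ν| * ‖fnL d f‖ ^ 2 := by gcongr; exact le_abs_self ν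
  rw [norm_sq_eq, energyQ]
  nlinarith [sq_nonneg ‖gradL d f‖]

/-- The energy is a quarter of the squared Hilbert norm minus a multiple of the mass: the first is
weakly lower semicontinuous and the second converges, so the sign of its coefficient is irrelevant.
-/
theorem energyQ_le_of_weak_limit {ν : ℝ} {f : ℕ → Phase d} {φ : Phase d} {m : ℝ}
    (hw : ∀ h, Tendsto (fun n => inner ℝ (f n - φ) h) atTop (𝓝 0))
    (h2 : Tendsto (fun n => ∫⁻ x, ‖fnL d (f n - φ) x‖ₑ ^ 2) atTop (𝓝 0))
    (hm : Tendsto (fun n => energyQ d ν (f n)) atTop (𝓝 m)) : energyQ d ν φ ≤ m := by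
  have h3 : Tendsto (fun n => ‖fnL d (f n - φ)‖ ^ 2) atTop (𝓝 0) := by
    have := (ENNReal.tendsto_toReal ENNReal.zero_ne_top).comp h2
    rw [ENNReal.toReal_zero] at this
    refine this.congr fun n => ?_
    rw [L2_norm_sq, Function.comp_apply, ← ofReal_integral_sq (Lp.memLp _),
      ENNReal.toReal_ofReal (integral_nonneg fun x => by positivity)]
  have h4 : Tendsto (fun n => fnL d (f n - φ)) atTop (𝓝 0) := by
    rw [tendsto_zero_iff_norm_tendsto_zero]
    have := (Real.continuous_sqrt.tendsto 0).comp h3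
    simpa [Function.comp_def, Real.sqrt_sq (norm_nonneg _)] using this
  have h5 : Tendsto (fun n => ‖fnL d (f n)‖ ^ 2) atTop (𝓝 (‖fnL d φ‖ ^ 2)) := by
    have := ((h4.add_const (fnL d φ)).norm).pow 2
    simpa using this
  have h6 : Tendsto (fun n => 1 / 4 * (‖φ‖ ^ 2 + 2 * inner ℝ (f n - φ) φ) -
      (1 / 4 + ν / 2) * ‖fnL d (f n)‖ ^ 2) atTop (𝓝 (energyQ d ν φ)) := by
    rw [energyQ_eq]
    refine Tendsto.sub ?_ (h5.const_mul _)
    have := (((hw φ).const_mul 2).const_add (‖φ‖ ^ 2)).const_mul (1 / 4 : ℝ)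
    simpa using this
  refine le_of_tendsto_of_tendsto' h6 hm fun n => ?_
  rw [energyQ_eq]
  have : ‖f n‖ ^ 2 = ‖f n - φ‖ ^ 2 + 2 * inner ℝ (f n - φ) φ + ‖φ‖ ^ 2 := by
    rw [← norm_add_sq_real, sub_add_cancel]
  nlinarith [sq_nonneg ‖f n - φ‖]

/-- The infimum of the energy over the radial constraint set is attained. -/
theorem exists_minimizer (hd : 1 ≤ d) (ν : ℝ) {c : ℝ} (hc0 : 0 ≤ c)
    (hne : ∃ f ∈ radialSigma d, potQ d f = c) :
    ∃ φ ∈ radialSigma d, potQ d φ = c ∧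
      ∀ f ∈ radialSigma d, potQ d f = c → energyQ d ν φ ≤ energyQ d ν f := by
  set S : Set ℝ := energyQ d ν '' {f | f ∈ radialSigma d ∧ potQ d f = c} with hS
  obtain ⟨K, hK⟩ := exists_coercive hd ν c
  have hSne : S.Nonempty := by
    obtain ⟨f, h1, h2⟩ := hne
    exact ⟨_, f, ⟨h1, h2⟩, rfl⟩
  have hSb : BddBelow S := by
    refine ⟨-K / 8, ?_⟩
    rintro _ ⟨f, ⟨h1, h2⟩, rfl⟩
    have := hK f (mem_radialSigma_iff.1 h1).1 h2
    linarith [sq_nonneg ‖f‖]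
  obtain ⟨e, -, hlim, he⟩ := exists_seq_tendsto_sInf hSne hSb
  choose f hf hfe using he
  obtain ⟨T, hT⟩ := hlim.bddAbove_range
  have hfs : ∀ n, f n ∈ sigma d := fun n => (mem_radialSigma_iff.1 (hf n).1).1
  have hbd : ∀ n, ‖f n‖ ≤ √(8 * T + K) := fun n => by
    refine Real.le_sqrt_of_sq_le ((hK _ (hfs n) (hf n).2).trans ?_)
    rw [hfe]; linarith [hT ⟨n, rfl⟩]
  obtain ⟨φ, s, hs, hφ⟩ := exists_subseq_weakly_convergent hbd
  have hφR : φ ∈ radialSigma d :=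
    mem_of_tendsto_inner (isClosed_radialSigma d) (fun n => (hf (s n)).1) hφ
  have hφs := (mem_radialSigma_iff.1 hφR).1
  have hw : ∀ h, Tendsto (fun n => inner ℝ (f (s n) - φ) h) atTop (𝓝 0) := fun h => by
    have := (hφ h).sub_const (inner ℝ φ h)
    simpa [inner_sub_left] using this
  obtain ⟨t2, tp⟩ := tendsto_of_weakly_null hd (f := fun n => f (s n) - φ)
    (fun n => (sigma d).sub_mem (hfs _) hφs) (C := √(8 * T + K) + ‖φ‖)
    (fun n => (norm_sub_le _ _).trans (add_le_add_left (hbd _) _)) hw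
  refine ⟨φ, hφR, potQ_eq_of_tendsto hd (fun n => hfs (s n)) hφs hc0 (fun n => (hf (s n)).2) tp,
    fun g hg hgc => ?_⟩
  have h1 : energyQ d ν φ ≤ sInf S := by
    refine energyQ_le_of_weak_limit hw t2 ?_
    simp_rw [hfe]
    exact hlim.comp hs.tendsto_atTop
  exact h1.trans (csInf_le hSb ⟨g, ⟨hg, hgc⟩, rfl⟩)

/-! ### Derivatives and the Euler–Lagrange equation in radial directions -/

theorem rpow_mul_self_self {p a : ℝ} (hp : 2 ≤ p) (ha : 0 ≤ a) :
    a ^ (p - 2) * (a * a) = a ^ p := by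
  rcases eq_or_lt_of_le ha with rfl | h
  · simp [Real.zero_rpow (by linarith : p ≠ 0)]
  · rw [← sq, ← Real.rpow_natCast, ← Real.rpow_add h]; congr 1; push_cast; ring

theorem norm_rpow_mul_le {p a b : ℝ} (hp : 2 ≤ p) (ha : 0 ≤ a) (hb : 0 ≤ b) :
    a ^ (p - 2) * (a * b) ≤ (a + b) ^ p := by
  rw [← rpow_mul_self_self hp (add_nonneg ha hb)]
  have : a ^ (p - 2) ≤ (a + b) ^ (p - 2) := Real.rpow_le_rpow ha (by linarith) (by linarith)
  gcongr <;> linarith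

/-- The derivative of `∫ |u|^p` in the direction `v`. -/
theorem hasDerivAt_integral_norm_rpow {α : Type*} [MeasurableSpace α] {μ : Measure α} {p : ℝ}
    (hp : 2 ≤ p) {u v : α → ℂ} (hu : MemLp u (ENNReal.ofReal p) μ)
    (hv : MemLp v (ENNReal.ofReal p) μ) :
    Integrable (fun x => ‖u x‖ ^ (p - 2) * inner ℝ (u x) (v x)) μ ∧
    HasDerivAt (fun t : ℝ => ∫ x, ‖u x + t • v x‖ ^ p ∂μ)
      (p * ∫ x, ‖u x‖ ^ (p - 2) * inner ℝ (u x) (v x) ∂μ) 0 := by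
  have hp0 : 0 < p := by linarith
  have hpne : ENNReal.ofReal p ≠ 0 := by simpa using hp0
  have hint : ∀ w : α → ℂ, MemLp w (ENNReal.ofReal p) μ → Integrable (fun x => ‖w x‖ ^ p) μ := by
    intro w hw
    have := hw.integrable_norm_rpow hpne ENNReal.ofReal_ne_top
    rwa [ENNReal.toReal_ofReal hp0.le] at this
  -- The dominating function for |t| < 1. One ‖v‖ bounds the shift t v, the other comes from
  -- `norm_rpow_mul_le`.
  have hbd : Integrable (fun x => p * (‖u x‖ + ‖v x‖ + ‖v x‖) ^ p) μ := by
    have h1 := ((hu.norm.add hv.norm).add hv.norm).integrable_norm_rpow hpne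
      ENNReal.ofReal_ne_top
    rw [ENNReal.toReal_ofReal hp0.le] at h1
    refine (h1.const_mul p).congr (ae_of_all _ fun x => ?_)
    simp only [Pi.add_apply]
    rw [Real.norm_of_nonneg (by positivity)]
  have hd : ∀ (t : ℝ) (x : α), HasDerivAt (fun t : ℝ => ‖u x + t • v x‖ ^ p)
      (p * ‖u x + t • v x‖ ^ (p - 2) * inner ℝ (u x + t • v x) (v x)) t := by
    intro t x
    have h1 : HasDerivAt (fun t : ℝ => u x + t • v x) (v x) t := by
      simpa using ((hasDerivAt_id t).smul_const (v x)).const_add (u x)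
    have h2 := (hasFDerivAt_norm_rpow (u x + t • v x) (p := p) (by linarith)).comp_hasDerivAt t h1
    exact h2.congr_deriv (by rw [_root_.smul_apply, innerSL_apply_apply, smul_eq_mul])
  have hm0 : AEStronglyMeasurable
      (fun x => p * ‖u x + (0 : ℝ) • v x‖ ^ (p - 2) * inner ℝ (u x + (0 : ℝ) • v x) (v x)) μ := by
    have hu1 := hu.1.aemeasurable
    have hv1 := hv.1.aemeasurable
    refine AEMeasurable.aestronglyMeasurable ?_
    exact (((hu1.add (hv1.const_smul (0 : ℝ))).norm.pow_const (p - 2)).const_mul p).mul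
      ((hu1.add (hv1.const_smul (0 : ℝ))).inner hv1)
  have key := hasDerivAt_integral_of_dominated_loc_of_deriv_le (μ := μ) (𝕜 := ℝ)
    (F := fun t x => ‖u x + t • v x‖ ^ p) (x₀ := 0)
    (F' := fun t x => p * ‖u x + t • v x‖ ^ (p - 2) * inner ℝ (u x + t • v x) (v x))
    (bound := fun x => p * (‖u x‖ + ‖v x‖ + ‖v x‖) ^ p)
    (Metric.ball_mem_nhds (0 : ℝ) one_pos)
    (Eventually.of_forall fun t => (hint _ (hu.add (hv.const_smul t))).1)
    (by simpa using hint u hu) hm0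
    (ae_of_all _ fun x t ht => by
      have ht' : |t| ≤ 1 := by
        have := mem_ball_zero_iff.1 ht
        rw [Real.norm_eq_abs] at this; exact this.le
      have h1 : ‖u x + t • v x‖ ≤ ‖u x‖ + ‖v x‖ := by
        refine (norm_add_le _ _).trans ?_
        rw [norm_smul, Real.norm_eq_abs]
        gcongr
        exact mul_le_of_le_one_left (norm_nonneg _) ht'
      rw [norm_mul, norm_mul, Real.norm_of_nonneg hp0.le,
        Real.norm_of_nonneg (by positivity : 0 ≤ ‖u x + t • v x‖ ^ (p - 2)), mul_assoc]
      gcongr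
      calc _ ≤ ‖u x + t • v x‖ ^ (p - 2) * (‖u x + t • v x‖ * ‖v x‖) := by
            gcongr; exact norm_inner_le_norm _ _
        _ ≤ (‖u x + t • v x‖ + ‖v x‖) ^ p :=
            norm_rpow_mul_le hp (norm_nonneg _) (norm_nonneg _)
        _ ≤ _ := by gcongr)
    hbd (ae_of_all _ fun x t _ => hd t x)
  simp only [zero_smul, add_zero, mul_assoc] at key
  refine ⟨?_, ?_⟩
  · have := key.1.const_mul p⁻¹
    refine this.congr (ae_of_all _ fun x => ?_)
    field_simp
  · rw [← integral_const_mul]; exact key.2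

/-- The pairing of `|u|^(4/d) u` with `v`. -/
noncomputable def critPair (u v : EuclideanSpace ℝ (Fin d) → ℂ) : ℝ :=
  ∫ x, ‖u x‖ ^ (4 / (d : ℝ)) * inner ℝ (u x) (v x)

theorem two_le_crit (d : ℕ) : 2 ≤ 2 + 4 / (d : ℝ) := by
  linarith [(by positivity : 0 ≤ 4 / (d : ℝ))]

theorem hasDerivAt_potQ (hd : 1 ≤ d) {φ η : Phase d} (hφ : φ ∈ sigma d) (hη : η ∈ sigma d) :
    Integrable (fun x => ‖fnL d φ x‖ ^ (4 / (d : ℝ)) * inner ℝ (fnL d φ x) (fnL d η x)) ∧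
    HasDerivAt (fun t : ℝ => potQ d (φ + t • η))
      ((2 + 4 / (d : ℝ)) * critPair (fnL d φ) (fnL d η)) 0 := by
  obtain ⟨h1, h2⟩ := hasDerivAt_integral_norm_rpow (two_le_crit d) (memLp_crit hd hφ)
    (memLp_crit hd hη)
  rw [add_sub_cancel_left] at h1 h2
  refine ⟨h1, ?_⟩
  have e : (fun t : ℝ => potQ d (φ + t • η)) =
      fun t => ∫ x, ‖fnL d φ x + t • fnL d η x‖ ^ (2 + 4 / (d : ℝ)) := by
    ext t
    refine integral_congr_ae ?_
    rw [map_add, map_smul]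
    filter_upwards [Lp.coeFn_add (fnL d φ) (t • fnL d η), Lp.coeFn_smul t (fnL d η)] with x a b
    rw [a, Pi.add_apply, b, Pi.smul_apply]
  rw [e]; exact h2

theorem hasDerivAt_energyQ (ν : ℝ) (φ η : Phase d) :
    HasDerivAt (fun t : ℝ => energyQ d ν (φ + t • η))
      (1 / 2 * inner ℝ φ η - (1 / 2 + ν) * inner ℝ (fnL d φ) (fnL d η)) 0 := by
  have gen : ∀ {H : Type} [NormedAddCommGroup H] [InnerProductSpace ℝ H] (a b : H),
      HasDerivAt (fun t : ℝ => ‖a + t • b‖ ^ 2) (2 * inner ℝ a b) 0 := by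
    intro H _ _ a b
    have h1 : HasDerivAt (fun t : ℝ => a + t • b) b 0 := by
      simpa using ((hasDerivAt_id (0 : ℝ)).smul_const b).const_add a
    simpa using h1.norm_sq
  have h1 := ((gen φ η).const_mul (1 / 4)).sub
    ((gen (fnL d φ) (fnL d η)).const_mul (1 / 4 + ν / 2))
  have e : (fun t : ℝ => energyQ d ν (φ + t • η)) = fun t => 1 / 4 * ‖φ + t • η‖ ^ 2 -
      (1 / 4 + ν / 2) * ‖fnL d φ + t • fnL d η‖ ^ 2 := by
    ext t; rw [energyQ_eq, map_add, map_smul]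
  rw [e]
  exact h1.congr_deriv (by ring)

theorem potQ_smul (t : ℝ) (ht : 0 ≤ t) (f : Phase d) :
    potQ d (t • f) = t ^ (2 + 4 / (d : ℝ)) * potQ d f := by
  rw [potQ, potQ, ← integral_const_mul]
  refine integral_congr_ae ?_
  rw [map_smul]
  filter_upwards [Lp.coeFn_smul t (fnL d f)] with x hx
  rw [hx, Pi.smul_apply, norm_smul, Real.norm_of_nonneg ht,
    Real.mul_rpow ht (norm_nonneg _)]

theorem energyQ_smul (ν t : ℝ) (f : Phase d) : energyQ d ν (t • f) = t ^ 2 * energyQ d ν f := by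
  simp only [energyQ, map_smul, norm_smul, mul_pow, Real.norm_eq_abs, sq_abs]; ring

/-- Rescale f onto the constraint set and compare degrees of homogeneity. The constrained problem
becomes an unconstrained inequality, so no curve inside the constraint set has to be built. -/
theorem energyQ_ge_of_minimizer {ν c m : ℝ} (hc : 0 < c)
    (hmin : ∀ f ∈ radialSigma d, potQ d f = c → m ≤ energyQ d ν f) {f : Phase d}
    (hf : f ∈ radialSigma d) (hpos : 0 < potQ d f) :
    m * (potQ d f / c) ^ (2 / (2 + 4 / (d : ℝ))) ≤ energyQ d ν f := by
  have hp : 0 < 2 + 4 / (d : ℝ) := by positivity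
  set t := (c / potQ d f) ^ (1 / (2 + 4 / (d : ℝ))) with ht
  have ht0 : 0 < t := by positivity
  have h1 : potQ d (t • f) = c := by
    rw [potQ_smul _ ht0.le, ht, ← Real.rpow_mul (by positivity), one_div_mul_cancel hp.ne',
      Real.rpow_one, div_mul_cancel₀ _ hpos.ne']
  have h2 := hmin _ ((radialSigma d).smul_mem t hf) h1
  rw [energyQ_smul] at h2
  have h3 : (potQ d f / c) ^ (2 / (2 + 4 / (d : ℝ))) * t ^ 2 = 1 := by
    rw [ht, ← Real.rpow_natCast, ← Real.rpow_mul (by positivity),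
      show 1 / (2 + 4 / (d : ℝ)) * ((2 : ℕ) : ℝ) = 2 / (2 + 4 / (d : ℝ)) by push_cast; ring,
      ← Real.mul_rpow (by positivity) (by positivity)]
    rw [div_mul_div_cancel₀ hc.ne', div_self hpos.ne', Real.one_rpow]
  calc _ ≤ (t ^ 2 * energyQ d ν f) * (potQ d f / c) ^ (2 / (2 + 4 / (d : ℝ))) := by gcongr
    _ = energyQ d ν f * ((potQ d f / c) ^ (2 / (2 + 4 / (d : ℝ))) * t ^ 2) := by ring
    _ = _ := by rw [h3, mul_one]

/-- The Euler-Lagrange equation tested against radial directions. -/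
theorem euler_lagrange_radial (hd : 1 ≤ d) {ν c : ℝ} (hc : 0 < c) {φ : Phase d}
    (hφ : φ ∈ radialSigma d) (hφc : potQ d φ = c)
    (hmin : ∀ f ∈ radialSigma d, potQ d f = c → energyQ d ν φ ≤ energyQ d ν f) {η : Phase d}
    (hη : η ∈ radialSigma d) :
    inner ℝ φ η = (1 + 2 * ν) * inner ℝ (fnL d φ) (fnL d η) +
      4 * energyQ d ν φ / c * critPair (fnL d φ) (fnL d η) := by
  have hp : 0 < 2 + 4 / (d : ℝ) := by positivity
  set m := energyQ d ν φ with hm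
  obtain ⟨-, hN⟩ := hasDerivAt_potQ hd (mem_radialSigma_iff.1 hφ).1 (mem_radialSigma_iff.1 hη).1
  have hE := hasDerivAt_energyQ ν φ η
  have e0 : potQ d (φ + (0 : ℝ) • η) = c := by simp [hφc]
  have hP := ((hN.div_const c).rpow_const (p := 2 / (2 + 4 / (d : ℝ)))
    (Or.inl (by rw [e0, div_self hc.ne']; norm_num))).const_mul m
  have hD := hE.sub hP
  -- The difference vanishes at t = 0 and is nonnegative as long as the potential stays positive,
  -- which holds near 0 by continuity.
  have hlm : IsLocalMin ((fun t : ℝ => energyQ d ν (φ + t • η)) -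
      fun t => m * (potQ d (φ + t • η) / c) ^ (2 / (2 + 4 / (d : ℝ)))) 0 := by
    have hpos : ∀ᶠ t in 𝓝 (0 : ℝ), 0 < potQ d (φ + t • η) :=
      hN.continuousAt.eventually_const_lt (by simpa only [e0] using hc)
    filter_upwards [hpos] with t ht
    simp only [Pi.sub_apply, div_self hc.ne', Real.one_rpow, zero_smul, add_zero, mul_one, ← hm,
      sub_self, hφc]
    have := energyQ_ge_of_minimizer hc hmin
      ((radialSigma d).add_mem hφ ((radialSigma d).smul_mem t hη)) ht
    linarith
  have := hlm.hasDerivAt_eq_zero hD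
  rw [e0, div_self hc.ne', Real.one_rpow] at this
  field_simp at this ⊢
  linarith

/-! ### From radial to arbitrary directions -/

/-- Principle of symmetric criticality. -/
theorem symmetric_criticality {φ : Phase d} (hφ : φ ∈ radialSigma d) (L : sigma d →L[ℝ] ℝ)
    (hinv : ∀ (f f' : sigma d) (g : EuclideanSpace ℝ (Fin d) ≃ₗᵢ[ℝ] EuclideanSpace ℝ (Fin d)),
      (fnL d f' =ᵐ[volume] fun x => fnL d f (g x)) → L f' = L f)
    (h : ∀ η : sigma d, (η : Phase d) ∈ radialSigma d → inner ℝ φ (η : Phase d) = L η)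
    (η : sigma d) : inner ℝ φ (η : Phase d) = L η := by
  have : CompleteSpace (sigma d) := (isClosed_sigma d).completeSpace_coe
  set u := (InnerProductSpace.toDual ℝ (sigma d)).symm L with hu
  have huL : ∀ η : sigma d, inner ℝ (u : Phase d) (η : Phase d) = L η := fun η => by
    have := InnerProductSpace.toDual_symm_apply (𝕜 := ℝ) (x := η) (y := L)
    rw [← this, ← hu, Submodule.coe_inner]
  -- The Riesz representative of an invariant functional is invariant: u∘g has the norm of u, and
  -- ⟨u, u∘g⟩ = L(u∘g) = L(u) = ‖u‖², so ‖u∘g - u‖ = 0.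
  have huR : (u : Phase d) ∈ radialSigma d := by
    refine mem_radialSigma_iff.2 ⟨u.2, fun g => ?_⟩
    obtain ⟨f', hf', h1, h2⟩ := exists_comp_isometry u.2 g
    have e1 : inner ℝ (u : Phase d) f' = ‖(u : Phase d)‖ ^ 2 := by
      rw [huL ⟨f', hf'⟩, hinv u ⟨f', hf'⟩ g h1, ← huL u, real_inner_self_eq_norm_sq]
    have e2 : ‖f' - u‖ ^ 2 = 0 := by
      rw [norm_sub_sq_real, real_inner_comm, e1, h2]; ring
    have e3 : f' = u := by simpa [sub_eq_zero] using e2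
    rw [e3] at h1; exact h1.symm
  have hs := (mem_radialSigma_iff.1 hφ).1
  have hz : ∀ η : sigma d, (η : Phase d) ∈ radialSigma d →
      inner ℝ (φ - u) (η : Phase d) = 0 := fun η hη => by
    rw [inner_sub_left, h η hη, huL, sub_self]
  -- φ - u is radial and orthogonal to every radial element, hence to itself.
  have e := hz ⟨φ - u, (sigma d).sub_mem hs u.2⟩ ((radialSigma d).sub_mem hφ huR)
  have e' : φ = u := by simpa [sub_eq_zero] using e
  rw [e']; exact huL η

theorem norm_rpow_mul_le_add {p a b : ℝ} (hp : 2 ≤ p) (ha : 0 ≤ a) (hb : 0 ≤ b) :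
    a ^ (p - 2) * (a * b) ≤ a ^ p + b ^ p := by
  rcases le_total a b with h | h
  · refine le_add_of_nonneg_of_le (by positivity) ?_
    rw [← rpow_mul_self_self hp hb]
    have : a ^ (p - 2) ≤ b ^ (p - 2) := Real.rpow_le_rpow ha h (by linarith)
    gcongr
  · refine le_add_of_le_of_nonneg ?_ (by positivity)
    rw [← rpow_mul_self_self hp ha]
    gcongr

/-- A bound on the unit sphere suffices for continuity because the pairing is linear in η; the crude
a^(p-1) b ≤ a^p + b^p replaces Hölder. -/
theorem abs_critPair_le (hd : 1 ≤ d) {φ : Phase d} (hφ : φ ∈ sigma d) :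
    ∃ K : ℝ, ∀ η ∈ sigma d, ‖η‖ = 1 → |critPair (fnL d φ) (fnL d η)| ≤ K := by
  obtain ⟨C, hC0, hC⟩ := exists_lintegral_crit_bound hd 1
  refine ⟨potQ d φ + C, fun η hη h1 => ?_⟩
  have hηC : potQ d η ≤ C := by
    have := hC η hη h1.le
    rw [lintegral_eq_potQ hd hη] at this
    exact (ENNReal.ofReal_le_ofReal_iff hC0).1 this
  have i1 := integrable_crit (memLp_crit hd hφ)
  have i2 := integrable_crit (memLp_crit hd hη)
  calc |critPair (fnL d φ) (fnL d η)|
      ≤ ∫ x, (‖fnL d φ x‖ ^ (2 + 4 / (d : ℝ)) + ‖fnL d η x‖ ^ (2 + 4 / (d : ℝ))) := by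
        rw [← Real.norm_eq_abs]
        refine norm_integral_le_of_norm_le (i1.add i2) (ae_of_all _ fun x => ?_)
        have := norm_rpow_mul_le_add (two_le_crit d) (norm_nonneg (fnL d φ x))
          (norm_nonneg (fnL d η x))
        rw [add_sub_cancel_left] at this
        refine le_trans ?_ this
        rw [norm_mul, Real.norm_of_nonneg (by positivity)]
        gcongr
        exact norm_inner_le_norm _ _
    _ = potQ d φ + potQ d η := integral_add i1 i2
    _ ≤ _ := by gcongr

theorem critPair_add_right (hd : 1 ≤ d) {φ a b : Phase d} (hφ : φ ∈ sigma d) (ha : a ∈ sigma d)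
    (hb : b ∈ sigma d) : critPair (fnL d φ) (fnL d (a + b)) =
      critPair (fnL d φ) (fnL d a) + critPair (fnL d φ) (fnL d b) := by
  simp only [critPair]
  rw [← integral_add (hasDerivAt_potQ hd hφ ha).1 (hasDerivAt_potQ hd hφ hb).1, map_add]
  refine integral_congr_ae ?_
  filter_upwards [Lp.coeFn_add (fnL d a) (fnL d b)] with x hx
  rw [hx, Pi.add_apply, inner_add_right, mul_add]

theorem critPair_smul_right (φ a : Phase d) (t : ℝ) :
    critPair (fnL d φ) (fnL d (t • a)) = t * critPair (fnL d φ) (fnL d a) := by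
  simp only [critPair]
  rw [map_smul, ← integral_const_mul]
  refine integral_congr_ae ?_
  filter_upwards [Lp.coeFn_smul t (fnL d a)] with x hx
  rw [hx, Pi.smul_apply, real_inner_smul_right]; ring

theorem exists_critPair_clm (hd : 1 ≤ d) {φ : Phase d} (hs : φ ∈ sigma d) :
    ∃ B : sigma d →L[ℝ] ℝ, ∀ η : sigma d,
      B η = critPair (fnL d φ) (fnL d (η : Phase d)) := by
  obtain ⟨K, hK⟩ := abs_critPair_le hd hs
  let B : sigma d →ₗ[ℝ] ℝ :=
    { toFun := fun η => critPair (fnL d φ) (fnL d (η : Phase d))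
      map_add' := fun a b => critPair_add_right hd hs a.2 b.2
      map_smul' := fun t a => critPair_smul_right φ a t }
  exact ⟨B.mkContinuous (K / 1) fun x =>
    LinearMap.bound_of_sphere_bound one_pos K B (fun z hz => by
      rw [Real.norm_eq_abs]
      exact hK z z.2 (by simpa using hz)) x, fun η => rfl⟩

theorem clm_combination_apply {H : Type*} [NormedAddCommGroup H] [NormedSpace ℝ H] (a b : ℝ)
    (K L : H →L[ℝ] ℝ) (x : H) : (a • K + b • L) x = a * K x + b * L x := rfl

theorem integral_comp_isometry
    (g : EuclideanSpace ℝ (Fin d) ≃ₗᵢ[ℝ] EuclideanSpace ℝ (Fin d))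
    (F : EuclideanSpace ℝ (Fin d) → ℝ) : ∫ x, F (g x) = ∫ x, F x :=
  g.measurePreserving.integral_comp' (f := g.toHomeomorph.toMeasurableEquiv) F

theorem inner_eq_of_comp_isometry {u v v' : L2C d}
    (g : EuclideanSpace ℝ (Fin d) ≃ₗᵢ[ℝ] EuclideanSpace ℝ (Fin d))
    (hu : (fun x => u (g x)) =ᵐ[volume] u) (hv : v' =ᵐ[volume] fun x => v (g x)) :
    inner ℝ u v' = inner ℝ u v := by
  rw [L2.inner_def, L2.inner_def, ← integral_comp_isometry g fun x => inner ℝ (u x) (v x)]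
  refine integral_congr_ae ?_
  filter_upwards [hu, hv] with x a b
  rw [a, b]

theorem critPair_eq_of_comp_isometry {u v v' : EuclideanSpace ℝ (Fin d) → ℂ}
    (g : EuclideanSpace ℝ (Fin d) ≃ₗᵢ[ℝ] EuclideanSpace ℝ (Fin d))
    (hu : (fun x => u (g x)) =ᵐ[volume] u) (hv : v' =ᵐ[volume] fun x => v (g x)) :
    critPair u v' = critPair u v := by
  rw [critPair, critPair, ← integral_comp_isometry g fun x =>
    ‖u x‖ ^ (4 / (d : ℝ)) * inner ℝ (u x) (v x)]
  refine integral_congr_ae ?_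
  filter_upwards [hu, hv] with x a b
  rw [a, b]

/-- The Euler-Lagrange equation tested against arbitrary elements of `Σ`. -/
theorem euler_lagrange (hd : 1 ≤ d) {ν c : ℝ} (hc : 0 < c) {φ : Phase d}
    (hφ : φ ∈ radialSigma d) (hφc : potQ d φ = c)
    (hmin : ∀ f ∈ radialSigma d, potQ d f = c → energyQ d ν φ ≤ energyQ d ν f) {η : Phase d}
    (hη : η ∈ sigma d) :
    inner ℝ φ η = (1 + 2 * ν) * inner ℝ (fnL d φ) (fnL d η) +
      4 * energyQ d ν φ / c * critPair (fnL d φ) (fnL d η) := by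
  have hs := (mem_radialSigma_iff.1 hφ).1
  obtain ⟨L, hL⟩ : ∃ L : sigma d →L[ℝ] ℝ, ∀ η : sigma d,
      L η = (1 + 2 * ν) * inner ℝ (fnL d φ) (fnL d (η : Phase d)) +
        4 * energyQ d ν φ / c * critPair (fnL d φ) (fnL d (η : Phase d)) := by
    obtain ⟨B, hB⟩ := exists_critPair_clm hd hs
    refine ⟨(1 + 2 * ν) • ((innerSL ℝ (fnL d φ)).comp ((fnL d).comp (sigma d).subtypeL)) +
      (4 * energyQ d ν φ / c) • B, fun η => ?_⟩
    rw [clm_combination_apply, hB]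
    rfl
  -- `L` is invariant because φ is: a change of variables by g moves the isometry from the direction
  -- onto φ, which absorbs it.
  have := symmetric_criticality hφ L (fun f f' g h => ?_) (fun η hη => ?_) ⟨η, hη⟩
  · rw [this, hL]
  · have hg := (mem_radialSigma_iff.1 hφ).2 g
    have e1 := inner_eq_of_comp_isometry g hg h
    have e2 := critPair_eq_of_comp_isometry (u := fnL d φ) (v := fnL d (f : Phase d))
      (v' := fnL d (f' : Phase d)) g hg h
    exact (hL f').trans ((congrArg₂ (fun s t => (1 + 2 * ν) * s + 4 * energyQ d ν φ / c * t)
      e1 e2).trans (hL f).symm)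
  · rw [hL]; exact euler_lagrange_radial hd hc hφ hφc hmin hη

/-! ### The equation in the sense of distributions -/

/-- The classical gradient of a real function, times a complex constant. -/
noncomputable def classGrad (v : EuclideanSpace ℝ (Fin d) → ℝ) (z : ℂ)
    (x : EuclideanSpace ℝ (Fin d)) : EuclideanSpace ℂ (Fin d) :=
  WithLp.toLp 2 fun j => fderiv ℝ v x (EuclideanSpace.single j 1) • z

theorem continuous_classGrad {v : EuclideanSpace ℝ (Fin d) → ℝ} (hv : ContDiff ℝ 1 v) (z : ℂ) :
    Continuous (classGrad v z) := by
  have h : ∀ j : Fin d, Continuous fun x => fderiv ℝ v x (EuclideanSpace.single j 1) := fun j =>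
    (hv.continuous_fderiv (by simp)).clm_apply continuous_const
  unfold classGrad
  fun_prop

theorem isWeakGrad_classGrad {v : EuclideanSpace ℝ (Fin d) → ℝ} (hv : ContDiff ℝ 1 v) (z : ℂ) :
    IsWeakGrad (fun x => v x • z) (classGrad v z) := by
  refine ⟨(hv.continuous.smul continuous_const).locallyIntegrable,
    (continuous_classGrad hv z).locallyIntegrable, fun η hη j => ?_⟩
  have hv' : Continuous fun x => fderiv ℝ v x (EuclideanSpace.single j 1) :=
    (hv.continuous_fderiv (by simp)).clm_apply continuous_const
  have i1 := (hη.fderiv_apply (EuclideanSpace.single j 1)).integrable_smul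
    hv.continuous.locallyIntegrable
  have i2 := hη.integrable_smul hv'.locallyIntegrable
  have i3 := hη.integrable_smul hv.continuous.locallyIntegrable
  have key := integral_mul_fderiv_eq_neg_fderiv_mul_of_integrable i1 i2 i3
    (fun x _ => hη.1.differentiable (by simp) x) (fun x _ => hv.differentiable (by simp) x)
  have e1 : ∫ x, fderiv ℝ η x (EuclideanSpace.single j 1) • v x • z =
      (∫ x, fderiv ℝ η x (EuclideanSpace.single j 1) * v x) • z := by
    rw [← integral_smul_const]; simp only [smul_smul]
  have e2 : ∫ x, η x • classGrad v z x j =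
      (∫ x, η x * fderiv ℝ v x (EuclideanSpace.single j 1)) • z := by
    rw [← integral_smul_const]; simp only [smul_smul, classGrad]
  rw [e1, e2, key, neg_smul, neg_neg]

theorem exists_classical_mem_sigma {v : EuclideanSpace ℝ (Fin d) → ℝ} (hv : ContDiff ℝ 1 v)
    (z : ℂ) (h0 : MemLp v 2) (h1 : MemLp (classGrad v z) 2) (h2 : MemLp (fun x => ‖x‖ * v x) 2) :
    ∃ f ∈ sigma d, (fnL d f =ᵐ[volume] fun x => v x • z) ∧ gradL d f =ᵐ[volume] classGrad v z ∧
      wtL d f =ᵐ[volume] fun x => ‖x‖ • v x • z := by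
  refine exists_mem_sigma ?_ (isWeakGrad_classGrad hv z) h1 ?_
  · exact (ContinuousLinearMap.smulRight (1 : ℝ →L[ℝ] ℝ) z).comp_memLp' h0
  · have := (ContinuousLinearMap.smulRight (1 : ℝ →L[ℝ] ℝ) z).comp_memLp' h2
    simpa [Function.comp_def, mul_assoc] using this

theorem IsTestFun.exists_mem_sigma {η : EuclideanSpace ℝ (Fin d) → ℝ} (hη : IsTestFun η) (z : ℂ) :
    ∃ f ∈ sigma d, (fnL d f =ᵐ[volume] fun x => η x • z) ∧ gradL d f =ᵐ[volume] classGrad η z ∧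
      wtL d f =ᵐ[volume] fun x => ‖x‖ • η x • z := by
  have h1 : ContDiff ℝ 1 η := hη.1.of_le (by simp)
  refine exists_classical_mem_sigma h1 z (hη.memLp 2) ?_ hη.norm_mul_memLp
  refine (continuous_classGrad h1 z).memLp_of_hasCompactSupport ?_
  refine (hη.2.fderiv (𝕜 := ℝ)).mono fun x hx => ?_
  rw [Function.mem_support] at hx ⊢
  contrapose! hx
  ext j; simp [classGrad, hx]

theorem laplacian_eq_sum_fderiv {η : EuclideanSpace ℝ (Fin d) → ℝ} (hη : IsTestFun η)
    (x : EuclideanSpace ℝ (Fin d)) :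
    (Δ η) x = ∑ j : Fin d, fderiv ℝ (fun y => fderiv ℝ η y (EuclideanSpace.single j 1)) x
      (EuclideanSpace.single j 1) := by
  rw [InnerProductSpace.laplacian_eq_iteratedFDeriv_orthonormalBasis η
    (EuclideanSpace.basisFun (Fin d) ℝ)]
  refine Finset.sum_congr rfl fun j _ => ?_
  have hd : DifferentiableAt ℝ (fderiv ℝ η) x :=
    (hη.1.fderiv_right (m := ∞) (by simp)).differentiable (by simp) x
  rw [iteratedFDeriv_two_apply, fderiv_clm_apply hd (by fun_prop)]
  simp

theorem IsWeakGrad.integral_laplacian {u : EuclideanSpace ℝ (Fin d) → ℂ}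
    {G : EuclideanSpace ℝ (Fin d) → EuclideanSpace ℂ (Fin d)} (hG : IsWeakGrad u G)
    {η : EuclideanSpace ℝ (Fin d) → ℝ} (hη : IsTestFun η) :
    Integrable (fun x => (Δ η) x • u x) ∧
    ∫ x, (Δ η) x • u x =
      -∑ j : Fin d, ∫ x, fderiv ℝ η x (EuclideanSpace.single j 1) • G x j := by
  have hi : ∀ j : Fin d, Integrable fun x =>
      fderiv ℝ (fun y => fderiv ℝ η y (EuclideanSpace.single j 1)) x
        (EuclideanSpace.single j 1) • u x := fun j =>
    ((hη.fderiv_apply _).fderiv_apply _).integrable_smul hG.1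
  simp_rw [laplacian_eq_sum_fderiv hη, Finset.sum_smul]
  refine ⟨integrable_finsetSum _ fun j _ => hi j, ?_⟩
  rw [integral_finsetSum _ fun j _ => hi j, ← Finset.sum_neg_distrib]
  exact Finset.sum_congr rfl fun j _ => hG.2.2 _ (hη.fderiv_apply _) j

theorem eq_of_forall_inner_right {a b : ℂ} (h : ∀ z : ℂ, inner ℝ a z = inner ℝ b z) : a = b :=
  ext_inner_right ℝ h

theorem integral_inner_const {w : EuclideanSpace ℝ (Fin d) → ℂ} (hw : Integrable w) (z : ℂ) :
    ∫ x, inner ℝ (w x) z = inner ℝ (∫ x, w x) z := by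
  simp_rw [real_inner_comm z]
  exact integral_inner hw z

/-- The directions η z with z complex turn real inner products into a complex-valued integral paired
with z. Here the weak gradient, tested against the derivatives of η, produces the Laplacian. -/
theorem inner_gradL_eq {φ e : Phase d} {η : EuclideanSpace ℝ (Fin d) → ℝ} (hη : IsTestFun η)
    (hφ : φ ∈ sigma d) {z : ℂ} (he : gradL d e =ᵐ[volume] classGrad η z) :
    inner ℝ (gradL d φ) (gradL d e) = -inner ℝ (∫ x, (Δ η) x • fnL d φ x) z := by
  have hG := (mem_sigma_iff.1 hφ).1
  have hi : ∀ j : Fin d, Integrable fun x =>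
      fderiv ℝ η x (EuclideanSpace.single j 1) • gradL d φ x j := fun j =>
    (hη.fderiv_apply _).integrable_smul (locallyIntegrable_coord hG.2.1 j)
  rw [(hG.integral_laplacian hη).2, inner_neg_left, neg_neg, sum_inner, L2.inner_def]
  simp_rw [← integral_inner_const (hi _) z]
  rw [← integral_finsetSum _ fun j _ => (hi j).inner_const z]
  refine integral_congr_ae ?_
  filter_upwards [he] with x hx
  rw [hx, PiLp.inner_apply]
  refine Finset.sum_congr rfl fun j _ => ?_
  simp only [classGrad]
  rw [real_inner_smul_left, real_inner_smul_right]

theorem inner_fnL_eq {φ e : Phase d} {η : EuclideanSpace ℝ (Fin d) → ℝ} (hη : IsTestFun η) {z : ℂ}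
    (he : fnL d e =ᵐ[volume] fun x => η x • z) :
    inner ℝ (fnL d φ) (fnL d e) = inner ℝ (∫ x, η x • fnL d φ x) z := by
  rw [← integral_inner_const (hη.integrable_smul (memLp_two_locallyIntegrable (Lp.memLp _))),
    L2.inner_def]
  refine integral_congr_ae ?_
  filter_upwards [he] with x hx
  rw [hx, real_inner_smul_left, real_inner_smul_right]

theorem IsTestFun.normSq_mul {η : EuclideanSpace ℝ (Fin d) → ℝ} (hη : IsTestFun η) :
    IsTestFun (fun x => ‖x‖ ^ 2 * η x) :=
  ⟨(contDiff_norm_sq ℝ).mul hη.1, hη.2.mul_left⟩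

theorem inner_wtL_eq {φ e : Phase d} {η : EuclideanSpace ℝ (Fin d) → ℝ} (hη : IsTestFun η) {z : ℂ}
    (hφ : φ ∈ sigma d) (he : wtL d e =ᵐ[volume] fun x => ‖x‖ • η x • z) :
    inner ℝ (wtL d φ) (wtL d e) = inner ℝ (∫ x, (‖x‖ ^ 2 * η x) • fnL d φ x) z := by
  rw [← integral_inner_const
    (hη.normSq_mul.integrable_smul (memLp_two_locallyIntegrable (Lp.memLp _))), L2.inner_def]
  refine integral_congr_ae ?_
  filter_upwards [he, (mem_sigma_iff.1 hφ).2] with x hx h2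
  rw [hx, h2]
  simp only [real_inner_smul_left, real_inner_smul_right]; ring

/-- The nonlinearity is dominated by |φ|^(2+4/d) + |φ|, according to whether |φ| exceeds 1. -/
theorem locallyIntegrable_nonlin (hd : 1 ≤ d) {φ : Phase d} (hφ : φ ∈ sigma d) :
    LocallyIntegrable (nonlin (fnL d φ)) := by
  have h := integrable_crit (memLp_crit hd hφ)
  have h1 : LocallyIntegrable
      (fun x => ‖fnL d φ x‖ ^ (2 + 4 / (d : ℝ)) + ‖fnL d φ x‖) :=
    h.locallyIntegrable.add (memLp_two_locallyIntegrable (Lp.memLp (fnL d φ)).norm)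
  have hm : AEMeasurable (fnL d φ) := (Lp.memLp (fnL d φ)).1.aemeasurable
  refine h1.mono ?_ (ae_of_all _ fun x => ?_)
  · refine AEMeasurable.aestronglyMeasurable ?_
    exact (Complex.measurable_ofReal.comp_aemeasurable (hm.norm.pow_const _)).mul hm
  · rw [nonlin, norm_mul, Complex.norm_real, Real.norm_of_nonneg (by positivity),
      Real.norm_of_nonneg (by positivity)]
    set a := ‖fnL d φ x‖
    have ha : 0 ≤ a := norm_nonneg _
    rcases le_total a 1 with h | h
    · refine le_add_of_nonneg_of_le (by positivity) ?_
      exact mul_le_of_le_one_left ha (Real.rpow_le_one ha h (by positivity))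
    · refine le_add_of_le_of_nonneg ?_ ha
      have e : a ^ (2 + 4 / (d : ℝ)) = a ^ (4 / (d : ℝ)) * a ^ 2 := by
        rw [← Real.rpow_natCast, ← Real.rpow_add (by linarith)]; congr 1; push_cast; ring
      rw [e]
      gcongr
      nlinarith

theorem critPair_eq (hd : 1 ≤ d) {φ e : Phase d} {η : EuclideanSpace ℝ (Fin d) → ℝ}
    (hη : IsTestFun η) {z : ℂ} (hφ : φ ∈ sigma d)
    (he : fnL d e =ᵐ[volume] fun x => η x • z) :
    critPair (fnL d φ) (fnL d e) = inner ℝ (∫ x, η x • nonlin (fnL d φ) x) z := by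
  rw [← integral_inner_const (hη.integrable_smul (locallyIntegrable_nonlin hd hφ)), critPair]
  refine integral_congr_ae ?_
  filter_upwards [he] with x hx
  rw [hx, nonlin, ← Complex.real_smul]
  simp only [real_inner_smul_left, real_inner_smul_right]; ring

theorem integral_smul_combination {a b : EuclideanSpace ℝ (Fin d) → ℂ} (ha : Integrable a)
    (hb : Integrable b) (s t : ℝ) :
    ∫ x, (s • a x + t • b x) = s • (∫ x, a x) + t • ∫ x, b x := by
  rw [← integral_smul, ← integral_smul]
  exact integral_add (ha.smul s) (hb.smul t)

/-- A minimizer solves the Euler-Lagrange equation in the sense of distributions. -/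
theorem harmonicEq_of_minimizer (hd : 1 ≤ d) {ν c : ℝ} (hc : 0 < c) {φ : Phase d}
    (hφ : φ ∈ radialSigma d) (hφc : potQ d φ = c)
    (hmin : ∀ f ∈ radialSigma d, potQ d f = c → energyQ d ν φ ≤ energyQ d ν f) :
    HarmonicEq (fnL d φ) (fun x => ν • fnL d φ x +
      (2 * energyQ d ν φ / c) • nonlin (fnL d φ) x) := by
  have hs := (mem_radialSigma_iff.1 hφ).1
  have l1 : LocallyIntegrable (fnL d φ) := memLp_two_locallyIntegrable (Lp.memLp _)
  have l2 := locallyIntegrable_nonlin hd hs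
  refine ⟨l1, (l1.smul ν).add (l2.smul (2 * energyQ d ν φ / c)), fun η hη => ?_⟩
  have iL := ((mem_sigma_iff.1 hs).1.integral_laplacian hη).1
  have iN := hη.normSq_mul.integrable_smul l1
  have i1 := hη.integrable_smul l1
  have i2 := hη.integrable_smul l2
  have eL : ∫ x, (-(1 / 2) * (Δ η) x + ‖x‖ ^ 2 / 2 * η x) • fnL d φ x =
      (-(1 / 2) : ℝ) • (∫ x, (Δ η) x • fnL d φ x) +
        (1 / 2 : ℝ) • ∫ x, (‖x‖ ^ 2 * η x) • fnL d φ x := by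
    rw [← integral_smul_combination iL iN]
    refine integral_congr_ae (ae_of_all _ fun x => ?_)
    simp only [smul_smul, ← add_smul]; congr 1; ring
  have eR : ∫ x, η x • (ν • fnL d φ x + (2 * energyQ d ν φ / c) • nonlin (fnL d φ) x) =
      ν • (∫ x, η x • fnL d φ x) +
        (2 * energyQ d ν φ / c) • ∫ x, η x • nonlin (fnL d φ) x := by
    rw [← integral_smul_combination i1 i2]
    refine integral_congr_ae (ae_of_all _ fun x => ?_)
    simp only [smul_add]
    rw [smul_comm ν, smul_comm (2 * energyQ d ν φ / c)]
  rw [eL, eR]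
  -- Letting z range over ℂ recovers the complex identity. The L² part of the Hilbert product
  -- cancels the `1` in `1 + 2ν`, and halving what remains gives the equation for H.
  refine eq_of_forall_inner_right fun z => ?_
  obtain ⟨e, he, h1, h2, h3⟩ := hη.exists_mem_sigma z
  have key := euler_lagrange hd hc hφ hφc hmin he
  rw [inner_eq, inner_gradL_eq hη hs h2, inner_wtL_eq hη hs h3, inner_fnL_eq hη h1,
    critPair_eq hd hη hs h1] at key
  simp only [inner_add_left, real_inner_smul_left]
  have e4 : 4 * energyQ d ν φ / c = 2 * (2 * energyQ d ν φ / c) := by ring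
  rw [e4] at key
  linarith

/-! ### The Gaussian competitor -/

/-- The ground state `exp (-|x|²/2)` of the harmonic oscillator. -/
noncomputable def gaussian (x : EuclideanSpace ℝ (Fin d)) : ℝ := Real.exp (-‖x‖ ^ 2 / 2)

theorem contDiff_gaussian : ContDiff ℝ ∞ (gaussian (d := d)) := by
  unfold gaussian
  exact (((contDiff_norm_sq ℝ).neg).div_const 2).exp

theorem fderiv_gaussian (x h : EuclideanSpace ℝ (Fin d)) :
    fderiv ℝ gaussian x h = -inner ℝ x h * gaussian x := by
  have h1 : HasFDerivAt (fun x : EuclideanSpace ℝ (Fin d) => ‖x‖ ^ 2) (2 • innerSL ℝ x) x :=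
    (hasStrictFDerivAt_norm_sq x).hasFDerivAt
  have h2 := ((h1.neg).mul_const (2⁻¹ : ℝ)).exp
  have h3 : HasFDerivAt gaussian _ x := h2
  rw [h3.fderiv]
  simp [gaussian, div_eq_mul_inv]
  ring

theorem integrable_exp_neg_norm_sq {b : ℝ} (hb : 0 < b) :
    Integrable (fun x : EuclideanSpace ℝ (Fin d) => Real.exp (-b * ‖x‖ ^ 2)) := by
  have h := GaussianFourier.integrable_cexp_neg_mul_sq_norm_add
    (V := EuclideanSpace ℝ (Fin d)) (b := (b : ℂ)) (by simpa using hb) 0 0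
  refine h.norm.congr (ae_of_all _ fun x => ?_)
  simp only [Complex.norm_exp, zero_mul, add_zero]
  congr 1
  have : (-(b : ℂ) * (‖x‖ : ℂ) ^ 2) = ((-b * ‖x‖ ^ 2 : ℝ) : ℂ) := by push_cast; ring
  rw [this, Complex.ofReal_re]

theorem gaussian_sq (x : EuclideanSpace ℝ (Fin d)) : gaussian x ^ 2 = Real.exp (-1 * ‖x‖ ^ 2) := by
  rw [gaussian, ← Real.exp_nat_mul]; congr 1; push_cast; ring

theorem integrable_gaussian_sq : Integrable (fun x : EuclideanSpace ℝ (Fin d) => gaussian x ^ 2) := by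
  simp_rw [gaussian_sq]
  exact integrable_exp_neg_norm_sq one_pos

theorem integrable_mul_gaussian_sq {F : EuclideanSpace ℝ (Fin d) → ℝ} (hF : Continuous F)
    (hb : ∀ x, |F x| ≤ ‖x‖ ^ 2) : Integrable (fun x => F x * gaussian x ^ 2) := by
  refine ((integrable_exp_neg_norm_sq (d := d) (b := 1 / 2) (by norm_num)).const_mul 2).mono'
    (hF.mul (contDiff_gaussian.continuous.pow 2)).aestronglyMeasurable (ae_of_all _ fun x => ?_)
  rw [norm_mul, Real.norm_eq_abs, Real.norm_of_nonneg (by positivity), gaussian_sq]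
  have h1 : ‖x‖ ^ 2 ≤ 2 * Real.exp (1 / 2 * ‖x‖ ^ 2) := by
    have := Real.add_one_le_exp (1 / 2 * ‖x‖ ^ 2)
    linarith
  calc |F x| * Real.exp (-1 * ‖x‖ ^ 2)
      ≤ (2 * Real.exp (1 / 2 * ‖x‖ ^ 2)) * Real.exp (-1 * ‖x‖ ^ 2) := by
        gcongr; exact (hb x).trans h1
    _ = 2 * Real.exp (-(1 / 2) * ‖x‖ ^ 2) := by
        rw [mul_assoc, ← Real.exp_add]; congr 2; ring

theorem abs_coord_le_norm (x : EuclideanSpace ℝ (Fin d)) (j : Fin d) : |x j| ≤ ‖x‖ := by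
  simpa using PiLp.norm_apply_le x j

theorem integrable_coord_sq_mul_gaussian_sq (j : Fin d) :
    Integrable (fun x : EuclideanSpace ℝ (Fin d) => x j ^ 2 * gaussian x ^ 2) := by
  refine integrable_mul_gaussian_sq (by fun_prop) fun x => ?_
  rw [abs_pow]
  gcongr
  exact abs_coord_le_norm x j

/-- Integrate by parts the product of x_j g and g in direction e_j, where ∂_j g = -x_j g. -/
theorem integral_coord_sq_mul_gaussian_sq (j : Fin d) :
    2 * ∫ x : EuclideanSpace ℝ (Fin d), x j ^ 2 * gaussian x ^ 2 =
      ∫ x : EuclideanSpace ℝ (Fin d), gaussian x ^ 2 := by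
  have i0 := integrable_gaussian_sq (d := d)
  have i2 := integrable_coord_sq_mul_gaussian_sq j
  have i1 : Integrable (fun x : EuclideanSpace ℝ (Fin d) => x j * gaussian x ^ 2) := by
    refine (i0.add i2).mono' ?_ (ae_of_all _ fun x => ?_)
    · have := contDiff_gaussian (d := d) |>.continuous
      exact (by fun_prop : Continuous _).aestronglyMeasurable
    · rw [norm_mul, Real.norm_eq_abs, Real.norm_of_nonneg (sq_nonneg _), Pi.add_apply]
      have : |x j| ≤ 1 + x j ^ 2 := by rw [← sq_abs (x j)]; nlinarith [sq_nonneg (|x j| - 1)]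
      nlinarith [sq_nonneg (gaussian x)]
  have hg : ∀ x : EuclideanSpace ℝ (Fin d), fderiv ℝ gaussian x (EuclideanSpace.single j 1) =
      -(x j) * gaussian x := fun x => by
    rw [fderiv_gaussian, EuclideanSpace.inner_single_right]; simp
  have hdg : ∀ x : EuclideanSpace ℝ (Fin d), DifferentiableAt ℝ gaussian x := fun x =>
    contDiff_gaussian.differentiable (by simp) x
  have hc : ∀ x : EuclideanSpace ℝ (Fin d),
      HasFDerivAt (fun y : EuclideanSpace ℝ (Fin d) => y j)
        (EuclideanSpace.proj (𝕜 := ℝ) j) x := fun x =>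
    (EuclideanSpace.proj (𝕜 := ℝ) j).hasFDerivAt
  have hf : ∀ x : EuclideanSpace ℝ (Fin d),
      fderiv ℝ (fun y : EuclideanSpace ℝ (Fin d) => y j * gaussian y) x
        (EuclideanSpace.single j 1) = gaussian x - x j ^ 2 * gaussian x := fun x => by
    have h : HasFDerivAt (fun y : EuclideanSpace ℝ (Fin d) => y j * gaussian y) _ x :=
      (hc x).mul (hdg x).hasFDerivAt
    rw [h.fderiv]
    simp [hg]; ring
  have key := integral_mul_fderiv_eq_neg_fderiv_mul_of_integrable (μ := volume)
    (f := fun y : EuclideanSpace ℝ (Fin d) => y j * gaussian y) (g := gaussian)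
    (v := EuclideanSpace.single j 1)
    ((i0.sub i2).congr (ae_of_all _ fun x => by simp only [hf, Pi.sub_apply]; ring))
    (i2.neg.congr (ae_of_all _ fun x => by simp only [hg, Pi.neg_apply]; ring))
    (i1.congr (ae_of_all _ fun x => by simp only []; ring))
    (fun x _ => (hc x).differentiableAt.mul (hdg x)) (fun x _ => hdg x)
  have e1 : ∫ x : EuclideanSpace ℝ (Fin d), x j * gaussian x *
      fderiv ℝ gaussian x (EuclideanSpace.single j 1) =
      -∫ x : EuclideanSpace ℝ (Fin d), x j ^ 2 * gaussian x ^ 2 := by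
    rw [← integral_neg]; congr 1; ext x; rw [hg]; ring
  have e2 : ∫ x : EuclideanSpace ℝ (Fin d),
      fderiv ℝ (fun y : EuclideanSpace ℝ (Fin d) => y j * gaussian y) x
        (EuclideanSpace.single j 1) * gaussian x =
      (∫ x : EuclideanSpace ℝ (Fin d), gaussian x ^ 2) -
        ∫ x : EuclideanSpace ℝ (Fin d), x j ^ 2 * gaussian x ^ 2 := by
    rw [← integral_sub i0 i2]; congr 1; ext x; rw [hf]; ring
  rw [e1, e2] at key
  linarith

theorem integral_norm_sq_mul_gaussian_sq :
    2 * ∫ x : EuclideanSpace ℝ (Fin d), ‖x‖ ^ 2 * gaussian x ^ 2 =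
      d * ∫ x : EuclideanSpace ℝ (Fin d), gaussian x ^ 2 := by
  have e : ∫ x : EuclideanSpace ℝ (Fin d), ‖x‖ ^ 2 * gaussian x ^ 2 =
      ∑ j, ∫ x : EuclideanSpace ℝ (Fin d), x j ^ 2 * gaussian x ^ 2 := by
    rw [← integral_finsetSum _ fun j _ => integrable_coord_sq_mul_gaussian_sq j]
    simp [EuclideanSpace.norm_sq_eq, Finset.sum_mul]
  rw [e, Finset.mul_sum]
  simp [integral_coord_sq_mul_gaussian_sq]

theorem norm_classGrad_gaussian (x : EuclideanSpace ℝ (Fin d)) :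
    ‖classGrad gaussian 1 x‖ ^ 2 = ‖x‖ ^ 2 * gaussian x ^ 2 := by
  rw [EuclideanSpace.norm_sq_eq, EuclideanSpace.norm_sq_eq, Finset.sum_mul]
  refine Finset.sum_congr rfl fun j _ => ?_
  simp only [classGrad, fderiv_gaussian, norm_smul, EuclideanSpace.inner_single_right]
  simp [mul_pow]

/-- The Gaussian belongs to the radial part of `Σ`, with energy `(d/2 - ν)/2 ‖ψ‖²`. -/
theorem exists_gaussian_mem (hd : 1 ≤ d) : ∃ f ∈ radialSigma d, 0 < potQ d f ∧ ∃ Y : ℝ, 0 < Y ∧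
    ∀ ν, energyQ d ν f = 1 / 2 * ((d : ℝ) / 2 - ν) * Y := by
  have hcont := contDiff_gaussian (d := d) |>.continuous
  have hC1 : ContDiff ℝ 1 (gaussian (d := d)) := contDiff_gaussian.of_le (by simp)
  have i0 := integrable_gaussian_sq (d := d)
  have i2 : Integrable (fun x : EuclideanSpace ℝ (Fin d) => ‖x‖ ^ 2 * gaussian x ^ 2) :=
    integrable_mul_gaussian_sq (by fun_prop) fun x => by rw [abs_of_nonneg (by positivity)]
  have m0 : MemLp (gaussian (d := d)) 2 :=
    (memLp_two_iff_integrable_sq hcont.aestronglyMeasurable).2 i0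
  have m2 : MemLp (fun x : EuclideanSpace ℝ (Fin d) => ‖x‖ * gaussian x) 2 :=
    (memLp_two_iff_integrable_sq (continuous_norm.mul hcont).aestronglyMeasurable).2
      (i2.congr (ae_of_all _ fun x => (mul_pow _ _ _).symm))
  have m1 : MemLp (classGrad (gaussian (d := d)) 1) 2 := by
    refine m2.mono (continuous_classGrad hC1 1).aestronglyMeasurable (ae_of_all _ fun x => ?_)
    rw [← sq_le_sq₀ (norm_nonneg _) (norm_nonneg _), norm_classGrad_gaussian, Real.norm_eq_abs,
      sq_abs, mul_pow]
  obtain ⟨f, hf, h1, h2, h3⟩ := exists_classical_mem_sigma hC1 1 m0 m1 m2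
  have hpos : ∀ x : EuclideanSpace ℝ (Fin d), 0 < gaussian x := fun x => Real.exp_pos _
  have n1 : ‖fnL d f‖ ^ 2 = ∫ x : EuclideanSpace ℝ (Fin d), gaussian x ^ 2 := by
    rw [L2_norm_sq]; refine integral_congr_ae ?_
    filter_upwards [h1] with x hx; rw [hx, norm_smul]; simp
  have n2 : ‖gradL d f‖ ^ 2 = ∫ x : EuclideanSpace ℝ (Fin d), ‖x‖ ^ 2 * gaussian x ^ 2 := by
    rw [L2_norm_sq]; refine integral_congr_ae ?_
    filter_upwards [h2] with x hx; rw [hx, norm_classGrad_gaussian]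
  have n3 : ‖wtL d f‖ ^ 2 = ∫ x : EuclideanSpace ℝ (Fin d), ‖x‖ ^ 2 * gaussian x ^ 2 := by
    rw [L2_norm_sq]; refine integral_congr_ae ?_
    filter_upwards [h3] with x hx; rw [hx, norm_smul, norm_smul]; simp [mul_pow]
  refine ⟨f, mem_radialSigma_iff.2 ⟨hf, fun g => ?_⟩, ?_,
    ∫ x : EuclideanSpace ℝ (Fin d), gaussian x ^ 2, ?_, fun ν => ?_⟩
  · have := g.measurePreserving.quasiMeasurePreserving.ae_eq_comp h1
    filter_upwards [this, h1] with x a b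
    simp only [Function.comp_apply] at a
    rw [a, b, gaussian, gaussian, g.norm_map]
  · rw [potQ_eq h1]
    have hi := integrable_crit ((memLp_congr_ae h1).1 (memLp_crit hd hf))
    rw [integral_pos_iff_support_of_nonneg (fun x => by positivity) hi]
    have : Function.support (fun x : EuclideanSpace ℝ (Fin d) =>
        ‖gaussian x • (1 : ℂ)‖ ^ (2 + 4 / (d : ℝ))) = Set.univ := by
      refine Set.eq_univ_of_forall fun x => ?_
      have : 0 < ‖gaussian x • (1 : ℂ)‖ := by
        rw [norm_pos_iff]; simp [(hpos x).ne']
      exact (Real.rpow_pos_of_pos this _).ne'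
    rw [this]; exact isOpen_univ.measure_pos _ Set.univ_nonempty
  · rw [integral_pos_iff_support_of_nonneg (fun x => sq_nonneg _) i0]
    have : Function.support (fun x : EuclideanSpace ℝ (Fin d) => gaussian x ^ 2) = Set.univ :=
      Set.eq_univ_of_forall fun x => (pow_pos (hpos x) 2).ne'
    rw [this]; exact isOpen_univ.measure_pos _ Set.univ_nonempty
  · have := integral_norm_sq_mul_gaussian_sq (d := d)
    rw [energyQ, n1, n2, n3]; linear_combination this / 4

/-- Scaling adjusts the constraint without changing the sign of the energy, which is that of d/2 -
ν. -/
theorem exists_scaled_gaussian (hd : 1 ≤ d) {c : ℝ} (hc : 0 < c) : ∃ f ∈ radialSigma d,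
    potQ d f = c ∧ ∀ ν, (d : ℝ) / 2 < ν → energyQ d ν f < 0 := by
  obtain ⟨f, hf, hp, Y, hY, hE⟩ := exists_gaussian_mem hd
  have hp0 : 0 < 2 + 4 / (d : ℝ) := by positivity
  have ht : 0 < (c / potQ d f) ^ (1 / (2 + 4 / (d : ℝ))) := by positivity
  refine ⟨_, (radialSigma d).smul_mem ((c / potQ d f) ^ (1 / (2 + 4 / (d : ℝ)))) hf, ?_,
    fun ν hν => ?_⟩
  · rw [potQ_smul _ ht.le, ← Real.rpow_mul (by positivity), one_div_mul_cancel hp0.ne',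
      Real.rpow_one, div_mul_cancel₀ _ hp.ne']
  · rw [energyQ_smul, hE]
    have : 0 < (ν - d / 2) * Y := mul_pos (by linarith) hY
    have h2 := mul_pos (pow_pos ht 2) this
    linarith

/-! ### Sign of the minimum, scaling and conclusion -/

theorem fnL_ne_zero_of_potQ_pos {f : Phase d} (h : 0 < potQ d f) : 0 < ‖fnL d f‖ := by
  rw [norm_pos_iff]
  intro h0
  have : potQ d f = 0 := by
    rw [potQ, h0]
    refine integral_eq_zero_of_ae ?_
    filter_upwards [Lp.coeFn_zero ℂ 2 (volume : Measure (EuclideanSpace ℝ (Fin d)))] with x hx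
    rw [hx]
    simp [Real.zero_rpow (by positivity : (2 + 4 / (d : ℝ)) ≠ 0)]
  linarith

theorem energyQ_pos {ν : ℝ} (hν : ν < (d : ℝ) / 2) {f : Phase d} (hf : f ∈ sigma d)
    (h : 0 < potQ d f) : 0 < energyQ d ν f := by
  have h1 := (mem_sigma_iff.1 hf).1.ground_state_bound (Lp.memLp _) (Lp.memLp _)
    (memLp_norm_smul_fn hf)
  have e : ∫ x, ‖x‖ ^ 2 * ‖fnL d f x‖ ^ 2 = ‖wtL d f‖ ^ 2 := by
    rw [L2_norm_sq]; refine integral_congr_ae ?_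
    filter_upwards [(mem_sigma_iff.1 hf).2] with x hx
    rw [hx, norm_smul, norm_norm, mul_pow]
  rw [e, ← L2_norm_sq, ← L2_norm_sq] at h1
  have h2 := mul_pos (sub_pos.2 hν) (pow_pos (fnL_ne_zero_of_potQ_pos h) 2)
  rw [energyQ]
  linarith

theorem HarmonicEq.congr_ae {u u' F F' : EuclideanSpace ℝ (Fin d) → ℂ} (h : HarmonicEq u F)
    (hu : u =ᵐ[volume] u') (hF : F =ᵐ[volume] F') : HarmonicEq u' F' := by
  refine ⟨h.1.congr hu, h.2.1.congr hF, fun η hη => ?_⟩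
  rw [integral_congr_ae (g := fun x => (-(1 / 2) * (Δ η) x + ‖x‖ ^ 2 / 2 * η x) • u x),
    h.2.2 η hη]
  · refine integral_congr_ae ?_
    filter_upwards [hF] with x hx; rw [hx]
  · filter_upwards [hu] with x hx; rw [hx]

theorem HarmonicEq.smul {u F : EuclideanSpace ℝ (Fin d) → ℂ} (h : HarmonicEq u F) (c : ℝ) :
    HarmonicEq (fun x => c • u x) (fun x => c • F x) := by
  refine ⟨h.1.smul c, h.2.1.smul c, fun η hη => ?_⟩
  simp_rw [smul_comm _ c, integral_smul, h.2.2 η hη]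

theorem nonlin_smul {c : ℝ} (hc : 0 ≤ c) (u : EuclideanSpace ℝ (Fin d) → ℂ)
    (x : EuclideanSpace ℝ (Fin d)) :
    nonlin (fun x => c • u x) x = (c ^ (4 / (d : ℝ)) * c) • nonlin u x := by
  have h : ‖c • u x‖ = c * ‖u x‖ := by rw [norm_smul, Real.norm_of_nonneg hc]
  rw [nonlin, nonlin, h, Real.mul_rpow hc (norm_nonneg _)]
  simp only [Complex.real_smul]
  push_cast; ring

/-- A minimizer with nonzero energy yields, after scaling, a solution of the nonlinear equation
in which the sign of the nonlinearity is the sign of the energy. -/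
theorem exists_solution (hd : 1 ≤ d) {ν s : ℝ} {φ : Phase d} (hφ : φ ∈ radialSigma d)
    (hφc : potQ d φ = 1 + 2 / (d : ℝ))
    (hmin : ∀ f ∈ radialSigma d, potQ d f = 1 + 2 / (d : ℝ) → energyQ d ν φ ≤ energyQ d ν f)
    (hm : energyQ d ν φ ≠ 0) (hs : energyQ d ν φ = |energyQ d ν φ| * s) :
    ∃ ψ : EuclideanSpace ℝ (Fin d) → ℂ, MemSigma ψ ∧ ¬ (ψ =ᵐ[volume] 0) ∧
      (∀ x, ψ (-x) = ψ x) ∧ HarmonicEq ψ (fun x => (ν : ℂ) * ψ x + (s : ℂ) * nonlin ψ x) ∧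
      FromMinimizer ν ψ := by
  have hd' : (0 : ℝ) < d := by exact_mod_cast hd
  have hc0 : 0 < 1 + 2 / (d : ℝ) := by positivity
  have hsig := (mem_radialSigma_iff.1 hφ).1
  obtain ⟨φ₀, hφ₀, hae⟩ := exists_mem_constraintSet hd hφ hφc
  obtain ⟨F, hF⟩ := hφ₀.2.1
  -- Scaling by c divides the coefficient of the nonlinearity by c^(4/d), so this choice leaves only
  -- the sign s.
  set c := (2 * |energyQ d ν φ| / (1 + 2 / (d : ℝ))) ^ ((d : ℝ) / 4) with hc
  have hbase : 0 < 2 * |energyQ d ν φ| / (1 + 2 / (d : ℝ)) := by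
    have := abs_pos.2 hm
    positivity
  have hcpos : 0 < c := Real.rpow_pos_of_pos hbase _
  have hcpow : c ^ (4 / (d : ℝ)) = 2 * |energyQ d ν φ| / (1 + 2 / (d : ℝ)) := by
    rw [hc, ← Real.rpow_mul hbase.le, div_mul_div_cancel₀' hd'.ne', div_self (by norm_num),
      Real.rpow_one]
  refine ⟨fun x => c • φ₀ x, ?_, ?_, fun x => ?_, ?_, φ₀, hφ₀, ?_, c, hcpos, fun x => rfl⟩
  · refine memSigma_of_ae_eq ((sigma d).smul_mem c hsig) ?_
    rw [map_smul]
    filter_upwards [Lp.coeFn_smul c (fnL d φ), hae] with x a b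
    rw [a, Pi.smul_apply, b]
  · intro h0
    have h1 := hφ₀.2.2
    have : ∫ x, ‖φ₀ x‖ ^ (2 + 4 / (d : ℝ)) = 0 := by
      refine integral_eq_zero_of_ae ?_
      filter_upwards [h0] with x hx
      have : φ₀ x = 0 := by simpa [hcpos.ne'] using hx
      rw [this]
      simp [Real.zero_rpow (by positivity : (2 + 4 / (d : ℝ)) ≠ 0)]
    rw [this, mul_zero] at h1
    exact zero_ne_one h1
  · simp only [hF, norm_neg]
  · refine ((harmonicEq_of_minimizer hd hc0 hφ hφc hmin).smul c).congr_ae ?_ ?_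
    · filter_upwards [hae] with x hx; rw [hx]
    · filter_upwards [hae] with x hx
      have e1 : nonlin (fnL d φ) x = nonlin φ₀ x := by rw [nonlin, nonlin, hx]
      rw [nonlin_smul hcpos.le, hcpow, e1, hx]
      have e2 : 2 * energyQ d ν φ / (1 + 2 / (d : ℝ)) =
          2 * |energyQ d ν φ| / (1 + 2 / (d : ℝ)) * s := by
        conv_lhs => rw [hs]
        ring
      rw [e2]
      simp only [Complex.real_smul]
      push_cast; ring
  · rw [isMinOn_iff]
    intro ψ hψ
    obtain ⟨f, hf, hfc, hfae⟩ := exists_of_mem_constraintSet hd hψ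
    rw [energy_eq_energyQ hsig hae, energy_eq_energyQ (mem_radialSigma_iff.1 hf).1 hfae]
    exact hmin f hf hfc

end HarmonicNLS

theorem mainTheorem3 (d : ℕ) (hd : 1 ≤ d) (ν : ℝ) :
    ((d : ℝ) / 2 < ν →
      ∃ ψ : EuclideanSpace ℝ (Fin d) → ℂ,
        HarmonicNLS.MemSigma ψ ∧ ¬ (ψ =ᵐ[volume] 0) ∧ (∀ x, ψ (-x) = ψ x) ∧
        HarmonicNLS.HarmonicEq ψ (fun x => (ν : ℂ) * ψ x - HarmonicNLS.nonlin ψ x) ∧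
        HarmonicNLS.FromMinimizer ν ψ) ∧
    (ν < (d : ℝ) / 2 →
      ∃ ψ : EuclideanSpace ℝ (Fin d) → ℂ,
        HarmonicNLS.MemSigma ψ ∧ ¬ (ψ =ᵐ[volume] 0) ∧ (∀ x, ψ (-x) = ψ x) ∧
        HarmonicNLS.HarmonicEq ψ (fun x => (ν : ℂ) * ψ x + HarmonicNLS.nonlin ψ x) ∧
        HarmonicNLS.FromMinimizer ν ψ) := by
  have hc : 0 < 1 + 2 / (d : ℝ) := by positivity
  -- The Gaussian serves twice: it shows that the constraint set is nonempty, and for ν > d/2 it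
  -- makes the minimum negative.
  obtain ⟨g, hg, hgc, hgE⟩ := HarmonicNLS.exists_scaled_gaussian hd hc
  obtain ⟨φ, hφ, hφc, hmin⟩ := HarmonicNLS.exists_minimizer hd ν hc.le ⟨g, hg, hgc⟩
  constructor
  · intro hν
    have hneg : HarmonicNLS.energyQ d ν φ < 0 := (hmin g hg hgc).trans_lt (hgE ν hν)
    have := HarmonicNLS.exists_solution hd hφ hφc hmin hneg.ne (s := -1)
      (by rw [abs_of_neg hneg]; ring)
    simpa [sub_eq_add_neg] using this
  · intro hν
    have hpos : 0 < HarmonicNLS.energyQ d ν φ :=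
      HarmonicNLS.energyQ_pos hν (HarmonicNLS.mem_radialSigma_iff.1 hφ).1 (by rw [hφc]; exact hc)
    have := HarmonicNLS.exists_solution hd hφ hφc hmin hpos.ne' (s := 1)
      (by rw [abs_of_pos hpos]; ring)
    simpa using this
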